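/- **Model.** Time is $\mathbb Z$. Locations are the addresses ($\mathbb N$) together with the shared variables $Head$, $Tail$ and, for each process $p$, the local variables $n1_p,n2_p,n3_p,res_p,pc_p$. A state assigns a value and, for each process, a permission in $[0,1]_{\mathbb Q}$ to every location; $p$ may write to a location iff its permission is $1$ and may read it iff its permission lies strictly between $0$ and $1$. A stream is a map from time to states that is healthy: permissions on a location sum up to at most $1$, a location changes its value in the step to time $t$ only if some process has write permission to it at $t$, and only $p$ ever has write permission to a local variable of $p$. An interval is a contiguous set of times. The chop $(g_1;g_2)$ holds on $\Delta$ iff $\Delta$ splits into adjoining (possibly empty) intervals satisfying $g_1$ and $g_2$, or $\Delta$ is unbounded above and satisfies $g_1$; $g^\omega$ is the greatest fixed point of $z=(g;z)\vee\mathsf{empty}$. **Commands.** The behaviour $beh_{P,Z}.C$ of a command $C$ executed by processes $P$ in context $Z$ (a set of locations) is an interval predicate. Idling: no process of $P$ writes to $Z$. A guard $[c]$ of $p$: $p$ idles, and $c$ is true in some state apparent to $p$, i.e. one composed of values of the accessed locations that $p$ may read at possibly different times of the interval. An atomic guard $\langle c\rangle$: $p$ idles and $c$ holds in some actual state of the interval.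 An assignment: an evaluation of this apparent kind, followed by a non-empty interval in which the process has write permission to the target, the target holds the value, and nothing else in $Z$ is written. Sequence is chop, choice is disjunction, iteration is $^\omega$; a context adds its (disjoint) locations to $Z$; $\mathsf{Rely}\,r\bullet C$ behaves as $r\Rightarrow beh.C$; a label $l$ adds $pc_p=l$ throughout. Parallel composition is conjunction: an empty composition is unconstrained, a singleton behaves as its component, and otherwise $P$ splits into two disjoint non-empty parts, each executing its components followed by finite or infinite idling, not both by infinite idling (for infinite $P$: every process executes its component followed by idling, and in an interval unbounded above some component takes the whole interval). **The lazy set.** Nodes have the fields $val,nxt,mrk,lck$ at four consecutive addresses. $\mathsf{Contains}(p,x)$ is $CL\,;\;cl_3: res_p:=IN$ with $$CL = cl_1:n1_p:=Head\;;\;cl_2:\bigl(([n1_p.val<x]\,;\,n1_p:=n1_p.nxt)^\omega\,;\,[n1_p.val\ge x]\bigr),\qquad IN=\neg\, n1_p.mrk\wedge n1_p.val=x .$$ $\mathsf{Add}(p,x)$ and $\mathsf{Remove}(p,x)$ are the lock-based add and remove operations of Heller et al.'s lazy set: optimistic search from $Head$, locking of predecessor and current node, validation (both unmarked and adjacent)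 with retry, insertion of a new node between them, resp. marking and then unlinking of the current node, assignment of the result to $res_p$, and unlocking. Acquiring a lock waits, possibly for ever, and then writes the process identifier into a lock that is $null$ in the immediately preceding state; releasing a lock assigns $null$. A new node is created at an address whose block has never been written before in the stream and does not overlap the nodes $Head$ and $Tail$, with all its fields initialised to $(x,null,false,null)$ together. Let $HT=\mathbb N\cup\{Head,Tail\}$ (all addresses, and the two shared variables), and $$\mathsf S(p)=\text{context }\{n1_p,n2_p,n3_p,res_p\}:\ \Bigl(\bigsqcap_{x\in\mathbb Z}\mathsf{Add}(p,x)\sqcap\mathsf{Remove}(p,x)\sqcap\mathsf{Contains}(p,x)\Bigr)^\omega,$$ $$\mathsf{Set}(P)=\text{context }HT:\ \mathsf{Rely}\,g\bullet\big\|_{p\in P}\mathsf S(p),$$ where $g$ says that at the beginning of the interval the list consists of exactly the unmarked, unlocked nodes $Head$ (value $-\infty$, next node $Tail$) and $Tail$ (value $\infty$, next $null$), and that in the interval no process outside $P$ writes to $HT$. **Abstraction.** $absSet$ of a state is the set of values of the unmarked nodes reachable from $Head$ along $nxt$. Put $$\mathsf{CGCon}(p,x)=(\langle x\in absSet\rangle\,;\,res_p:=true)\sqcap(\langle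 x\notin absSet\rangle\,;\,res_p:=false).$$ $\mathsf{CGS}(p)$ is the process with context $\{res_p\}$ that iterates ($^\omega$) the choice, over $x\in\mathbb Z$, of $\mathsf{Add}(p,x)\sqcap\mathsf{Remove}(p,x)$ in context $\{n1_p,n2_p,n3_p\}$ and $\mathsf{CGCon}(p,x)$; and $\mathsf{CGSet}(P)=\text{context }HT:\mathsf{Rely}\,g\bullet\|_{p\in P}\mathsf{CGS}(p)$. **Theorem.** Let $P$ be any set of processes. 1. $\mathsf{CGSet}(P)\sqsubseteq_P\mathsf{Set}(P)$: for every interval and stream, $beh_{P,\emptyset}.\mathsf{Set}(P)$ implies $beh_{P,\emptyset}.\mathsf{CGSet}(P)$. 2. Suppose that $g$ and $beh_{P,HT}.(\|_{q\in P}\mathsf S(q))$ hold on an interval $\Delta$ in a stream. Let $p\in P$ and let $\Delta'\subseteq\Delta$ be an interval. (a) If $\mathsf S(p)$ (in context $HT$, executed by $p$) holds on $\Delta'$, then so does $\mathsf{CGS}(p)$. (b) Let $x\in\mathbb Z$, let $\Delta'$ be bounded above, $L=HT\cup\{res_p\}$ and $M=L\cup\{n1_p,n2_p,n3_p\}$.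 If $beh_{p,M}.(CL\,;\,cl_3:[IN])$ holds on $\Delta'$ (a run of `contains(x)` that returns true, up to the assignment of the result), then so does $beh_{p,L}.\langle x\in absSet\rangle$; in particular $x\in absSet$ in some actual state of $\Delta'$. If $beh_{p,M}.(CL\,;\,cl_3:[\neg IN])$ holds on $\Delta'$ (a run that returns false, up to the assignment), then so does $beh_{p,L}.\langle x\notin absSet\rangle$; in particular $x\notin absSet$ in some actual state of $\Delta'$. -/

import Mathlib

namespace LazySet

universe u

/-! ### Values, locations, states -/

/-- Fields of a node object. -/
inductive Field
  | val | nxt | mrk | lck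

/-- Offset of a field within the block of four consecutive addresses of a node. -/
def Field.offset : Field → ℕ
  | .val => 0
  | .nxt => 1
  | .mrk => 2
  | .lck => 3

/-- Program labels. -/
inductive Label
  | cl1 | cl2 | cl3
  | al1 | alt2 | alf2 | al3 | al4 | al5 | al6 | al7 | al8 | al9
  | rl1 | rlt2 | rlf2 | rl3 | rl4 | rl5 | rl6 | rl7 | rl8 | rl9

/-- Integers together with `-∞` and `∞`. -/
abbrev Key : Type := WithBot (WithTop ℤ)

/-- Values. Addresses are natural numbers, and every address is a value. -/
inductive Val (Proc : Type u) : Type u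
  | addr (a : ℕ)
  | key (k : Key)
  | bool (b : Bool)
  | null
  | proc (p : Proc)
  | lab (l : Label)

/-- Variables: the shared `Head` and `Tail` and, for each process, its program variables and its
program counter. -/
inductive Var (Proc : Type u) : Type u
  | Head | Tail
  | n1 (p : Proc) | n2 (p : Proc) | n3 (p : Proc) | res (p : Proc) | pc (p : Proc)

/-- The process to which a variable is local, if any. -/
def Var.owner {Proc : Type u} : Var Proc → Option Proc
  | .Head => none
  | .Tail => none
  | .n1 p => some p
  | .n2 p => some p
  | .n3 p => some p
  | .res p => some p
  | .pc p => some p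

/-- A location is a variable or an address. -/
abbrev Loc (Proc : Type u) : Type u := Var Proc ⊕ ℕ

/-- A state: a value for each location, and the permission variable. -/
structure State (Proc : Type u) : Type u where
  mem : Loc Proc → Val Proc
  perm : Loc Proc → Proc → Set.Icc (0 : ℚ) 1

abbrev StatePred (Proc : Type u) : Type u := State Proc → Prop

/-- Read permission. -/
def CanRead {Proc : Type u} (va : Loc Proc) (p : Proc) : StatePred Proc :=
  fun σ => 0 < (σ.perm va p : ℚ) ∧ (σ.perm va p : ℚ) < 1

/-- Write permission. -/
def CanWrite {Proc : Type u} (va : Loc Proc) (p : Proc) : StatePred Proc :=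
  fun σ => (σ.perm va p : ℚ) = 1

/-- Interference on `VA` by processes outside `P`. -/
def Interference {Proc : Type u} (VA : Set (Loc Proc)) (P : Set Proc) : StatePred Proc :=
  fun σ => ∃ va ∈ VA, ∃ q, q ∉ P ∧ CanWrite va q σ

/-! ### Expressions -/

inductive Expr (Proc : Type u) : Type u
  | const (v : Val Proc)
  | var (v : Var Proc)
  | deref (e : Expr Proc)
  | fld (e : Expr Proc) (f : Field)
  | not (e : Expr Proc)
  | and (e₁ e₂ : Expr Proc)
  | eq (e₁ e₂ : Expr Proc)
  | lt (e₁ e₂ : Expr Proc)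
  | le (e₁ e₂ : Expr Proc)

/-- `e ↦ f`, the value stored in field `f` of the node at address `e`. -/
def Expr.at {Proc : Type u} (e : Expr Proc) (f : Field) : Expr Proc := .deref (.fld e f)

def Expr.key {Proc : Type u} (k : Key) : Expr Proc := .const (.key k)

open Classical in
/-- Evaluation in a state that is defined on part of the locations. The result is `none` if a
location outside the domain of the state is needed, or an operand has the wrong type. -/
noncomputable def Expr.eval {Proc : Type u} (σ : Loc Proc → Option (Val Proc)) :
    Expr Proc → Option (Val Proc)
  | .const v => some v
  | .var v => σ (Sum.inl v)
  | .deref e =>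
    match e.eval σ with
    | some (.addr a) => σ (Sum.inr a)
    | _ => none
  | .fld e f =>
    match e.eval σ with
    | some (.addr a) => some (.addr (a + f.offset))
    | _ => none
  | .not e =>
    match e.eval σ with
    | some (.bool b) => some (.bool (!b))
    | _ => none
  | .and e₁ e₂ =>
    match e₁.eval σ, e₂.eval σ with
    | some (.bool b), some (.bool c) => some (.bool (b && c))
    | _, _ => none
  | .eq e₁ e₂ =>
    match e₁.eval σ, e₂.eval σ with
    | some v, some w => some (.bool (decide (v = w)))
    | _, _ => none
  | .lt e₁ e₂ =>
    match e₁.eval σ, e₂.eval σ with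
    | some (.key k), some (.key l) => some (.bool (decide (k < l)))
    | _, _ => none
  | .le e₁ e₂ =>
    match e₁.eval σ, e₂.eval σ with
    | some (.key k), some (.key l) => some (.bool (decide (k ≤ l)))
    | _, _ => none

/-- Evaluation in a (total) state. -/
noncomputable def Expr.evalIn {Proc : Type u} (σ : State Proc) (e : Expr Proc) :
    Option (Val Proc) :=
  e.eval (fun va => some (σ.mem va))

/-- A Boolean expression as a state predicate. -/
def Expr.holds {Proc : Type u} (e : Expr Proc) : StatePred Proc :=
  fun σ => e.evalIn σ = some (.bool true)

/-- The locations that are accessed when `e` is evaluated in `σ`. -/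
def Expr.accessed {Proc : Type u} (σ : State Proc) : Expr Proc → Set (Loc Proc)
  | .const _ => ∅
  | .var v => {Sum.inl v}
  | .deref e => e.accessed σ ∪ {va | ∃ a : ℕ, e.evalIn σ = some (.addr a) ∧ va = Sum.inr a}
  | .fld e _ => e.accessed σ
  | .not e => e.accessed σ
  | .and e₁ e₂ => e₁.accessed σ ∪ e₂.accessed σ
  | .eq e₁ e₂ => e₁.accessed σ ∪ e₂.accessed σ
  | .lt e₁ e₂ => e₁.accessed σ ∪ e₂.accessed σ
  | .le e₁ e₂ => e₁.accessed σ ∪ e₂.accessed σ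

/-! ### Intervals, streams, interval predicates -/

/-- A discrete interval: a contiguous (possibly empty or unbounded) set of times. -/
abbrev Intv : Type := {Δ : Set ℤ // Δ.OrdConnected}

/-- The least upper bound is `∞`. -/
def Intv.IsInf (Δ : Intv) : Prop := ¬ BddAbove Δ.1

def Intv.IsFin (Δ : Intv) : Prop := ¬ Δ.IsInf

def Intv.IsEmpty (Δ : Intv) : Prop := Δ.1 = ∅

/-- `Δ₁` adjoins `Δ₂`. -/
def Adjoins (Δ₁ Δ₂ : Intv) : Prop :=
  (∀ t ∈ Δ₁.1, ∀ u ∈ Δ₂.1, t < u) ∧ (Δ₁.1 ∪ Δ₂.1).OrdConnected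

abbrev Stream (Proc : Type u) : Type u := ℤ → State Proc

/-- Healthiness conditions on streams. -/
structure Healthy {Proc : Type u} (s : Stream Proc) : Prop where
  /-- The permissions on a location sum up to at most one. -/
  perm_sum : ∀ (t : ℤ) (va : Loc Proc) (F : Finset Proc), ∑ p ∈ F, ((s t).perm va p : ℚ) ≤ 1
  /-- A location keeps its value in the step to time `t` unless some process has write
  permission to it at `t`. -/
  frame : ∀ (t : ℤ) (va : Loc Proc),
    (s t).mem va ≠ (s (t - 1)).mem va → ∃ p, CanWrite va p (s t)
  /-- A variable that is local to a process is written by that process only. -/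
  own : ∀ (t : ℤ) (v : Var Proc) (p q : Proc),
    v.owner = some p → CanWrite (Sum.inl v) q (s t) → q = p

abbrev IntvPred (Proc : Type u) : Type u := Intv → Stream Proc → Prop

/-- Universal implication, over all intervals and all healthy streams. -/
def Entails {Proc : Type u} (g₁ g₂ : IntvPred Proc) : Prop :=
  ∀ (Δ : Intv) (s : Stream Proc), Healthy s → g₁ Δ s → g₂ Δ s

/-- Chop. -/
def chop {Proc : Type u} (g₁ g₂ : IntvPred Proc) : IntvPred Proc := fun Δ s =>
  (∃ Δ₁ Δ₂ : Intv, Δ.1 = Δ₁.1 ∪ Δ₂.1 ∧ Adjoins Δ₁ Δ₂ ∧ g₁ Δ₁ s ∧ g₂ Δ₂ s) ∨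
    (Δ.IsInf ∧ g₁ Δ s)

theorem chop_mono {Proc : Type u} {g₁ g₁' g₂ g₂' : IntvPred Proc} (h₁ : g₁ ≤ g₁')
    (h₂ : g₂ ≤ g₂') : chop g₁ g₂ ≤ chop g₁' g₂' := by
  rintro Δ s (⟨Δ₁, Δ₂, hu, ha, k₁, k₂⟩ | ⟨hi, k₁⟩)
  · exact Or.inl ⟨Δ₁, Δ₂, hu, ha, h₁ _ _ k₁, h₂ _ _ k₂⟩
  · exact Or.inr ⟨hi, h₁ _ _ k₁⟩

/-- Possibly infinite iteration: the greatest fixed point of `z = (g ; z) ∨ empty`. -/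
def omega {Proc : Type u} (g : IntvPred Proc) : IntvPred Proc :=
  OrderHom.gfp
    { toFun := fun z => chop g z ⊔ fun Δ _ => Δ.IsEmpty
      monotone' := fun _ _ h => sup_le_sup_right (chop_mono le_rfl h) _ }

/-- `c` holds in all actual states. -/
def allStates {Proc : Type u} (c : StatePred Proc) : IntvPred Proc :=
  fun Δ s => ∀ t ∈ Δ.1, c (s t)

/-- `c` holds in some actual state. -/
def someState {Proc : Type u} (c : StatePred Proc) : IntvPred Proc :=
  fun Δ s => ∃ t ∈ Δ.1, c (s t)

/-- `c` holds at the beginning of the interval. -/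
def atStart {Proc : Type u} (c : StatePred Proc) : IntvPred Proc :=
  chop (fun Δ s => allStates c Δ s ∧ ¬ Δ.IsEmpty) (fun _ _ => True)

/-- `c` holds at the end of the interval. -/
def atEnd {Proc : Type u} (c : StatePred Proc) : IntvPred Proc :=
  chop (fun _ _ => True) (fun Δ s => allStates c Δ s ∧ ¬ Δ.IsEmpty)

/-- `g` holds in some immediately preceding interval. -/
def previously {Proc : Type u} (g : IntvPred Proc) : IntvPred Proc :=
  fun Δ s => ∃ Δ' : Intv, Adjoins Δ' Δ ∧ g Δ' s

/-- The locations accessed by `c` during the interval. -/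
def locs {Proc : Type u} (c : Expr Proc) (Δ : Intv) (s : Stream Proc) : Set (Loc Proc) :=
  {va | ∃ t ∈ Δ.1, va ∈ c.accessed (s t)}

/-- The states over `W` (partial states with domain `W`) that are apparent to `p`: each location
in `W` is read, with read permission, at some time of the interval. -/
def apparent {Proc : Type u} (p : Proc) (W : Set (Loc Proc)) (Δ : Intv) (s : Stream Proc) :
    Set (Loc Proc → Option (Val Proc)) :=
  {σ | (∀ va ∈ W, ∃ t ∈ Δ.1, σ va = some ((s t).mem va) ∧ CanRead va p (s t)) ∧
    ∀ va, va ∉ W → σ va = none}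

/-- `c` possibly holds: it is true in some state apparent to `p`. -/
def possibly {Proc : Type u} (p : Proc) (c : Expr Proc) : IntvPred Proc :=
  fun Δ s => ∃ σ ∈ apparent p (locs c Δ s) Δ s, c.eval σ = some (.bool true)

/-! ### Commands and their behaviour -/

inductive Cmd (Proc : Type u) : Type u
  | idle
  /-- guard `[c]` -/
  | guard (c : Expr Proc)
  /-- atomically evaluated guard `⟨c⟩` -/
  | aguard (c : StatePred Proc)
  /-- assignment to a variable -/
  | assign (v : Var Proc) (e : Expr Proc)
  /-- assignment to the address given by an address-valued expression -/
  | assignAt (ae e : Expr Proc)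
  | seq (C₁ C₂ : Cmd Proc)
  | choice (C₁ C₂ : Cmd Proc)
  /-- choice over all integers -/
  | choiceInt (C : ℤ → Cmd Proc)
  | iter (C : Cmd Proc)
  | par (P : Set Proc) (C : Proc → Cmd Proc)
  | context (Z : Set (Loc Proc)) (C : Cmd Proc)
  | label (l : Label) (C : Cmd Proc)
  | rely (r : IntvPred Proc) (C : Cmd Proc)
  | enf (g : IntvPred Proc) (C : Cmd Proc)
  /-- acquire the lock stored at the address given by an address-valued expression -/
  | lock (ae : Expr Proc)
  /-- allocate a node with value `x` and assign its address to `v` -/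
  | newNode (x : ℤ) (v : Var Proc)

/-- No process of `P` writes to a location in `Z`. -/
def idleBeh {Proc : Type u} (P : Set Proc) (Z : Set (Loc Proc)) : IntvPred Proc :=
  fun Δ s => ∀ p ∈ P, ∀ va ∈ Z, allStates (fun σ => ¬ CanWrite va p σ) Δ s

/-- Evaluation of `c` by `p`. -/
def evalBeh {Proc : Type u} (p : Proc) (Z : Set (Loc Proc)) (c : Expr Proc) : IntvPred Proc :=
  fun Δ s => possibly p c Δ s ∧ idleBeh {p} Z Δ s

/-- Update of location `va` to `k` by `p`. -/
def update {Proc : Type u} (p : Proc) (Z : Set (Loc Proc)) (va : Loc Proc) (k : Val Proc) :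
    IntvPred Proc :=
  fun Δ s => idleBeh {p} (Z \ {va}) Δ s ∧ ¬ Δ.IsEmpty ∧
    allStates (fun σ => σ.mem va = k ∧ CanWrite va p σ) Δ s

def assignBeh {Proc : Type u} (p : Proc) (Z : Set (Loc Proc)) (v : Var Proc) (e : Expr Proc) :
    IntvPred Proc :=
  fun Δ s => ∃ k, chop (evalBeh p Z (.eq e (.const k))) (update p Z (Sum.inl v) k) Δ s

def assignAtBeh {Proc : Type u} (p : Proc) (Z : Set (Loc Proc)) (ae e : Expr Proc) :
    IntvPred Proc :=
  fun Δ s => ∃ (k : Val Proc) (a : ℕ),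
    chop (evalBeh p Z (.and (.eq ae (.const (.addr a))) (.eq e (.const k))))
      (update p Z (Sum.inr a) k) Δ s

/-- Test-and-set: after an evaluation of the address of the lock (during which `p` may wait, for
ever if need be), `p` writes its identifier into the lock, and the lock holds `null` in the state
immediately before the write. -/
def lockBeh {Proc : Type u} (p : Proc) (Z : Set (Loc Proc)) (ae : Expr Proc) : IntvPred Proc :=
  fun Δ s => ∃ a : ℕ,
    chop (evalBeh p Z (.eq ae (.const (.addr a))))
      (fun Δ' s => previously (atEnd (fun σ => σ.mem (Sum.inr a) = .null)) Δ' s ∧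
        update p Z (Sum.inr a) (.proc p) Δ' s) Δ s

/-- The four addresses of the node at address `a`. -/
def block (a : ℕ) : Set ℕ := {b | ∃ f : Field, b = a + f.offset}

/-- The block at `a` is fresh at the beginning of the interval: no process has written to it
before, and it does not overlap the nodes at `Head` and `Tail`. -/
def fresh {Proc : Type u} (a : ℕ) : IntvPred Proc := fun Δ s =>
  (∀ b ∈ block a, ∀ t : ℤ, (∀ u ∈ Δ.1, t < u) → ∀ q, ¬ CanWrite (Sum.inr b) q (s t)) ∧
    allStates (fun σ => ∀ h : ℕ,
      (σ.mem (Sum.inl .Head) = .addr h ∨ σ.mem (Sum.inl .Tail) = .addr h) →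
        Disjoint (block a) (block h)) Δ s

/-- Allocation: `p` initialises all fields of a node at a fresh address `a` to
`(x, null, false, null)`, and then assigns `a` to `v`. -/
def newNodeBeh {Proc : Type u} (p : Proc) (Z : Set (Loc Proc)) (x : ℤ) (v : Var Proc) :
    IntvPred Proc :=
  fun Δ s => ∃ a : ℕ,
    chop (idleBeh {p} Z)
      (chop
        (fun Δ' s => fresh a Δ' s ∧ ¬ Δ'.IsEmpty ∧ idleBeh {p} (Z \ (Sum.inr '' block a)) Δ' s ∧
          allStates (fun σ =>
            σ.mem (Sum.inr (a + Field.val.offset)) = .key (x : ℤ) ∧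
            σ.mem (Sum.inr (a + Field.nxt.offset)) = .null ∧
            σ.mem (Sum.inr (a + Field.mrk.offset)) = .bool false ∧
            σ.mem (Sum.inr (a + Field.lck.offset)) = .null ∧
            ∀ b ∈ block a, CanWrite (Sum.inr b) p σ) Δ' s)
        (assignBeh p Z v (.const (.addr a)))) Δ s

/-- The behaviour of finite (`false`) or infinite (`true`) idling. -/
def tailBeh {Proc : Type u} (i : Bool) (P : Set Proc) (Z : Set (Loc Proc)) : IntvPred Proc :=
  fun Δ s => (if i then Δ.IsInf else Δ.IsFin) ∧ idleBeh P Z Δ s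

/-- One unfolding of the recursive definition of parallel composition, where `b p` is the
behaviour of the component of `p`. The first three disjuncts determine the parallel composition
over finite sets. For an infinite set the recursion does not terminate, and the last disjunct adds
the solution of the recursive equation in which every process executes its component: each
component is followed by idling, and in an infinite interval one component takes all of it. -/
def parStep {Proc : Type u} (b : Proc → IntvPred Proc) (Z : Set (Loc Proc))
    (X : Set Proc → IntvPred Proc) : Set Proc → IntvPred Proc := fun P Δ s =>
  P = ∅ ∨
  (∃ p, P = {p} ∧ b p Δ s) ∨
  (∃ (P₁ P₂ : Set Proc) (i₁ i₂ : Bool), P₁ ∪ P₂ = P ∧ P₁ ∩ P₂ = ∅ ∧ P₁ ≠ ∅ ∧ P₂ ≠ ∅ ∧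
    (i₁ = true → i₂ ≠ true) ∧
    chop (X P₁) (tailBeh i₁ P₁ Z) Δ s ∧ chop (X P₂) (tailBeh i₂ P₂ Z) Δ s) ∨
  (P.Infinite ∧ (∀ p ∈ P, chop (b p) (idleBeh {p} Z) Δ s) ∧ (Δ.IsInf → ∃ p ∈ P, b p Δ s))

theorem parStep_mono {Proc : Type u} (b : Proc → IntvPred Proc) (Z : Set (Loc Proc)) :
    Monotone (parStep b Z) := by
  rintro X Y h P Δ s (h0 | h1 | ⟨P₁, P₂, i₁, i₂, hu, hd, n₁, n₂, hi, c₁, c₂⟩ | h3)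
  · exact Or.inl h0
  · exact Or.inr (Or.inl h1)
  · exact Or.inr (Or.inr (Or.inl ⟨P₁, P₂, i₁, i₂, hu, hd, n₁, n₂, hi,
      chop_mono (h P₁) le_rfl _ _ c₁, chop_mono (h P₂) le_rfl _ _ c₂⟩))
  · exact Or.inr (Or.inr (Or.inr h3))

/-- Parallel composition: the recursive definition. -/
def parBeh {Proc : Type u} (b : Proc → IntvPred Proc) (Z : Set (Loc Proc)) :
    Set Proc → IntvPred Proc :=
  OrderHom.lfp ⟨parStep b Z, parStep_mono b Z⟩

/-- A behaviour that is defined for a single executing process only. -/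
def solo {Proc : Type u} (P : Set Proc) (g : Proc → IntvPred Proc) : IntvPred Proc :=
  fun Δ s => ∃ p, P = {p} ∧ g p Δ s

/-- The behaviour of a command executed by the processes `P` in context `Z`. -/
def beh {Proc : Type u} : Cmd Proc → Set Proc → Set (Loc Proc) → IntvPred Proc
  | .idle, P, Z => idleBeh P Z
  | .guard c, P, Z => solo P fun p => evalBeh p Z c
  | .aguard c, P, Z => solo P fun p Δ s => someState c Δ s ∧ idleBeh {p} Z Δ s
  | .assign v e, P, Z => solo P fun p => assignBeh p Z v e
  | .assignAt ae e, P, Z => solo P fun p => assignAtBeh p Z ae e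
  | .seq C₁ C₂, P, Z => chop (beh C₁ P Z) (beh C₂ P Z)
  | .choice C₁ C₂, P, Z => fun Δ s => beh C₁ P Z Δ s ∨ beh C₂ P Z Δ s
  | .choiceInt C, P, Z => fun Δ s => ∃ x, beh (C x) P Z Δ s
  | .iter C, P, Z => omega (beh C P Z)
  | .par Q C, P, Z => fun Δ s => P = Q ∧ parBeh (fun p => beh (C p) {p} Z) Z P Δ s
  | .context Y C, P, Z => fun Δ s => Z ∩ Y = ∅ ∧ beh C P (Z ∪ Y) Δ s
  | .label l C, P, Z => fun Δ s =>
      solo P (fun p => allStates fun σ => σ.mem (Sum.inl (.pc p)) = .lab l) Δ s ∧ beh C P Z Δ s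
  | .rely r C, P, Z => fun Δ s => r Δ s → beh C P Z Δ s
  | .enf g C, P, Z => fun Δ s => g Δ s ∧ beh C P Z Δ s
  | .lock ae, P, Z => solo P fun p => lockBeh p Z ae
  | .newNode x v, P, Z => solo P fun p => newNodeBeh p Z x v

/-- `A` with context `Y` is refined by `C` with context `Z` with respect to `P`. -/
def Refines {Proc : Type u} (P : Set Proc) (Y Z : Set (Loc Proc)) (A C : Cmd Proc) : Prop :=
  Entails (beh C P Z) (beh A P Y)

infixr:60 " ;; " => Cmd.seq
infixr:55 " ⊓⊓ " => Cmd.choice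

/-! ### The lazy set -/

/-- `¬ pred.mrk ∧ ¬ curr.mrk ∧ pred.nxt = curr` -/
def located {Proc : Type u} (pred curr : Var Proc) : Expr Proc :=
  .and (.not ((Expr.var pred).at .mrk))
    (.and (.not ((Expr.var curr).at .mrk)) (.eq ((Expr.var pred).at .nxt) (.var curr)))

def Lock {Proc : Type u} (v : Var Proc) : Cmd Proc := .lock (.fld (.var v) .lck)

def Unlock {Proc : Type u} (v : Var Proc) : Cmd Proc := .assignAt (.fld (.var v) .lck) (.const .null)

def Search {Proc : Type u} (x : ℤ) (pred curr : Var Proc) : Cmd Proc :=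
  .assign pred (.var .Head) ;; .assign curr ((Expr.var pred).at .nxt) ;;
  .iter (.guard (.lt ((Expr.var curr).at .val) (Expr.key (x : ℤ))) ;;
    .assign pred (.var curr) ;; .assign curr ((Expr.var pred).at .nxt)) ;;
  .guard (.le (Expr.key (x : ℤ)) ((Expr.var curr).at .val)) ;; Lock pred ;; Lock curr

def TryFind {Proc : Type u} (x : ℤ) (pred curr : Var Proc) : Cmd Proc :=
  Search x pred curr ;; .guard (.not (located pred curr)) ;; Unlock pred ;; Unlock curr

def Find {Proc : Type u} (x : ℤ) (pred curr : Var Proc) : Cmd Proc :=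
  Search x pred curr ;; .guard (located pred curr)

def Locate {Proc : Type u} (x : ℤ) (pred curr : Var Proc) : Cmd Proc :=
  .iter (TryFind x pred curr) ;; Find x pred curr

def AddOK {Proc : Type u} (p : Proc) (x : ℤ) : Cmd Proc :=
  .label .alt2 (.guard (.not (.eq ((Expr.var (.n3 p)).at .val) (Expr.key (x : ℤ))))) ;;
  .label .al3 (.newNode x (.n2 p)) ;;
  .label .al4 (.assignAt (.fld (.var (.n2 p)) .nxt) (.var (.n3 p))) ;;
  .label .al5 (.assignAt (.fld (.var (.n1 p)) .nxt) (.var (.n2 p))) ;;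
  .label .al6 (.assign (.res p) (.const (.bool true)))

def AddFail {Proc : Type u} (p : Proc) (x : ℤ) : Cmd Proc :=
  .label .alf2 (.guard (.eq ((Expr.var (.n3 p)).at .val) (Expr.key (x : ℤ)))) ;;
  .label .al7 (.assign (.res p) (.const (.bool false)))

def Add {Proc : Type u} (p : Proc) (x : ℤ) : Cmd Proc :=
  .label .al1 (Locate x (.n1 p) (.n3 p)) ;; (AddOK p x ⊓⊓ AddFail p x) ;;
  .label .al8 (Unlock (.n1 p)) ;; .label .al9 (Unlock (.n3 p))

def RemOK {Proc : Type u} (p : Proc) (x : ℤ) : Cmd Proc :=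
  .label .rlt2 (.guard (.eq ((Expr.var (.n2 p)).at .val) (Expr.key (x : ℤ)))) ;;
  .label .rl3 (.assignAt (.fld (.var (.n2 p)) .mrk) (.const (.bool true))) ;;
  .label .rl4 (.assign (.n3 p) ((Expr.var (.n2 p)).at .nxt)) ;;
  .label .rl5 (.assignAt (.fld (.var (.n1 p)) .nxt) (.var (.n3 p))) ;;
  .label .rl6 (.assign (.res p) (.const (.bool true)))

def RemFail {Proc : Type u} (p : Proc) (x : ℤ) : Cmd Proc :=
  .label .rlf2 (.guard (.not (.eq ((Expr.var (.n2 p)).at .val) (Expr.key (x : ℤ))))) ;;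
  .label .rl7 (.assign (.res p) (.const (.bool false)))

def Remove {Proc : Type u} (p : Proc) (x : ℤ) : Cmd Proc :=
  .label .rl1 (Locate x (.n1 p) (.n2 p)) ;; (RemOK p x ⊓⊓ RemFail p x) ;;
  .label .rl8 (Unlock (.n1 p)) ;; .label .rl9 (Unlock (.n2 p))

def CLoop {Proc : Type u} (p : Proc) (x : ℤ) : Cmd Proc :=
  .iter (.guard (.lt ((Expr.var (.n1 p)).at .val) (Expr.key (x : ℤ))) ;;
    .assign (.n1 p) ((Expr.var (.n1 p)).at .nxt)) ;;
  .guard (.le (Expr.key (x : ℤ)) ((Expr.var (.n1 p)).at .val))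

/-- The part of `Contains` that precedes the assignment to `res`. -/
def CL {Proc : Type u} (p : Proc) (x : ℤ) : Cmd Proc :=
  .label .cl1 (.assign (.n1 p) (.var .Head)) ;; .label .cl2 (CLoop p x)

/-- `¬ n1.mrk ∧ n1.val = x` -/
def IN {Proc : Type u} (p : Proc) (x : ℤ) : Expr Proc :=
  .and (.not ((Expr.var (.n1 p)).at .mrk)) (.eq ((Expr.var (.n1 p)).at .val) (Expr.key (x : ℤ)))

def Contains {Proc : Type u} (p : Proc) (x : ℤ) : Cmd Proc :=
  CL p x ;; .label .cl3 (.assign (.res p) (IN p x))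

/-- `n ⟼ (vv, nn, mm, ll)` -/
def nodeIs {Proc : Type u} (n vv nn mm ll : Expr Proc) : StatePred Proc := fun σ =>
  (Expr.eq (n.at .val) vv).holds σ ∧ (Expr.eq (n.at .nxt) nn).holds σ ∧
    (Expr.eq (n.at .mrk) mm).holds σ ∧ (Expr.eq (n.at .lck) ll).holds σ

/-- The initial list, which consists of the sentinel nodes `Head` and `Tail`. -/
def HTInit {Proc : Type u} : StatePred Proc := fun σ =>
  nodeIs (.var .Head) (Expr.key ⊥) (.var .Tail) (.const (.bool false)) (.const .null) σ ∧
  nodeIs (.var .Tail) (Expr.key ⊤) (.const .null) (.const (.bool false)) (.const .null) σ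

/-- The shared locations: all addresses, `Head` and `Tail`. -/
def HT {Proc : Type u} : Set (Loc Proc) := Set.range Sum.inr ∪ {Sum.inl .Head, Sum.inl .Tail}

def nVars {Proc : Type u} (p : Proc) : Set (Loc Proc) :=
  {Sum.inl (.n1 p), Sum.inl (.n2 p), Sum.inl (.n3 p)}

def resVar {Proc : Type u} (p : Proc) : Set (Loc Proc) := {Sum.inl (.res p)}

/-- What the system relies on: the list is initialised, and processes that do not belong to the
system do not write to the shared locations. -/
def sysRely {Proc : Type u} (P : Set Proc) : IntvPred Proc := fun Δ s =>
  atStart HTInit Δ s ∧ allStates (fun σ => ¬ Interference HT P σ) Δ s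

def S {Proc : Type u} (p : Proc) : Cmd Proc :=
  .context (nVars p ∪ resVar p)
    (.iter (.choiceInt fun x => Add p x ⊓⊓ Remove p x ⊓⊓ Contains p x))

/-- The lazy set, `Set(P)`. -/
def LSet {Proc : Type u} (P : Set Proc) : Cmd Proc :=
  .context HT (.rely (sysRely P) (.par P S))

/-! ### The coarse-grained abstraction -/

/-- Follow `k` `nxt`-pointers from `ua`. -/
noncomputable def follow {Proc : Type u} (σ : State Proc) (ua : Val Proc) : ℕ → Option (Val Proc)
  | 0 => some ua
  | k + 1 => (follow σ ua k).bind fun v => ((Expr.const v).at .nxt).evalIn σ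

/-- `vb` is reachable from `ua`. -/
def RE {Proc : Type u} (ua vb : Val Proc) : StatePred Proc :=
  fun σ => ∃ k : ℕ, follow σ ua k = some vb

/-- The addresses of the unmarked nodes reachable from `Head`. -/
def setAddr {Proc : Type u} (σ : State Proc) : Set ℕ :=
  {a | RE (σ.mem (Sum.inl .Head)) (.addr a) σ ∧
    (Expr.not ((Expr.const (.addr a)).at .mrk)).holds σ}

/-- The abstract set. -/
def absSet {Proc : Type u} (σ : State Proc) : Set (Val Proc) :=
  {v | ∃ a ∈ setAddr σ, ((Expr.const (.addr a)).at .val).evalIn σ = some v}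

/-- `x ∈ absSet` -/
def inAbs {Proc : Type u} (x : ℤ) : StatePred Proc := fun σ => Val.key (x : ℤ) ∈ absSet σ

/-- `x ∉ absSet` -/
def notInAbs {Proc : Type u} (x : ℤ) : StatePred Proc := fun σ => Val.key (x : ℤ) ∉ absSet σ

def CGCon {Proc : Type u} (p : Proc) (x : ℤ) : Cmd Proc :=
  (.aguard (inAbs x) ;; .assign (.res p) (.const (.bool true))) ⊓⊓
  (.aguard (notInAbs x) ;; .assign (.res p) (.const (.bool false)))

def CGS {Proc : Type u} (p : Proc) : Cmd Proc :=
  .context (resVar p)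
    (.iter (.choiceInt fun x =>
      .context (nVars p) (Add p x ⊓⊓ Remove p x) ⊓⊓ CGCon p x))

/-- The coarse-grained abstraction, `CGSet(P)`. -/
def CGSet {Proc : Type u} (P : Set Proc) : Cmd Proc :=
  .context HT (.rely (sysRely P) (.par P CGS))

end LazySet

/-!
The proof is a rely/guarantee argument about the shared memory alone. This is possible because a
lock stores the identifier of the process that holds it, so that the protection which a lock gives
can be expressed without reference to the program counters.

*Permitted steps.* `Permitted` lists the changes which a process may make to the memory: acquire or
release a lock, mark a node that it has locked, link a new node of its own behind a locked unmarked
node, unlink a marked node behind a locked unmarked node, or write to a node which it has allocated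
and which has never been in the list. If all changes in a step are permitted (`GoodStep`), then the
invariant `ListInv` is preserved (`GoodStep.listInv`), even if several processes write at once: the
nodes that have ever been in the list are sentinels or allocated nodes, so that their blocks are
disjoint (`Sys.known_unique`); their values increase along `nxt`; and the unmarked ones are reachable
from `Head`. Moreover, the value of such a node never changes, only marked nodes leave the list, and
the successor of a marked node is frozen.

*All steps are permitted.* This is proved by induction on the time `T` of the step. Suppose that all
earlier steps are permitted. The changes of a process at `T` are analysed with a Hoare logic for
interval predicates (`Walk`), whose triples say that a run up to `T` either reaches `T`, where it
makes a permitted change, or ends earlier and establishes a postcondition. What a process has read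
about nodes that it has locked remains true, because the earlier steps of the others are permitted;
this turns the apparent states of the guards into facts about actual states (`walk_locate`). The
outcome is `past_of_run`. At the times at which the list is known to be in its initial state, its
nodes are constant and not locked, which starts the induction, also in intervals that are unbounded
below.

*Hindsight.* `Contains` follows pointers without locks. If a node that was reachable at some time
has the successor `b` later on, then at some time in between it was reachable with the successor `b`
(`Past.hindsight_nxt`): as long as it is reachable, this is clear, and after that its successor is
frozen. Hence every node that the traversal visits was reachable at some time of the traversal, and
a step over the value `x` shows `x` absent at some time. If the node with value `x` is found to be
marked, it was reachable and marked at some time (`Past.hindsight_marked`), and then `x` was absent;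
if it is found to be unmarked, it is reachable at that time. So the outcome of the traversal is
justified by an actual state (`walk_CL_eval`), which gives the refinement of `Contains` by a
coarse-grained test. It carries over to the processes by coinduction on the iteration (`S_refines`)
and to the system by induction on the parallel composition (`parBeh_mono_on`).
-/

namespace LazySet

variable {Proc : Type*}

/-! ### Intervals between positions -/

/-- Positions on the time line, including both ends. A position `n : ℤ` is the point just after
time `n`. -/
abbrev Pos : Type := EInt

-- This lets `norm_cast` compare positions that are times.
attribute [coe] WithBotTop.coe

@[norm_cast]
theorem Pos.coe_le {n m : ℤ} : (n : Pos) ≤ (m : Pos) ↔ n ≤ m := WithBotTop.coe_le_coe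

@[norm_cast]
theorem Pos.coe_lt {n m : ℤ} : (n : Pos) < (m : Pos) ↔ n < m := WithBotTop.coe_lt_coe

theorem Pos.bot_lt (n : ℤ) : (⊥ : Pos) < (n : Pos) := WithBot.bot_lt_coe _

/-- The interval of the times after position `u` and up to position `v`. -/
def ioc (u v : Pos) : Intv :=
  ⟨{t : ℤ | u < (t : Pos) ∧ (t : Pos) ≤ v}, ⟨fun a ha b hb c hc => by
    obtain ⟨h₁, h₂⟩ := hc
    have h₁' : (a : Pos) ≤ (c : Pos) := by exact_mod_cast h₁
    have h₂' : (c : Pos) ≤ (b : Pos) := by exact_mod_cast h₂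
    exact ⟨lt_of_lt_of_le ha.1 h₁', h₂'.trans hb.2⟩⟩⟩

theorem mem_ioc {u v : Pos} {t : ℤ} : t ∈ (ioc u v).1 ↔ u < (t : Pos) ∧ (t : Pos) ≤ v := Iff.rfl

theorem mem_ioc_coe {n m t : ℤ} : t ∈ (ioc (n : Pos) (m : Pos)).1 ↔ n < t ∧ t ≤ m := by
  rw [mem_ioc]; norm_cast

theorem Pos.eq_coe {n T : ℤ} {v : Pos} (h : (n : Pos) ≤ v) (h' : v < (T : Pos)) :
    ∃ m : ℤ, v = (m : Pos) := by
  induction v using WithBotTop.rec with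
  | bot => exact absurd h (not_le.2 (Pos.bot_lt n))
  | coe v => exact ⟨v, rfl⟩
  | top => exact absurd h' (not_lt.2 le_top)

theorem Pos.eq_bot_or_coe {T : ℤ} {v : Pos} (h' : v < (T : Pos)) :
    v = ⊥ ∨ ∃ m : ℤ, v = (m : Pos) := by
  induction v using WithBotTop.rec with
  | bot => exact Or.inl rfl
  | coe v => exact Or.inr ⟨v, rfl⟩
  | top => exact absurd h' (not_lt.2 le_top)

/-- Every interval lies between two positions. -/
theorem exists_ioc (Δ : Intv) : ∃ u v : Pos, u ≤ v ∧ Δ = ioc u v := by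
  obtain ⟨D, hD⟩ := Δ
  rcases D.eq_empty_or_nonempty with rfl | ⟨x, hx⟩
  · refine ⟨⊥, ⊥, le_rfl, Subtype.ext ?_⟩
    ext t; simp [mem_ioc]
  have hlow : ∃ u : Pos, u < (x : Pos) ∧ (∀ t ∈ D, u < (t : Pos)) ∧
      ∀ t : ℤ, u < (t : Pos) → ∃ y ∈ D, y ≤ t := by
    by_cases hb : ∃ b, ∀ z ∈ D, b ≤ z
    · obtain ⟨m, hm, hm'⟩ := Int.exists_least_of_bdd hb ⟨x, hx⟩
      refine ⟨((m - 1 : ℤ) : Pos), ?_, ?_, ?_⟩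
      · have := hm' x hx; norm_cast; omega
      · intro t ht; have := hm' t ht; norm_cast; omega
      · intro t ht; norm_cast at ht; exact ⟨m, hm, by omega⟩
    · push Not at hb
      refine ⟨⊥, Pos.bot_lt x, fun t _ => Pos.bot_lt t, fun t _ => ?_⟩
      obtain ⟨z, hz, hz'⟩ := hb t
      exact ⟨z, hz, hz'.le⟩
  have hup : ∃ v : Pos, (x : Pos) ≤ v ∧ (∀ t ∈ D, (t : Pos) ≤ v) ∧
      ∀ t : ℤ, (t : Pos) ≤ v → ∃ y ∈ D, t ≤ y := by
    by_cases hb : ∃ b, ∀ z ∈ D, z ≤ b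
    · obtain ⟨m, hm, hm'⟩ := Int.exists_greatest_of_bdd hb ⟨x, hx⟩
      refine ⟨(m : Pos), ?_, ?_, ?_⟩
      · have := hm' x hx; norm_cast
      · intro t ht; have := hm' t ht; norm_cast
      · intro t ht; norm_cast at ht; exact ⟨m, hm, ht⟩
    · push Not at hb
      refine ⟨⊤, le_top, fun _ _ => le_top, fun t _ => ?_⟩
      obtain ⟨z, hz, hz'⟩ := hb t
      exact ⟨z, hz, hz'.le⟩
  obtain ⟨u, hux, hu, hu'⟩ := hlow
  obtain ⟨v, hvx, hv, hv'⟩ := hup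
  refine ⟨u, v, hux.le.trans hvx, Subtype.ext ?_⟩
  ext t
  refine ⟨fun ht => ⟨hu t ht, hv t ht⟩, fun ht => ?_⟩
  obtain ⟨y, hy, hyt⟩ := hu' t ht.1
  obtain ⟨z, hz, hzt⟩ := hv' t ht.2
  exact hD.out hy hz ⟨hyt, hzt⟩

/-- A chop of the interval between two positions cuts it at a position in between. -/
theorem chop_ioc {g₁ g₂ : IntvPred Proc} {u v : Pos} {s : Stream Proc} (huv : u ≤ v)
    (h : chop g₁ g₂ (ioc u v) s) :
    (∃ w, u ≤ w ∧ w ≤ v ∧ g₁ (ioc u w) s ∧ g₂ (ioc w v) s) ∨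
      ((ioc u v).IsInf ∧ g₁ (ioc u v) s) := by
  rcases h with ⟨Δ₁, Δ₂, hu, ha, h₁, h₂⟩ | h
  swap
  · exact Or.inr h
  left
  have key : ∃ w, u ≤ w ∧ w ≤ v ∧ Δ₁ = ioc u w ∧ Δ₂ = ioc w v := by
    rcases Δ₁.1.eq_empty_or_nonempty with e₁ | ⟨x, hx⟩
    · refine ⟨u, le_rfl, huv, Subtype.ext ?_, Subtype.ext ?_⟩
      · rw [e₁]; ext t
        simp only [Set.mem_empty_iff_false, false_iff, mem_ioc, not_and, not_le]
        exact fun h => h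
      · rw [hu, e₁, Set.empty_union]
    rcases Δ₂.1.eq_empty_or_nonempty with e₂ | ⟨y, hy⟩
    · refine ⟨v, huv, le_rfl, Subtype.ext ?_, Subtype.ext ?_⟩
      · rw [hu, e₂, Set.union_empty]
      · rw [e₂]; ext t
        simp only [Set.mem_empty_iff_false, false_iff, mem_ioc, not_and, not_le]
        exact fun h => h
    obtain ⟨m, hm, hm'⟩ := Int.exists_greatest_of_bdd (P := fun z => z ∈ Δ₁.1)
      ⟨y, fun z hz => (ha.1 z hz y hy).le⟩ ⟨x, hx⟩
    have hmΔ : m ∈ (ioc u v).1 := hu ▸ Or.inl hm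
    refine ⟨(m : Pos), hmΔ.1.le, hmΔ.2, Subtype.ext ?_, Subtype.ext ?_⟩
    · ext t
      constructor
      · intro ht
        have : t ∈ (ioc u v).1 := hu ▸ Or.inl ht
        exact ⟨this.1, by exact_mod_cast hm' t ht⟩
      · rintro ⟨h₁, h₂⟩
        have : t ∈ (ioc u v).1 := ⟨h₁, h₂.trans hmΔ.2⟩
        rw [hu] at this
        rcases this with h | h
        · exact h
        · have := ha.1 m hm t h
          norm_cast at h₂
          omega
    · ext t
      constructor
      · intro ht
        have : t ∈ (ioc u v).1 := hu ▸ Or.inr ht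
        exact ⟨by exact_mod_cast ha.1 m hm t ht, this.2⟩
      · rintro ⟨h₁, h₂⟩
        have : t ∈ (ioc u v).1 := ⟨hmΔ.1.trans h₁, h₂⟩
        rw [hu] at this
        rcases this with h | h
        · have := hm' t h
          norm_cast at h₁
          omega
        · exact h
  obtain ⟨w, hw₁, hw₂, rfl, rfl⟩ := key
  exact ⟨w, hw₁, hw₂, h₁, h₂⟩

theorem omega_unfold {g : IntvPred Proc} {Δ : Intv} {s : Stream Proc} (h : omega g Δ s) :
    chop g (omega g) Δ s ∨ Δ.IsEmpty := by
  rw [omega, ← OrderHom.map_gfp] at h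
  exact h

theorem IsInf.nonempty {Δ : Intv} (h : Δ.IsInf) : Δ.1.Nonempty := by
  by_contra hne
  rw [Set.not_nonempty_iff_eq_empty] at hne
  exact h (hne ▸ bddAbove_empty)

/-- `g` holds on non-empty intervals only. -/
def NonEmp (g : IntvPred Proc) : Prop := ∀ Δ s, g Δ s → Δ.1.Nonempty

theorem NonEmp.chop_left {g₁ g₂ : IntvPred Proc} (h : NonEmp g₁) : NonEmp (chop g₁ g₂) := by
  rintro Δ s (⟨Δ₁, Δ₂, hu, -, h₁, -⟩ | h')
  · obtain ⟨t, ht⟩ := h _ _ h₁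
    exact ⟨t, hu ▸ Or.inl ht⟩
  · exact IsInf.nonempty h'.1

theorem NonEmp.chop_right {g₁ g₂ : IntvPred Proc} (h : NonEmp g₂) : NonEmp (chop g₁ g₂) := by
  rintro Δ s (⟨Δ₁, Δ₂, hu, -, -, h₂⟩ | h')
  · obtain ⟨t, ht⟩ := h _ _ h₂
    exact ⟨t, hu ▸ Or.inr ht⟩
  · exact IsInf.nonempty h'.1

/-! ### A program logic for interval predicates -/

/-- A Hoare triple for an interval predicate `g`, relative to a critical time `T`. Whenever `g`
holds on an interval within `D` that starts before `T` at a position that satisfies `A`, the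
proposition `Goal` is true if the interval reaches `T`, and otherwise the end of the interval
satisfies `B`. -/
def Walk (s : Stream Proc) (D : Set ℤ) (T : ℤ) (Goal : Prop) (g : IntvPred Proc)
    (A B : Pos → Prop) : Prop :=
  ∀ u v : Pos, u ≤ v → u < (T : Pos) → (ioc u v).1 ⊆ D → g (ioc u v) s → A u →
    ((T : Pos) ≤ v → Goal) ∧ (v < (T : Pos) → B v)

section Walk

variable {s : Stream Proc} {D : Set ℤ} {T : ℤ} {Goal : Prop} {g g₁ g₂ : IntvPred Proc}
  {A B C : Pos → Prop}

theorem not_isInf_ioc {u v : Pos} {T : ℤ} (h : v < (T : Pos)) : ¬ (ioc u v).IsInf := by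
  intro hi
  refine hi ⟨T, fun t ht => ?_⟩
  have := lt_of_le_of_lt ht.2 h
  norm_cast at this
  exact this.le

theorem Walk.chop (h₁ : Walk s D T Goal g₁ A B) (h₂ : Walk s D T Goal g₂ B C) :
    Walk s D T Goal (chop g₁ g₂) A C := by
  intro u v huv hu hD hg hA
  rcases chop_ioc huv hg with ⟨w, huw, hwv, k₁, k₂⟩ | ⟨hi, k₁⟩
  · have hD₁ : (ioc u w).1 ⊆ D := fun t ht => hD ⟨ht.1, ht.2.trans hwv⟩
    have hD₂ : (ioc w v).1 ⊆ D := fun t ht => hD ⟨huw.trans_lt ht.1, ht.2⟩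
    obtain ⟨a₁, b₁⟩ := h₁ u w huw hu hD₁ k₁ hA
    rcases le_or_gt (T : Pos) w with hw | hw
    · exact ⟨fun _ => a₁ hw, fun hv => absurd (hw.trans hwv) (not_le.2 hv)⟩
    · exact h₂ w v hwv hw hD₂ k₂ (b₁ hw)
  · exact ⟨(h₁ u v huv hu hD k₁ hA).1, fun hv => absurd hi (not_isInf_ioc hv)⟩

/-- An iteration whose body takes time reaches `T` or ends after finitely many rounds. The first
round may start at `⊥`; the others start at a time. -/
theorem Walk.omega (hne : NonEmp g) (h : Walk s D T Goal g A A) :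
    Walk s D T Goal (omega g) A A := by
  have step : ∀ u v : Pos, u ≤ v → u < (T : Pos) → (ioc u v).1 ⊆ D → LazySet.omega g (ioc u v) s →
      A u →
      (∀ w : ℤ, u < (w : Pos) → (w : Pos) < T → (w : Pos) ≤ v → (ioc (w : Pos) v).1 ⊆ D →
        LazySet.omega g (ioc (w : Pos) v) s → A w →
        ((T : Pos) ≤ v → Goal) ∧ (v < (T : Pos) → A v)) →
      ((T : Pos) ≤ v → Goal) ∧ (v < (T : Pos) → A v) := by
    intro u v huv hu hD hg hA ih
    rcases omega_unfold hg with hc | he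
    · rcases chop_ioc huv hc with ⟨w, huw, hwv, k₁, k₂⟩ | ⟨hi, k₁⟩
      · have hD₁ : (ioc u w).1 ⊆ D := fun t ht => hD ⟨ht.1, ht.2.trans hwv⟩
        have hD₂ : (ioc w v).1 ⊆ D := fun t ht => hD ⟨huw.trans_lt ht.1, ht.2⟩
        obtain ⟨a₁, b₁⟩ := h u w huw hu hD₁ k₁ hA
        rcases le_or_gt (T : Pos) w with hw | hw
        · exact ⟨fun _ => a₁ hw, fun hv => absurd (hw.trans hwv) (not_le.2 hv)⟩
        · obtain ⟨t, ht⟩ := hne _ _ k₁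
          obtain ⟨m, rfl⟩ := Pos.eq_coe ht.2 hw
          exact ih m (ht.1.trans_le ht.2) hw hwv hD₂ k₂ (b₁ hw)
      · exact ⟨(h u v huv hu hD k₁ hA).1, fun hv => absurd hi (not_isInf_ioc hv)⟩
    · have hvu : ¬ u < v := by
        intro hlt
        rcases le_or_gt (T : Pos) v with hv | hv
        · have : T ∈ (ioc u v).1 := ⟨hu, hv⟩
          rw [he] at this; exact this
        · rcases Pos.eq_bot_or_coe hv with rfl | ⟨m, rfl⟩
          · simp at hlt
          · have : m ∈ (ioc u (m : Pos)).1 := ⟨hlt, le_rfl⟩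
            rw [he] at this; exact this
      have : u = v := le_antisymm huv (not_lt.1 hvu)
      subst this
      exact ⟨fun hv => absurd hv (not_le.2 hu), fun _ => hA⟩
  have main : ∀ (k : ℕ) (n : ℤ), (T - n).toNat ≤ k → ∀ v : Pos, (n : Pos) ≤ v →
      (n : Pos) < (T : Pos) → (ioc (n : Pos) v).1 ⊆ D → LazySet.omega g (ioc (n : Pos) v) s → A n →
      ((T : Pos) ≤ v → Goal) ∧ (v < (T : Pos) → A v) := by
    intro k
    induction k with
    | zero =>
      intro n hn v _ hT
      norm_cast at hT
      omega
    | succ k ih =>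
      intro n hn v hnv hT hD hg hA
      refine step n v hnv hT hD hg hA fun w hw hwT hwv hD' hg' hA' => ?_
      refine ih w ?_ v hwv hwT hD' hg' hA'
      norm_cast at hw hwT
      omega
  intro u v huv hu hD hg hA
  exact step u v huv hu hD hg hA fun w _ hwT hwv hD' hg' hA' =>
    main _ w le_rfl v hwv hwT hD' hg' hA'

theorem Walk.or (h₁ : Walk s D T Goal g₁ A B) (h₂ : Walk s D T Goal g₂ A B) :
    Walk s D T Goal (fun Δ s => g₁ Δ s ∨ g₂ Δ s) A B := by
  rintro u v huv hu hD (h | h) hA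
  · exact h₁ u v huv hu hD h hA
  · exact h₂ u v huv hu hD h hA

theorem Walk.mono {A' B' : Pos → Prop} {g' : IntvPred Proc} (h : Walk s D T Goal g A B)
    (hg : ∀ Δ, g' Δ s → g Δ s) (hA : ∀ u, A' u → A u) (hB : ∀ u, B u → B' u) :
    Walk s D T Goal g' A' B' :=
  fun u v huv hu hD k a =>
    have := h u v huv hu hD (hg _ k) (hA _ a)
    ⟨this.1, fun hv => hB _ (this.2 hv)⟩

end Walk

/-- The position is a time in `D` that satisfies `J`. -/
def At (D : Set ℤ) (J : ℤ → Prop) : Pos → Prop := fun u => ∃ n : ℤ, u = (n : Pos) ∧ n ∈ D ∧ J n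

theorem int_stable {J : ℤ → Prop} {n m : ℤ} (h : n ≤ m) (h₀ : J n)
    (hs : ∀ t, n < t → t ≤ m → J (t - 1) → J t) : J m := by
  have : ∀ k, n ≤ k → k ≤ m → J k := by
    intro k hk
    induction k, hk using Int.leInduction with
    | base => exact fun _ => h₀
    | succ k hk ih =>
      intro hkm
      refine hs (k + 1) (by omega) hkm ?_
      rw [add_sub_cancel_right]
      exact ih (by omega)
  exact this m h le_rfl

/-! ### Nodes and reachability -/

/-- The value at time `t` of the field `f` of the node at address `a`. -/
def cell (s : Stream Proc) (t : ℤ) (a : ℕ) (f : Field) : Val Proc :=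
  (s t).mem (Sum.inr (a + f.offset))

/-- `p` may write to field `f` of the node at address `a` at time `t`. -/
def Wr (s : Stream Proc) (p : Proc) (t : ℤ) (a : ℕ) (f : Field) : Prop :=
  CanWrite (Sum.inr (a + f.offset)) p (s t)

/-- At time `t`, the node at `a` is reachable from the node at `h`. -/
def Reach (s : Stream Proc) (h : ℕ) (t : ℤ) (a : ℕ) : Prop :=
  Relation.ReflTransGen (fun a b => cell s t a .nxt = .addr b) h a

/-- The node at `a` has been reachable from the node at `h` at some time of `D` up to `t`. -/
def Entered (s : Stream Proc) (D : Set ℤ) (h : ℕ) (t : ℤ) (a : ℕ) : Prop :=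
  ∃ t' ∈ D, t' ≤ t ∧ Reach s h t' a

/-- At time `t`, process `q` writes to the block at `a` and to no other address, nobody has written
to the block before, and the block does not overlap the nodes at `h` and `tl`. -/
structure Alloc (s : Stream Proc) (h tl : ℕ) (q : Proc) (a : ℕ) (t : ℤ) : Prop where
  write : ∀ f, Wr s q t a f
  only : ∀ b, b ∉ block a → ¬ CanWrite (Sum.inr b) q (s t)
  fresh : ∀ t' < t, ∀ r f, ¬ Wr s r t' a f
  head : ∀ f, a + Field.offset f ∉ block h
  tail : ∀ f, a + Field.offset f ∉ block tl

/-- The address `a` is that of a sentinel node or of a node that has been allocated up to `t`. -/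
def Known (s : Stream Proc) (h tl : ℕ) (t : ℤ) (a : ℕ) : Prop :=
  a = h ∨ a = tl ∨ ∃ q t₁, t₁ ≤ t ∧ Alloc s h tl q a t₁

theorem Field.offset_inj {f f' : Field} (h : f.offset = f'.offset) : f = f' := by
  cases f <;> cases f' <;> simp_all [Field.offset]

theorem mem_block (a : ℕ) (f : Field) : a + f.offset ∈ block a := ⟨f, rfl⟩

theorem block_antisymm {a b : ℕ} (h₁ : a ∈ block b) (h₂ : b ∈ block a) : a = b := by
  obtain ⟨f, hf⟩ := h₁
  obtain ⟨f', hf'⟩ := h₂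
  omega

theorem canWrite_unique {s : Stream Proc} (hs : Healthy s) {t : ℤ} {va : Loc Proc} {p q : Proc}
    (hp : CanWrite va p (s t)) (hq : CanWrite va q (s t)) : p = q := by
  classical
  by_contra hne
  have := hs.perm_sum t va {p, q}
  rw [Finset.sum_pair hne] at this
  simp only [CanWrite] at hp hq
  rw [hp, hq] at this
  norm_num at this

/-- Blocks that have been allocated at different times or by different processes do not overlap:
the later allocation would not be fresh, and simultaneous ones would need write permission for two
processes. -/
theorem Alloc.unique {s : Stream Proc} (hs : Healthy s) {h tl : ℕ} {q q' : Proc} {a a' : ℕ}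
    {t t' : ℤ} (k : Alloc s h tl q a t) (k' : Alloc s h tl q' a' t') {f f' : Field}
    (e : a + f.offset = a' + f'.offset) : q = q' ∧ a = a' ∧ t = t' := by
  have w := k.write f
  have w' := k'.write f'
  have ht : t = t' := by
    rcases lt_trichotomy t t' with hlt | rfl | hlt
    · refine absurd w ?_
      have := k'.fresh t hlt q f'
      unfold Wr at this ⊢
      rwa [e]
    · rfl
    · refine absurd w' ?_
      have := k.fresh t' hlt q' f
      unfold Wr at this ⊢
      rwa [← e]
  subst ht
  have hq : q = q' := by
    unfold Wr at w w'
    rw [e] at w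
    exact canWrite_unique hs w w'
  subst hq
  refine ⟨rfl, block_antisymm ?_ ?_, rfl⟩
  · by_contra hn
    exact k'.only a hn (by simpa [Wr, Field.offset] using k.write .val)
  · by_contra hn
    exact k.only a' hn (by simpa [Wr, Field.offset] using k'.write .val)

/-! ### The shared state of the system -/

/-- The system runs on `D`, with the sentinel nodes at the addresses `h` and `tl`; the list is
initialised up to time `t₀`, and nobody outside `P` writes to an address. -/
structure Sys (s : Stream Proc) (D : Set ℤ) (P : Set Proc) (h tl : ℕ) (t₀ : ℤ) : Prop where
  healthy : Healthy s
  conn : D.OrdConnected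
  mem₀ : t₀ ∈ D
  head : ∀ t ∈ D, (s t).mem (Sum.inl .Head) = .addr h
  tail : ∀ t ∈ D, (s t).mem (Sum.inl .Tail) = .addr tl
  initHead : ∀ t ∈ D, t ≤ t₀ → cell s t h .val = .key ⊥ ∧ cell s t h .nxt = .addr tl ∧
    cell s t h .mrk = .bool false ∧ cell s t h .lck = .null
  initTail : ∀ t ∈ D, t ≤ t₀ → cell s t tl .val = .key ⊤ ∧ cell s t tl .nxt = .null ∧
    cell s t tl .mrk = .bool false ∧ cell s t tl .lck = .null
  ext : ∀ t ∈ D, ∀ q b, CanWrite (Sum.inr b) q (s t) → q ∈ P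

/-- Process `p` links its new node `c` between the nodes `a` and `b`. The values of the fields are
those before the step, except for the field that is written. -/
structure Link (s : Stream Proc) (D : Set ℤ) (h tl : ℕ) (p : Proc) (t : ℤ) (a b c : ℕ) :
    Prop where
  old : cell s (t - 1) a .nxt = .addr b
  new : cell s t a .nxt = .addr c
  nxt : cell s (t - 1) c .nxt = .addr b
  alloc : ∃ t₁ ≤ t, Alloc s h tl p c t₁
  notEntered : ¬ Entered s D h (t - 1) c
  keys : ∃ ka kc kb, cell s (t - 1) a .val = .key ka ∧ cell s (t - 1) c .val = .key kc ∧
    cell s (t - 1) b .val = .key kb ∧ ka < kc ∧ kc < kb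
  only : ∀ b', b' ≠ a + Field.nxt.offset → ¬ CanWrite (Sum.inr b') p (s t)

/-- The changes which process `p` may make in the step to time `t` to a field of a node `a` that
has been in the list. -/
inductive Change (s : Stream Proc) (D : Set ℤ) (h tl : ℕ) (p : Proc) (t : ℤ) (a : ℕ) :
    Field → Prop
  | acquire : cell s (t - 1) a .lck = .null → cell s t a .lck = .proc p →
      Change s D h tl p t a .lck
  | release : cell s (t - 1) a .lck = .proc p → cell s t a .lck = .null →
      Change s D h tl p t a .lck
  | mark : cell s (t - 1) a .lck = .proc p → cell s t a .mrk = .bool true →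
      Change s D h tl p t a .mrk
  | link (b c : ℕ) : cell s (t - 1) a .lck = .proc p → cell s (t - 1) a .mrk ≠ .bool true →
      Link s D h tl p t a b c → Change s D h tl p t a .nxt
  | unlink (b : ℕ) : cell s (t - 1) a .lck = .proc p → cell s (t - 1) a .mrk ≠ .bool true →
      cell s (t - 1) a .nxt = .addr b → cell s (t - 1) b .mrk = .bool true →
      cell s t a .nxt = cell s (t - 1) b .nxt → Change s D h tl p t a .nxt

/-- A permitted change of address `b` by process `p` in the step to time `t`: either a field of a
node that has been in the list changes as described by `Change`, or `p` writes to a node which it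
has allocated itself and which has never been in the list. -/
def Permitted (s : Stream Proc) (D : Set ℤ) (h tl : ℕ) (p : Proc) (t : ℤ) (b : ℕ) : Prop :=
  (∃ a f, b = a + f.offset ∧ Entered s D h (t - 1) a ∧ Change s D h tl p t a f) ∨
    ∃ c t₁, b ∈ block c ∧ t₁ ≤ t ∧ Alloc s h tl p c t₁ ∧ ¬ Entered s D h (t - 1) c

/-- All changes in the step to time `t` are permitted. Nothing is said about addresses outside the
list for the times at which the list is known to be in its initial state. -/
structure GoodStep (s : Stream Proc) (D : Set ℤ) (h tl : ℕ) (t₀ t : ℤ) : Prop where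
  entered : ∀ a f, Entered s D h (t - 1) a → cell s t a f ≠ cell s (t - 1) a f →
    ∃ p, Wr s p t a f ∧ Change s D h tl p t a f
  all : t₀ < t → ∀ b, (s t).mem (Sum.inr b) ≠ (s (t - 1)).mem (Sum.inr b) →
    ∃ p, CanWrite (Sum.inr b) p (s t) ∧ Permitted s D h tl p t b

/-- The invariant of the list. -/
structure ListInv (s : Stream Proc) (D : Set ℤ) (h tl : ℕ) (t : ℤ) : Prop where
  known : ∀ a, Entered s D h t a → Known s h tl t a
  key : ∀ a, Entered s D h t a → ∃ k, cell s t a .val = .key k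
  edge : ∀ a b, Entered s D h t a → cell s t a .nxt = .addr b → Entered s D h t b
  sorted : ∀ a b ka kb, Entered s D h t a → cell s t a .nxt = .addr b →
    cell s t a .val = .key ka → cell s t b .val = .key kb → ka < kb
  unmarked : ∀ a, Entered s D h t a → cell s t a .mrk ≠ .bool true → Reach s h t a

section Sys

variable {s : Stream Proc} {D : Set ℤ} {P : Set Proc} {h tl : ℕ} {t₀ t : ℤ}

theorem Entered.mono {a : ℕ} {t' : ℤ} (k : Entered s D h t a) (ht : t ≤ t') :
    Entered s D h t' a := by
  obtain ⟨u, hu, hut, hr⟩ := k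
  exact ⟨u, hu, hut.trans ht, hr⟩

theorem Reach.entered {a : ℕ} (k : Reach s h t a) (ht : t ∈ D) : Entered s D h t a :=
  ⟨t, ht, le_rfl, k⟩

theorem Entered.cases {a : ℕ} (k : Entered s D h t a) :
    Entered s D h (t - 1) a ∨ Reach s h t a := by
  obtain ⟨u, hu, hut, hr⟩ := k
  rcases eq_or_lt_of_le hut with rfl | hlt
  · exact Or.inr hr
  · exact Or.inl ⟨u, hu, by omega, hr⟩

/-- The sentinel nodes do not overlap, because the initial values of overlapping fields differ. -/
theorem Sys.block_ne (hS : Sys s D P h tl t₀) (f f' : Field) :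
    h + f.offset ≠ tl + f'.offset := by
  intro e
  obtain ⟨h1, h2, h3, h4⟩ := hS.initHead t₀ hS.mem₀ le_rfl
  obtain ⟨k1, k2, k3, k4⟩ := hS.initTail t₀ hS.mem₀ le_rfl
  unfold cell at *
  have hd : h = tl ∨ h = tl + 1 ∨ h = tl + 2 ∨ h = tl + 3 ∨
      tl = h + 1 ∨ tl = h + 2 ∨ tl = h + 3 := by
    cases f <;> cases f' <;> simp only [Field.offset] at e <;> omega
  simp only [Field.offset] at *
  rcases hd with rfl | rfl | rfl | rfl | rfl | rfl | rfl <;> simp_all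

/-- The blocks of known nodes are disjoint, so that an address determines the node and the field. -/
theorem Sys.known_unique (hS : Sys s D P h tl t₀) {t' : ℤ} {a a' : ℕ} (k : Known s h tl t a)
    (k' : Known s h tl t' a') {f f' : Field} (e : a + f.offset = a' + f'.offset) :
    a = a' ∧ f = f' := by
  have key : a = a' := by
    rcases k with rfl | rfl | ⟨q, t₁, -, k⟩ <;> rcases k' with rfl | rfl | ⟨q', t₁', -, k'⟩
    · rfl
    · exact absurd e (hS.block_ne f f')
    · exact absurd (e ▸ mem_block a f) (k'.head f')
    · exact absurd e.symm (hS.block_ne f' f)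
    · rfl
    · exact absurd (e ▸ mem_block a f) (k'.tail f')
    · exact absurd (e ▸ mem_block a' f') (k.head f)
    · exact absurd (e ▸ mem_block a' f') (k.tail f)
    · exact (k.unique hS.healthy k' e).2.1
  exact ⟨key, Field.offset_inj (by omega)⟩

theorem Sys.reach_init (hS : Sys s D P h tl t₀) (ht : t ∈ D) (h₀ : t ≤ t₀) {a : ℕ}
    (k : Reach s h t a) : a = h ∨ a = tl := by
  induction k with
  | refl => exact Or.inl rfl
  | tail _ hst ih =>
    rcases ih with rfl | rfl
    · rw [(hS.initHead t ht h₀).2.1] at hst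
      cases hst; exact Or.inr rfl
    · rw [(hS.initTail t ht h₀).2.1] at hst
      cases hst

theorem Sys.entered_init (hS : Sys s D P h tl t₀) (h₀ : t ≤ t₀) {a : ℕ}
    (k : Entered s D h t a) : a = h ∨ a = tl := by
  obtain ⟨u, hu, hut, hr⟩ := k
  exact hS.reach_init hu (hut.trans h₀) hr

/-- In the initial state the nodes of the list do not change. -/
theorem Sys.goodStep_init (hS : Sys s D P h tl t₀) (ht : t ∈ D) (ht' : t - 1 ∈ D) (h₀ : t ≤ t₀) :
    GoodStep s D h tl t₀ t := by
  refine ⟨fun a f ha hne => absurd ?_ hne, fun hlt => by omega⟩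
  obtain ⟨h1, h2, h3, h4⟩ := hS.initHead t ht h₀
  obtain ⟨k1, k2, k3, k4⟩ := hS.initTail t ht h₀
  obtain ⟨h1', h2', h3', h4'⟩ := hS.initHead (t - 1) ht' (by omega)
  obtain ⟨k1', k2', k3', k4'⟩ := hS.initTail (t - 1) ht' (by omega)
  rcases hS.entered_init (by omega) ha with rfl | rfl <;> cases f <;> simp [*]

theorem Sys.reach_tail_init (hS : Sys s D P h tl t₀) (ht : t ∈ D) (h₀ : t ≤ t₀) :
    Reach s h t tl :=
  Relation.ReflTransGen.single (hS.initHead t ht h₀).2.1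

theorem Sys.listInv_init (hS : Sys s D P h tl t₀) (ht : t ∈ D) (h₀ : t ≤ t₀) :
    ListInv s D h tl t := by
  obtain ⟨h1, h2, h3, h4⟩ := hS.initHead t ht h₀
  obtain ⟨k1, k2, k3, k4⟩ := hS.initTail t ht h₀
  refine ⟨fun a ha => ?_, fun a ha => ?_, fun a b ha hb => ?_, fun a b ka kb ha hb hka hkb => ?_,
    fun a ha _ => ?_⟩
  · rcases hS.entered_init h₀ ha with rfl | rfl
    · exact Or.inl rfl
    · exact Or.inr (Or.inl rfl)
  · rcases hS.entered_init h₀ ha with rfl | rfl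
    · exact ⟨_, h1⟩
    · exact ⟨_, k1⟩
  · rcases hS.entered_init h₀ ha with rfl | rfl
    · rw [h2] at hb
      cases hb
      exact (hS.reach_tail_init ht h₀).entered ht
    · rw [k2] at hb; cases hb
  · rcases hS.entered_init h₀ ha with rfl | rfl
    · rw [h2] at hb
      cases hb
      rw [h1] at hka; rw [k1] at hkb
      cases hka; cases hkb
      exact bot_lt_top
    · rw [k2] at hb; cases hb
  · rcases hS.entered_init h₀ ha with rfl | rfl
    · exact Relation.ReflTransGen.refl
    · exact hS.reach_tail_init ht h₀

/-! ### Consequences of a permitted step -/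

/-- The fields of a node that is in preparation are changed by its owner only. -/
theorem GoodStep.private_cell (hG : GoodStep s D h tl t₀ t) (hS : Sys s D P h tl t₀)
    (hI : ListInv s D h tl (t - 1)) (h₀ : t₀ < t) {p : Proc} {c : ℕ} {t₁ : ℤ} {f : Field}
    (ha : Alloc s h tl p c t₁) (hc : ¬ Entered s D h (t - 1) c)
    (hw : ¬ Wr s p t c f) : cell s t c f = cell s (t - 1) c f := by
  by_contra hne
  obtain ⟨q, hq, hp⟩ := hG.all h₀ _ hne
  rcases hp with ⟨a, f', e, he, -⟩ | ⟨c', t', ⟨f', e⟩, -, ha', -⟩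
  · have := hS.known_unique (hI.known a he) (Or.inr (Or.inr ⟨p, t₁, le_rfl, ha⟩)) e.symm
    exact hc (this.1 ▸ he)
  · obtain ⟨rfl, -, -⟩ := ha.unique hS.healthy ha' e
    exact hw hq

/-- The new node does not change in the step in which it is linked, since its owner, the only process
that might change it, writes elsewhere. -/
theorem Link.cell_new {p : Proc} {a b c : ℕ} (hL : Link s D h tl p t a b c)
    (hG : GoodStep s D h tl t₀ t) (hS : Sys s D P h tl t₀)
    (hI : ListInv s D h tl (t - 1)) (h₀ : t₀ < t) (ha : Entered s D h (t - 1) a) (f : Field) :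
    cell s t c f = cell s (t - 1) c f := by
  obtain ⟨t₁, -, hal⟩ := hL.alloc
  refine hG.private_cell hS hI h₀ hal hL.notEntered (hL.only _ fun e => hL.notEntered ?_)
  have := hS.known_unique (hI.known a ha) (Or.inr (Or.inr ⟨p, t₁, le_rfl, hal⟩)) e.symm
  exact this.1 ▸ ha

theorem GoodStep.val_eq (hG : GoodStep s D h tl t₀ t) {a : ℕ} (ha : Entered s D h (t - 1) a) :
    cell s t a .val = cell s (t - 1) a .val := by
  by_contra hne
  obtain ⟨p, -, hc⟩ := hG.entered a _ ha hne
  cases hc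

theorem GoodStep.marked (hG : GoodStep s D h tl t₀ t) {a : ℕ} (ha : Entered s D h (t - 1) a)
    (hm : cell s (t - 1) a .mrk = .bool true) : cell s t a .mrk = .bool true := by
  by_contra hne
  obtain ⟨p, -, hc⟩ := hG.entered a .mrk ha (fun e => hne (e.trans hm))
  cases hc with
  | mark _ h => exact hne h

theorem GoodStep.nxt_frozen (hG : GoodStep s D h tl t₀ t) {a : ℕ} (ha : Entered s D h (t - 1) a)
    (hm : cell s (t - 1) a .mrk = .bool true) : cell s t a .nxt = cell s (t - 1) a .nxt := by
  by_contra hne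
  obtain ⟨p, -, hc⟩ := hG.entered a .nxt ha hne
  cases hc with
  | link _ _ _ h _ => exact h hm
  | unlink _ _ h _ _ _ => exact h hm

/-- A locked node is modified by the holder of its lock only. -/
theorem GoodStep.locked (hG : GoodStep s D h tl t₀ t) {a : ℕ} {p : Proc}
    (ha : Entered s D h (t - 1) a) (hl : cell s (t - 1) a .lck = .proc p) {f : Field}
    (hw : ¬ Wr s p t a f) : cell s t a f = cell s (t - 1) a f := by
  by_contra hne
  obtain ⟨q, hq, hc⟩ := hG.entered a f ha hne
  have hqp : cell s (t - 1) a .lck = .proc q := by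
    cases hc with
    | acquire h _ => rw [hl] at h; cases h
    | release h _ => exact h
    | mark h _ => exact h
    | link _ _ h _ _ => exact h
    | unlink _ h _ _ _ _ => exact h
  rw [hl] at hqp
  cases hqp
  exact hw hq

/-- Only marked nodes leave the list. -/
theorem GoodStep.reach (hG : GoodStep s D h tl t₀ t) (hS : Sys s D P h tl t₀)
    (ht : t - 1 ∈ D) (hI : ListInv s D h tl (t - 1)) (h₀ : t₀ < t) {a : ℕ}
    (ha : Reach s h (t - 1) a) : Reach s h t a ∨ cell s (t - 1) a .mrk = .bool true := by
  -- A node that drops out of the list is bypassed by the new edge of a remaining node.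
  have key : Reach s h t a ∨ (cell s (t - 1) a .mrk = .bool true ∧
      ∃ u, Reach s h t u ∧ cell s t u .nxt = cell s (t - 1) a .nxt) := by
    induction ha with
    | refl => exact Or.inl Relation.ReflTransGen.refl
    | @tail n m hn hst ih =>
      rcases ih with hr | ⟨-, u, hu, e⟩
      · by_cases hne : cell s t n .nxt = cell s (t - 1) n .nxt
        · exact Or.inl (hr.tail (hne.trans hst))
        · have hnE := Reach.entered hn ht
          obtain ⟨q, -, hc⟩ := hG.entered n .nxt hnE hne
          cases hc with
          | link b c _ _ hL =>
            have e₁ := hL.old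
            rw [hst] at e₁
            cases e₁
            have e₂ := hL.cell_new hG hS hI h₀ hnE .nxt
            rw [hL.nxt] at e₂
            exact Or.inl ((hr.tail hL.new).tail e₂)
          | unlink b _ _ e₁ hm e₂ =>
            rw [hst] at e₁
            cases e₁
            exact Or.inr ⟨hm, n, hr, e₂⟩
      · exact Or.inl (hu.tail (e.trans hst))
  exact key.imp id fun k => k.1

/-- A node enters the list only by a `Link`. -/
theorem GoodStep.reach_new (hG : GoodStep s D h tl t₀ t) (hS : Sys s D P h tl t₀)
    (ht : t - 1 ∈ D) (hI : ListInv s D h tl (t - 1)) (h₀ : t₀ < t) {a : ℕ}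
    (ha : Reach s h t a) : Entered s D h (t - 1) a ∨
      ∃ p u b, Entered s D h (t - 1) u ∧ Wr s p t u .nxt ∧ cell s (t - 1) u .mrk ≠ .bool true ∧
        Link s D h tl p t u b a := by
  induction ha with
  | refl => exact Or.inl (Reach.entered Relation.ReflTransGen.refl ht)
  | @tail n m hn hst ih =>
    rcases ih with hE | ⟨p, u, b, hu, -, -, hL⟩
    · by_cases hne : cell s t n .nxt = cell s (t - 1) n .nxt
      · rw [hne] at hst
        exact Or.inl (hI.edge n m hE hst)
      · obtain ⟨q, hq, hc⟩ := hG.entered n .nxt hE hne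
        cases hc with
        | link b c _ hm hL =>
          have e₁ := hL.new
          rw [hst] at e₁
          cases e₁
          exact Or.inr ⟨q, n, b, hE, hq, hm, hL⟩
        | unlink b _ _ e₁ _ e₂ =>
          rw [hst] at e₂
          exact Or.inl (hI.edge b m (hI.edge n b hE e₁) e₂.symm)
    · rw [hL.cell_new hG hS hI h₀ hu .nxt, hL.nxt] at hst
      cases hst
      exact Or.inl (hI.edge u _ hu hL.old)

/-- Permitted steps preserve the invariant of the list, even if several processes write at once. -/
theorem GoodStep.listInv (hG : GoodStep s D h tl t₀ t) (hS : Sys s D P h tl t₀) (ht' : t ∈ D)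
    (ht : t - 1 ∈ D) (hI : ListInv s D h tl (t - 1)) (h₀ : t₀ < t) : ListInv s D h tl t := by
  have hle : t - 1 ≤ t := by omega
  have hcases : ∀ a, Entered s D h t a → Entered s D h (t - 1) a ∨
      ∃ p u b, Entered s D h (t - 1) u ∧ Wr s p t u .nxt ∧ cell s (t - 1) u .mrk ≠ .bool true ∧
        Link s D h tl p t u b a := by
    intro a ha
    rcases ha.cases with h | h
    · exact Or.inl h
    · exact hG.reach_new hS ht hI h₀ h
  have hunm : ∀ a, Entered s D h (t - 1) a → cell s (t - 1) a .mrk ≠ .bool true →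
      Reach s h t a := fun a ha hm =>
    (hG.reach hS ht hI h₀ (hI.unmarked a ha hm)).resolve_right hm
  refine ⟨fun a ha => ?_, fun a ha => ?_, fun a b ha hb => ?_, fun a b ka kb ha hb hka hkb => ?_,
    fun a ha hm => ?_⟩
  · rcases hcases a ha with hE | ⟨p, u, b, hu, -, -, hL⟩
    · rcases hI.known a hE with h | h | ⟨q, t₁, h₁, h⟩
      · exact Or.inl h
      · exact Or.inr (Or.inl h)
      · exact Or.inr (Or.inr ⟨q, t₁, h₁.trans hle, h⟩)
    · obtain ⟨t₁, h₁, h⟩ := hL.alloc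
      exact Or.inr (Or.inr ⟨p, t₁, h₁, h⟩)
  · rcases hcases a ha with hE | ⟨p, u, b, hu, -, -, hL⟩
    · rw [hG.val_eq hE]
      exact hI.key a hE
    · rw [hL.cell_new hG hS hI h₀ hu]
      obtain ⟨ka, kc, kb, -, h, -⟩ := hL.keys
      exact ⟨kc, h⟩
  · rcases hcases a ha with hE | ⟨p, u, d, hu, -, -, hL⟩
    · by_cases hne : cell s t a .nxt = cell s (t - 1) a .nxt
      · rw [hne] at hb
        exact (hI.edge a b hE hb).mono hle
      · obtain ⟨q, hq, hc⟩ := hG.entered a .nxt hE hne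
        cases hc with
        | link b' c _ hm hL =>
          have e₁ := hL.new
          rw [hb] at e₁
          cases e₁
          exact Reach.entered ((hunm a hE hm).tail hb) ht'
        | unlink b' _ _ e₁ _ e₂ =>
          rw [hb] at e₂
          exact (hI.edge b' b (hI.edge a b' hE e₁) e₂.symm).mono hle
    · rw [hL.cell_new hG hS hI h₀ hu .nxt, hL.nxt] at hb
      cases hb
      exact (hI.edge u _ hu hL.old).mono hle
  · rcases hcases a ha with hE | ⟨p, u, d, hu, -, -, hL⟩
    · rw [hG.val_eq hE] at hka
      by_cases hne : cell s t a .nxt = cell s (t - 1) a .nxt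
      · rw [hne] at hb
        rw [hG.val_eq (hI.edge a b hE hb)] at hkb
        exact hI.sorted a b ka kb hE hb hka hkb
      · obtain ⟨q, hq, hc⟩ := hG.entered a .nxt hE hne
        cases hc with
        | link b' c _ hm hL =>
          have e₁ := hL.new
          rw [hb] at e₁
          cases e₁
          rw [hL.cell_new hG hS hI h₀ hE] at hkb
          obtain ⟨ka', kc', kb', e₁, e₂, -, hlt, -⟩ := hL.keys
          rw [hka] at e₁
          rw [hkb] at e₂
          cases e₁; cases e₂
          exact hlt
        | unlink b' _ _ e₁ _ e₂ =>
          rw [hb] at e₂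
          have hE' := hI.edge a b' hE e₁
          rw [hG.val_eq (hI.edge b' b hE' e₂.symm)] at hkb
          obtain ⟨kb', hk'⟩ := hI.key b' hE'
          exact (hI.sorted a b' ka kb' hE e₁ hka hk').trans
            (hI.sorted b' b kb' kb hE' e₂.symm hk' hkb)
    · rw [hL.cell_new hG hS hI h₀ hu .nxt, hL.nxt] at hb
      cases hb
      rw [hL.cell_new hG hS hI h₀ hu] at hka
      rw [hG.val_eq (hI.edge u _ hu hL.old)] at hkb
      obtain ⟨ka', kc', kb', -, e₂, e₃, -, hlt⟩ := hL.keys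
      rw [hka] at e₂
      rw [hkb] at e₃
      cases e₂; cases e₃
      exact hlt
  · rcases ha.cases with hE | h
    · exact hunm a hE fun h => hm (hG.marked hE h)
    · exact h

end Sys

/-! ### Evaluation in apparent states -/

/-- What is read in an apparent state has been the value of the location at some time. -/
theorem possibly.elim {p : Proc} {c : Expr Proc} {Δ : Intv} {s : Stream Proc}
    (h : possibly p c Δ s) : ∃ σ : Loc Proc → Option (Val Proc),
      (∀ va k, σ va = some k → ∃ t ∈ Δ.1, (s t).mem va = k) ∧ c.eval σ = some (.bool true) := by
  obtain ⟨σ, ⟨h₁, h₂⟩, he⟩ := h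
  refine ⟨σ, fun va k hk => ?_, he⟩
  by_cases hva : va ∈ locs c Δ s
  · obtain ⟨t, ht, e, -⟩ := h₁ va hva
    rw [hk] at e
    cases e
    exact ⟨t, ht, rfl⟩
  · rw [h₂ va hva] at hk
    cases hk

section Eval

variable {σ : Loc Proc → Option (Val Proc)} {e e₁ e₂ : Expr Proc} {v : Var Proc} {f : Field}
  {k : Val Proc} {b : Bool}

theorem eval_eq_const : (Expr.eq e (.const k)).eval σ = some (.bool true) ↔ e.eval σ = some k := by
  simp only [Expr.eval]
  cases e.eval σ <;> simp

theorem eval_eq : (Expr.eq e₁ e₂).eval σ = some (.bool b) ↔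
    ∃ k₁ k₂, e₁.eval σ = some k₁ ∧ e₂.eval σ = some k₂ ∧ (b = true ↔ k₁ = k₂) := by
  simp only [Expr.eval]
  cases e₁.eval σ <;> cases e₂.eval σ <;> cases b <;> simp

theorem eval_fld : (Expr.fld e f).eval σ = some k ↔
    ∃ a, e.eval σ = some (.addr a) ∧ k = .addr (a + f.offset) := by
  simp only [Expr.eval]
  split
  · rename_i a h
    simp [h, eq_comm]
  · rename_i h
    simp only [reduceCtorEq, false_iff, not_exists, not_and]
    intro a ha
    exact absurd ha (h a)

theorem eval_at : (e.at f).eval σ = some k ↔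
    ∃ a, e.eval σ = some (.addr a) ∧ σ (Sum.inr (a + f.offset)) = some k := by
  simp only [Expr.at, Expr.eval]
  cases e.eval σ with
  | none => simp
  | some w => cases w <;> simp

theorem eval_not : (Expr.not e).eval σ = some (.bool b) ↔ e.eval σ = some (.bool (!b)) := by
  simp only [Expr.eval]
  cases e.eval σ with
  | none => simp
  | some w => cases w <;> cases b <;> simp

theorem eval_and : (Expr.and e₁ e₂).eval σ = some k ↔
    ∃ b₁ b₂, e₁.eval σ = some (.bool b₁) ∧ e₂.eval σ = some (.bool b₂) ∧ k = .bool (b₁ && b₂) := by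
  simp only [Expr.eval]
  cases e₁.eval σ with
  | none => simp
  | some w =>
    cases e₂.eval σ with
    | none => cases w <;> simp
    | some w' => cases w <;> cases w' <;> simp [eq_comm]

theorem eval_lt : (Expr.lt e₁ e₂).eval σ = some (.bool true) ↔
    ∃ k l, e₁.eval σ = some (.key k) ∧ e₂.eval σ = some (.key l) ∧ k < l := by
  simp only [Expr.eval]
  cases e₁.eval σ with
  | none => simp
  | some w =>
    cases e₂.eval σ with
    | none => cases w <;> simp
    | some w' => cases w <;> cases w' <;> simp

theorem eval_le : (Expr.le e₁ e₂).eval σ = some (.bool true) ↔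
    ∃ k l, e₁.eval σ = some (.key k) ∧ e₂.eval σ = some (.key l) ∧ k ≤ l := by
  simp only [Expr.eval]
  cases e₁.eval σ with
  | none => simp
  | some w =>
    cases e₂.eval σ with
    | none => cases w <;> simp
    | some w' => cases w <;> cases w' <;> simp

theorem eval_const : (Expr.const k).eval σ = some k := rfl

end Eval

/-- Each value of the partial state `σ` occurs at some time after `n` and up to `m`. -/
def Seen (s : Stream Proc) (n m : ℤ) (σ : Loc Proc → Option (Val Proc)) : Prop :=
  ∀ va k, σ va = some k → ∃ t, n < t ∧ t ≤ m ∧ (s t).mem va = k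

/-! ### Rules for the primitive commands -/

/-- A segment of a run of `p` within `D`, from time `n` to a time `m` before `T`, in which `p`
writes to no location of `Z` outside `W`. -/
structure Seg (s : Stream Proc) (D : Set ℤ) (T : ℤ) (p : Proc) (Z W : Set (Loc Proc)) (n m : ℤ) :
    Prop where
  start : n ∈ D
  le : n ≤ m
  lt : m < T
  mem : ∀ t, n < t → t ≤ m → t ∈ D
  idle : ∀ t, n < t → t ≤ m → ∀ va ∈ Z, va ∉ W → ¬ CanWrite va p (s t)

/-- `v` is a local variable of `p` in the context `Z`. -/
def Own (p : Proc) (Z : Set (Loc Proc)) (v : Var Proc) : Prop :=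
  v.owner = some p ∧ Sum.inl v ∈ Z

section Rules

variable {s : Stream Proc} {D : Set ℤ} {T : ℤ} {p : Proc} {Z W : Set (Loc Proc)} {n m : ℤ}
  {J K : ℤ → Prop} {Goal : Prop}

theorem Seg.mem' (hs : Seg s D T p Z W n m) {t : ℤ} (h₁ : n ≤ t) (h₂ : t ≤ m) : t ∈ D := by
  rcases eq_or_lt_of_le h₁ with rfl | h
  · exact hs.start
  · exact hs.mem t h h₂

theorem Seg.take (hs : Seg s D T p Z W n m) {t : ℤ} (h₁ : n ≤ t) (h₂ : t ≤ m) :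
    Seg s D T p Z W n t :=
  ⟨hs.start, h₁, h₂.trans_lt hs.lt, fun u hu hu' => hs.mem u hu (hu'.trans h₂),
    fun u hu hu' => hs.idle u hu (hu'.trans h₂)⟩

theorem Seg.var (hs : Seg s D T p Z W n m) (hh : Healthy s) {v : Var Proc} (hv : Own p Z v)
    (hW : Sum.inl v ∉ W) : (s m).mem (Sum.inl v) = (s n).mem (Sum.inl v) := by
  refine int_stable (J := fun t => (s t).mem (Sum.inl v) = (s n).mem (Sum.inl v)) hs.le rfl ?_
  intro t h₁ h₂ e
  rw [← e]
  by_contra hne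
  obtain ⟨q, hq⟩ := hh.frame t _ hne
  have := hh.own t v p q hv.1 hq
  subst this
  exact hs.idle t h₁ h₂ _ hv.2 hW hq

theorem Seg.seen_var (hs : Seg s D T p Z W n m) (hh : Healthy s) {v : Var Proc} (hv : Own p Z v)
    (hW : Sum.inl v ∉ W) {σ : Loc Proc → Option (Val Proc)} {k : Val Proc} (hσ : Seen s n m σ)
    (e : σ (Sum.inl v) = some k) : (s n).mem (Sum.inl v) = k := by
  obtain ⟨t, h₁, h₂, rfl⟩ := hσ _ _ e
  exact ((hs.take h₁.le h₂).var hh hv hW).symm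

/-- The value of `v ↦ f` in an apparent state is that of the field at some time. -/
theorem Seg.seen_at (hs : Seg s D T p Z W n m) (hh : Healthy s) {v : Var Proc} (hv : Own p Z v)
    (hW : Sum.inl v ∉ W) {σ : Loc Proc → Option (Val Proc)} {k : Val Proc} {f : Field}
    (hσ : Seen s n m σ) (e : ((Expr.var v).at f).eval σ = some k) :
    ∃ a t, (s n).mem (Sum.inl v) = .addr a ∧ n < t ∧ t ≤ m ∧ cell s t a f = k := by
  obtain ⟨a, h₁, h₂⟩ := eval_at.1 e
  obtain ⟨t, ht, ht', e'⟩ := hσ _ _ h₂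
  exact ⟨a, t, hs.seen_var hh hv hW hσ h₁, ht, ht', e'⟩

theorem idle_of_mem {u v : Pos} {t : ℤ} (hi : idleBeh {p} Z (ioc u v) s) (ht : u < (t : Pos))
    (ht' : (t : Pos) ≤ v) {va : Loc Proc} (hva : va ∈ Z) : ¬ CanWrite va p (s t) :=
  hi p rfl va hva t ⟨ht, ht'⟩

theorem seg_of_idle {m : ℤ} (hT : (m : Pos) < (T : Pos)) (hnm : (n : Pos) ≤ (m : Pos)) (hn : n ∈ D)
    (hD : (ioc (n : Pos) (m : Pos)).1 ⊆ D) (hi : idleBeh {p} (Z \ W) (ioc (n : Pos) (m : Pos)) s) :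
    Seg s D T p Z W n m := by
  norm_cast at hT hnm
  exact ⟨hn, hnm, hT, fun t h₁ h₂ => hD (mem_ioc_coe.2 ⟨h₁, h₂⟩), fun t h₁ h₂ va hZ hW =>
    hi p rfl va ⟨hZ, hW⟩ t (mem_ioc_coe.2 ⟨h₁, h₂⟩)⟩

theorem at_end (hs : Seg s D T p Z W n m) (h : K m) : At D K (m : Pos) :=
  ⟨m, rfl, hs.mem' hs.le le_rfl, h⟩

theorem walk_idle (hZ : ∀ b, Sum.inr b ∈ Z)
    (hidle : T ∈ D → (∀ b, ¬ CanWrite (Sum.inr b) p (s T)) → Goal)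
    (H : ∀ n m, Seg s D T p Z ∅ n m → J n → K m) :
    Walk s D T Goal (idleBeh {p} Z) (At D J) (At D K) := by
  rintro u v huv hu hD hi ⟨n, rfl, hn, hJ⟩
  refine ⟨fun hv => hidle (hD ⟨hu, hv⟩) fun b => idle_of_mem hi hu hv (hZ b), fun hv => ?_⟩
  obtain ⟨m, rfl⟩ := Pos.eq_coe huv hv
  have hs : Seg s D T p Z ∅ n m := seg_of_idle hv huv hn hD (by rwa [Set.sdiff_empty])
  exact at_end hs (H n m hs hJ)

theorem walk_eval {c : Expr Proc} (hZ : ∀ b, Sum.inr b ∈ Z)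
    (hidle : T ∈ D → (∀ b, ¬ CanWrite (Sum.inr b) p (s T)) → Goal)
    (H : ∀ n m σ, Seg s D T p Z ∅ n m → J n → Seen s n m σ → c.eval σ = some (.bool true) → K m) :
    Walk s D T Goal (evalBeh p Z c) (At D J) (At D K) := by
  rintro u v huv hu hD ⟨hp, hi⟩ ⟨n, rfl, hn, hJ⟩
  refine ⟨fun hv => hidle (hD ⟨hu, hv⟩) fun b => idle_of_mem hi hu hv (hZ b), fun hv => ?_⟩
  obtain ⟨m, rfl⟩ := Pos.eq_coe huv hv
  have hs : Seg s D T p Z ∅ n m := seg_of_idle hv huv hn hD (by rwa [Set.sdiff_empty])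
  obtain ⟨σ, hσ, he⟩ := hp.elim
  refine at_end hs (H n m σ hs hJ (fun va k hk => ?_) he)
  obtain ⟨t, ht, e⟩ := hσ va k hk
  rw [mem_ioc_coe] at ht
  exact ⟨t, ht.1, ht.2, e⟩

theorem update_nonempty {va : Loc Proc} {k : Val Proc} : NonEmp (update p Z va k) :=
  fun _ _ h => Set.nonempty_iff_ne_empty.2 h.2.1

theorem walk_update_var {v : Var Proc} {k : Val Proc} (hZ : ∀ b, Sum.inr b ∈ Z)
    (hidle : T ∈ D → (∀ b, ¬ CanWrite (Sum.inr b) p (s T)) → Goal)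
    (H : ∀ n m, Seg s D T p Z {Sum.inl v} n m → n < m → J n → (s m).mem (Sum.inl v) = k → K m) :
    Walk s D T Goal (update p Z (Sum.inl v) k) (At D J) (At D K) := by
  rintro u w huv hu hD hg ⟨n, rfl, hn, hJ⟩
  obtain ⟨t, ht⟩ := update_nonempty _ _ hg
  obtain ⟨hi, -, hk⟩ := hg
  refine ⟨fun hv => hidle (hD ⟨hu, hv⟩) fun b =>
    idle_of_mem hi hu hv ⟨hZ b, by simp⟩, fun hv => ?_⟩
  obtain ⟨m, rfl⟩ := Pos.eq_coe huv hv
  have hs : Seg s D T p Z {Sum.inl v} n m := seg_of_idle hv huv hn hD hi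
  rw [mem_ioc_coe] at ht
  have hlt : n < m := by omega
  exact at_end hs (H n m hs hlt hJ (hk m (mem_ioc_coe.2 ⟨hlt, le_rfl⟩)).1)

theorem walk_exists {ι : Sort*} {g : ι → IntvPred Proc} {A B : Pos → Prop}
    (H : ∀ i, Walk s D T Goal (g i) A B) :
    Walk s D T Goal (fun Δ s => ∃ i, g i Δ s) A B := by
  rintro u v huv hu hD ⟨i, hi⟩ hA
  exact H i u v huv hu hD hi hA

/-- An assignment to a local variable changes no address. Here `Q k` describes the times at which the
value `k` has been computed. -/
theorem walk_assign {v : Var Proc} {e : Expr Proc} (Q : Val Proc → ℤ → Prop)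
    (hZ : ∀ b, Sum.inr b ∈ Z)
    (hidle : T ∈ D → (∀ b, ¬ CanWrite (Sum.inr b) p (s T)) → Goal)
    (He : ∀ n m σ k, Seg s D T p Z ∅ n m → J n → Seen s n m σ → e.eval σ = some k → Q k m)
    (Hu : ∀ n m k, Seg s D T p Z {Sum.inl v} n m → n < m → Q k n → (s m).mem (Sum.inl v) = k →
      K m) :
    Walk s D T Goal (assignBeh p Z v e) (At D J) (At D K) :=
  walk_exists fun k => Walk.chop
    (walk_eval (K := Q k) hZ hidle fun n m σ hs hJ hσ he =>
      He n m σ k hs hJ hσ (eval_eq_const.1 he))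
    (walk_update_var hZ hidle fun n m hs hlt hQ => Hu n m k hs hlt hQ)

/-- The assignment of `Head` to a local variable needs no precondition. -/
theorem walk_assign_head {v : Var Proc} {h : ℕ} (hZ : ∀ b, Sum.inr b ∈ Z)
    (hidle : T ∈ D → (∀ b, ¬ CanWrite (Sum.inr b) p (s T)) → Goal)
    (hh : ∀ t ∈ D, (s t).mem (Sum.inl .Head) = .addr h) :
    Walk s D T Goal (assignBeh p Z v (.var .Head)) (fun _ => True)
      (At D fun n => (s n).mem (Sum.inl v) = .addr h) := by
  refine walk_exists fun k => Walk.chop (B := fun _ => k = .addr h) ?_ ?_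
  · rintro u w huw hu hD ⟨hp, hi⟩ -
    refine ⟨fun hv => hidle (hD ⟨hu, hv⟩) fun b => idle_of_mem hi hu hv (hZ b), fun _ => ?_⟩
    obtain ⟨σ, hσ, he⟩ := hp.elim
    obtain ⟨t, ht, rfl⟩ := hσ _ _ (eval_eq_const.1 he)
    exact hh t (hD ht)
  · rintro u w huw hu hD hg rfl
    obtain ⟨t, ht⟩ := update_nonempty _ _ hg
    obtain ⟨hi, -, hk⟩ := hg
    refine ⟨fun hv => hidle (hD ⟨hu, hv⟩) fun b =>
      idle_of_mem hi hu hv ⟨hZ b, by simp⟩, fun hv => ?_⟩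
    obtain ⟨m, rfl⟩ := Pos.eq_coe ht.2 hv
    have hm : m ∈ (ioc u (m : Pos)).1 := ⟨ht.1.trans_le ht.2, le_rfl⟩
    exact ⟨m, rfl, hD hm, (hk m hm).1⟩

/-- The changes of addresses that `p` makes in the step to `T` are permitted. -/
def GoodAt (s : Stream Proc) (D : Set ℤ) (h tl : ℕ) (p : Proc) (T : ℤ) : Prop :=
  ∀ b, (s T).mem (Sum.inr b) ≠ (s (T - 1)).mem (Sum.inr b) → CanWrite (Sum.inr b) p (s T) →
    Permitted s D h tl p T b

theorem GoodAt.of_idle {h tl : ℕ} (_ : T ∈ D) (hi : ∀ b, ¬ CanWrite (Sum.inr b) p (s T)) :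
    GoodAt s D h tl p T := fun b _ hb => absurd hb (hi b)

/-- In an update of a field, only the first state of the interval can bring a change, and this change
has to be permitted. -/
theorem walk_update_cell {h tl a : ℕ} {f : Field} {k : Val Proc} (hZ : ∀ b, Sum.inr b ∈ Z)
    (Hg : T - 1 ∈ D → T ∈ D → J (T - 1) → cell s T a f = k →
      (∀ b, b ≠ a + f.offset → ¬ CanWrite (Sum.inr b) p (s T)) →
      Permitted s D h tl p T (a + f.offset))
    (H : ∀ n m, Seg s D T p Z {Sum.inr (a + f.offset)} n m → n < m → J n → cell s m a f = k →
      K m) :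
    Walk s D T (GoodAt s D h tl p T) (update p Z (Sum.inr (a + f.offset)) k)
      (At D J) (At D K) := by
  rintro u w huv hu hD hg ⟨n, rfl, hn, hJ⟩
  obtain ⟨t, ht⟩ := update_nonempty _ _ hg
  obtain ⟨hi, -, hk⟩ := hg
  constructor
  · intro hv b hne hb
    have honly : ∀ b, b ≠ a + f.offset → ¬ CanWrite (Sum.inr b) p (s T) := fun b hb =>
      idle_of_mem hi hu hv ⟨hZ b, by simpa using hb⟩
    have hba : b = a + f.offset := by
      by_contra hne
      exact honly b hne hb
    subst hba
    have hk' := (hk T ⟨hu, hv⟩).1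
    have hu' : n < T := by exact_mod_cast hu
    -- Only the first state of the interval can be reached by a change.
    rcases eq_or_lt_of_le (show n + 1 ≤ T by omega) with rfl | hlt
    · rw [add_sub_cancel_right] at Hg
      exact Hg hn (hD ⟨hu, hv⟩) hJ hk' honly
    · have : T - 1 ∈ (ioc (n : Pos) w).1 := by
        refine ⟨by norm_cast; omega, le_trans ?_ hv⟩
        norm_cast; omega
      exact absurd (hk'.trans (hk _ this).1.symm) hne
  · intro hv
    obtain ⟨m, rfl⟩ := Pos.eq_coe huv hv
    have hs : Seg s D T p Z {Sum.inr (a + f.offset)} n m := seg_of_idle hv huv hn hD hi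
    rw [mem_ioc_coe] at ht
    have hlt : n < m := by omega
    exact at_end hs (H n m hs hlt hJ (hk m (mem_ioc_coe.2 ⟨hlt, le_rfl⟩)).1)

/-- An assignment to a field of the node whose address is in the local variable `v`. -/
theorem walk_assign_cell {h tl : ℕ} {v : Var Proc} {f : Field} {e : Expr Proc} (hh : Healthy s)
    (hv : Own p Z v) (hZ : ∀ b, Sum.inr b ∈ Z)
    (he : (∃ k, e = .const k) ∨ ∃ v', Own p Z v' ∧ e = .var v')
    (hJ : ∀ n m, Seg s D T p Z ∅ n m → J n → J m)
    (Hg : ∀ a k, T - 1 ∈ D → T ∈ D → J (T - 1) → (s (T - 1)).mem (Sum.inl v) = .addr a →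
      e.evalIn (s (T - 1)) = some k → cell s T a f = k →
      (∀ b, b ≠ a + f.offset → ¬ CanWrite (Sum.inr b) p (s T)) →
      Permitted s D h tl p T (a + f.offset))
    (H : ∀ n m a k, Seg s D T p Z {Sum.inr (a + f.offset)} n m → n < m → J n →
      (s n).mem (Sum.inl v) = .addr a → e.evalIn (s n) = some k → cell s m a f = k → K m) :
    Walk s D T (GoodAt s D h tl p T) (assignAtBeh p Z (.fld (.var v) f) e) (At D J) (At D K) := by
  have he' : ∀ n m σ k, Seg s D T p Z ∅ n m → Seen s n m σ → e.eval σ = some k →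
      e.evalIn (s m) = some k := by
    intro n m σ k hs hσ hk
    rcases he with ⟨k', rfl⟩ | ⟨v', hv', rfl⟩
    · exact hk
    · have h₁ := hs.seen_var hh hv' (by simp) hσ hk
      have h₂ := hs.var hh hv' (by simp)
      exact congrArg some (h₂.trans h₁)
  refine walk_exists fun k => walk_exists fun a' => Walk.chop
    (B := At D fun n => ∃ a, a' = a + f.offset ∧ J n ∧ (s n).mem (Sum.inl v) = .addr a ∧
      e.evalIn (s n) = some k) ?_ ?_
  · refine walk_eval hZ GoodAt.of_idle fun n m σ hs hn hσ hc => ?_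
    obtain ⟨b₁, b₂, h₁, h₂, h₃⟩ := eval_and.1 hc
    have : b₁ = true ∧ b₂ = true := by
      cases b₁ <;> cases b₂ <;> simp_all
    obtain ⟨rfl, rfl⟩ := this
    obtain ⟨a, h₄, h₅⟩ := eval_fld.1 (eval_eq_const.1 h₁)
    refine ⟨a, by simpa using h₅, hJ n m hs hn, ?_, he' n m σ k hs hσ (eval_eq_const.1 h₂)⟩
    rw [hs.var hh hv (by simp)]
    exact hs.seen_var hh hv (by simp) hσ h₄
  · intro u w huw hu hD hg hA
    obtain ⟨n, rfl, hn, a, rfl, hJn, hva, hek⟩ := hA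
    exact walk_update_cell (J := fun n => J n ∧ (s n).mem (Sum.inl v) = .addr a ∧
      e.evalIn (s n) = some k) hZ
      (fun h₁ h₂ h₃ h₄ h₅ => Hg a k h₁ h₂ h₃.1 h₃.2.1 h₃.2.2 h₄ h₅)
      (fun n m hs hlt h₃ h₄ => H n m a k hs hlt h₃.1 h₃.2.1 h₃.2.2 h₄)
      n w huw hu hD hg ⟨n, rfl, hn, hJn, hva, hek⟩

/-- What holds at the end of a preceding interval holds in the state just before the interval. -/
theorem previous_state {c : StatePred Proc} {w : Pos} {t : ℤ} (ht : t ∈ (ioc (n : Pos) w).1)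
    (hp : previously (atEnd c) (ioc (n : Pos) w) s) : c (s n) := by
  obtain ⟨Δ, hadj, hend⟩ := hp
  rcases hend with ⟨A, B, hAB, hadj', -, hB, hne⟩ | ⟨hi, -⟩
  · obtain ⟨y, hy⟩ := Set.nonempty_iff_ne_empty.2 hne
    have hyΔ : y ∈ Δ.1 := hAB ▸ Or.inr hy
    have ht' : n < t := by exact_mod_cast ht.1
    have h₁ : n + 1 ∈ (ioc (n : Pos) w).1 := by
      refine ⟨by norm_cast; omega, le_trans ?_ ht.2⟩
      norm_cast
    have hlt := hadj.1 y hyΔ (n + 1) h₁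
    have hn : n ∈ Δ.1 ∪ (ioc (n : Pos) w).1 :=
      hadj.2.out (Or.inl hyΔ) (Or.inr h₁) ⟨by omega, by omega⟩
    rcases hn with hn | hn
    · rw [hAB] at hn
      rcases hn with hn | hn
      · have := hadj'.1 n hn y hy
        omega
      · exact hB n hn
    · exact absurd hn.1 (lt_irrefl _)
  · exact absurd ⟨t, fun y hy => (hadj.1 y hy t ht).le⟩ hi

/-- Acquiring the lock of the node whose address is in the local variable `v`. -/
theorem walk_lock {h tl : ℕ} {v : Var Proc} (hh : Healthy s) (hv : Own p Z v)
    (hZ : ∀ b, Sum.inr b ∈ Z)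
    (hJ : ∀ n m, Seg s D T p Z ∅ n m → J n → J m)
    (hE : ∀ n a, J n → (s n).mem (Sum.inl v) = .addr a → Entered s D h n a)
    (H : ∀ n m a, Seg s D T p Z {Sum.inr (a + Field.lck.offset)} n m → n < m → J n →
      (s n).mem (Sum.inl v) = .addr a → cell s m a .lck = .proc p → K m) :
    Walk s D T (GoodAt s D h tl p T) (lockBeh p Z (.fld (.var v) .lck)) (At D J) (At D K) := by
  refine walk_exists fun a' => Walk.chop
    (B := At D fun n => ∃ a, a' = a + Field.lck.offset ∧ J n ∧
      (s n).mem (Sum.inl v) = .addr a) ?_ ?_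
  · refine walk_eval hZ GoodAt.of_idle fun n m σ hs hn hσ hc => ?_
    obtain ⟨a, h₄, h₅⟩ := eval_fld.1 (eval_eq_const.1 hc)
    refine ⟨a, by simpa using h₅, hJ n m hs hn, ?_⟩
    rw [hs.var hh hv (by simp)]
    exact hs.seen_var hh hv (by simp) hσ h₄
  · rintro u w huw hu hD ⟨hprev, hg⟩ hA
    obtain ⟨n, rfl, hn, a, rfl, hJn, hva⟩ := hA
    obtain ⟨t, ht⟩ := update_nonempty _ _ hg
    have hnull := previous_state ht hprev
    exact walk_update_cell (J := fun n => J n ∧ (s n).mem (Sum.inl v) = .addr a ∧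
      cell s n a .lck = .null) hZ
      (fun h₁ h₂ h₃ h₄ h₅ =>
        Or.inl ⟨a, .lck, rfl, hE _ _ h₃.1 h₃.2.1, .acquire h₃.2.2 h₄⟩)
      (fun n m hs hlt h₃ h₄ => H n m a hs hlt h₃.1 h₃.2.1 h₄)
      n w huw hu hD hg ⟨n, rfl, hn, hJn, hva, hnull⟩

end Rules

/-! ### Stability of facts along a segment -/

/-- The steps before time `T` are permitted, and the invariant of the list holds before `T`. -/
structure Past (s : Stream Proc) (D : Set ℤ) (P : Set Proc) (h tl : ℕ) (t₀ T : ℤ) : Prop where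
  sys : Sys s D P h tl t₀
  good : ∀ t ∈ D, t - 1 ∈ D → t < T → GoodStep s D h tl t₀ t
  inv : ∀ t ∈ D, t < T → ListInv s D h tl t

section Past

variable {s : Stream Proc} {D : Set ℤ} {P : Set Proc} {h tl : ℕ} {t₀ T : ℤ} {p : Proc}
  {Z W : Set (Loc Proc)} {n m : ℤ}

/-- It suffices to consider the steps after the initial state of the list. -/
theorem Past.of_good (hS : Sys s D P h tl t₀)
    (hG : ∀ t ∈ D, t - 1 ∈ D → t₀ < t → t < T → GoodStep s D h tl t₀ t) :
    Past s D P h tl t₀ T := by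
  refine ⟨hS, fun t ht ht' hT => ?_, fun t ht hT => ?_⟩
  · rcases le_or_gt t t₀ with h₀ | h₀
    · exact hS.goodStep_init ht ht' h₀
    · exact hG t ht ht' h₀ hT
  · rcases le_or_gt t t₀ with h₀ | h₀
    · exact hS.listInv_init ht h₀
    · refine int_stable h₀.le (hS.listInv_init hS.mem₀ le_rfl) fun u h₁ h₂ hI => ?_
      have hu : u ∈ D := hS.conn.out hS.mem₀ ht ⟨h₁.le, h₂⟩
      have hu' : u - 1 ∈ D := hS.conn.out hS.mem₀ ht ⟨by omega, by omega⟩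
      exact (hG u hu hu' h₁ (by omega)).listInv hS hu hu' hI h₁

theorem Past.step_mem (hP : Past s D P h tl t₀ T) (hn : n ∈ D) (hm : m ∈ D) {t : ℤ} (h₁ : n < t)
    (h₂ : t ≤ m) : t ∈ D ∧ t - 1 ∈ D :=
  ⟨hP.sys.conn.out hn hm ⟨h₁.le, h₂⟩, hP.sys.conn.out hn hm ⟨by omega, by omega⟩⟩

/-- The value of a node never changes. -/
theorem Past.val_eq (hP : Past s D P h tl t₀ T) (hn : n ∈ D) (hm : m ∈ D) (hnm : n ≤ m)
    (hT : m < T) {a : ℕ} (ha : Entered s D h n a) : cell s m a .val = cell s n a .val := by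
  refine int_stable (J := fun t => cell s t a .val = cell s n a .val) hnm rfl fun t h₁ h₂ e => ?_
  obtain ⟨ht, ht'⟩ := hP.step_mem hn hm h₁ h₂
  rw [← e]
  exact (hP.good t ht ht' (by omega)).val_eq (ha.mono (by omega))

theorem Past.entered_head (ht : n ∈ D) : Entered s D h n h :=
  Reach.entered Relation.ReflTransGen.refl ht

theorem Past.head_val (hP : Past s D P h tl t₀ T) (hn : n ∈ D) (hT : n < T) :
    cell s n h .val = .key ⊥ := by
  rcases le_total n t₀ with h₀ | h₀
  · exact (hP.sys.initHead n hn h₀).1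
  · rw [hP.val_eq hP.sys.mem₀ hn h₀ hT (Past.entered_head hP.sys.mem₀)]
    exact (hP.sys.initHead t₀ hP.sys.mem₀ le_rfl).1

/-- No lock is held while the list is in its initial state. -/
theorem Sys.lock_after (hS : Sys s D P h tl t₀) (hn : n ∈ D) {a : ℕ} (ha : Entered s D h n a)
    (hl : cell s n a .lck = .proc p) : t₀ < n := by
  by_contra h₀
  rcases hS.entered_init (not_lt.1 h₀) ha with rfl | rfl
  · rw [(hS.initHead n hn (not_lt.1 h₀)).2.2.2] at hl; cases hl
  · rw [(hS.initTail n hn (not_lt.1 h₀)).2.2.2] at hl; cases hl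

theorem Seg.end_mem (hs : Seg s D T p Z W n m) : m ∈ D := hs.mem' hs.le le_rfl

/-- The node whose lock is held by `p` is not changed by the other processes. -/
theorem Seg.locked (hs : Seg s D T p Z W n m) (hP : Past s D P h tl t₀ T)
    (hZ : ∀ b, Sum.inr b ∈ Z) {a : ℕ} (ha : Entered s D h n a) (hl : cell s n a .lck = .proc p)
    (hWl : Sum.inr (a + Field.lck.offset) ∉ W) (f : Field)
    (hWf : Sum.inr (a + f.offset) ∉ W) : cell s m a f = cell s n a f := by
  have key : cell s m a .lck = cell s n a .lck ∧ cell s m a f = cell s n a f := by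
    refine int_stable (J := fun t => cell s t a .lck = cell s n a .lck ∧
      cell s t a f = cell s n a f) hs.le ⟨rfl, rfl⟩ fun t h₁ h₂ ⟨e₁, e₂⟩ => ?_
    obtain ⟨ht, ht'⟩ := hP.step_mem hs.start hs.end_mem h₁ h₂
    have hG := hP.good t ht ht' (h₂.trans_lt hs.lt)
    have hE : Entered s D h (t - 1) a := ha.mono (by omega)
    rw [← e₁, ← e₂]
    exact ⟨hG.locked hE (e₁.trans hl) (hs.idle t h₁ h₂ _ (hZ _) hWl),
      hG.locked hE (e₁.trans hl) (hs.idle t h₁ h₂ _ (hZ _) hWf)⟩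
  exact key.2

/-- A node in preparation does not enter the list while its owner writes to the node only. -/
theorem Seg.not_entered (hs : Seg s D T p Z W n m) (hP : Past s D P h tl t₀ T)
    (hZ : ∀ b, Sum.inr b ∈ Z) {c : ℕ} {t₁ : ℤ} (hal : Alloc s h tl p c t₁)
    (hc : ¬ Entered s D h n c) (h₀ : t₀ ≤ n)
    (hW : ∀ b, Sum.inr b ∈ W → b ∈ block c) : ¬ Entered s D h m c := by
  refine int_stable (J := fun t => ¬ Entered s D h t c) hs.le hc fun t h₁ h₂ hE hE' => ?_
  obtain ⟨ht, ht'⟩ := hP.step_mem hs.start hs.end_mem h₁ h₂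
  have hT : t < T := h₂.trans_lt hs.lt
  have hI := hP.inv (t - 1) ht' (by omega)
  rcases hE'.cases with h | h
  · exact hE h
  · rcases (hP.good t ht ht' hT).reach_new hP.sys ht' hI (by omega) h with
      h | ⟨q, u, b, hu, hw, -, hL⟩
    · exact hE h
    · obtain ⟨t₂, -, hal'⟩ := hL.alloc
      obtain ⟨rfl, -, -⟩ := hal.unique hP.sys.healthy hal' (f := .val) (f' := .val) rfl
      have : Sum.inr (u + Field.nxt.offset) ∈ W := by
        by_contra hn
        exact hs.idle t h₁ h₂ _ (hZ _) hn hw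
      obtain ⟨f, hf⟩ := hW _ this
      have := hP.sys.known_unique (hI.known u hu) (Or.inr (Or.inr ⟨p, t₁, le_rfl, hal⟩)) hf
      exact hE (this.1 ▸ hu)

theorem Seg.private_cell (hs : Seg s D T p Z W n m) (hP : Past s D P h tl t₀ T)
    (hZ : ∀ b, Sum.inr b ∈ Z) {c : ℕ} {t₁ : ℤ} (hal : Alloc s h tl p c t₁)
    (hc : ¬ Entered s D h n c) (h₀ : t₀ ≤ n)
    (hW : ∀ b, Sum.inr b ∈ W → b ∈ block c) {f : Field}
    (hf : Sum.inr (c + f.offset) ∉ W) : cell s m c f = cell s n c f := by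
  refine int_stable (J := fun t => cell s t c f = cell s n c f) hs.le rfl fun t h₁ h₂ e => ?_
  obtain ⟨ht, ht'⟩ := hP.step_mem hs.start hs.end_mem h₁ h₂
  rw [← e]
  have hE : ¬ Entered s D h (t - 1) c :=
    (hs.take (t := t - 1) (by omega) (by omega)).not_entered hP hZ hal hc h₀ hW
  exact (hP.good t ht ht' (h₂.trans_lt hs.lt)).private_cell hP.sys
    (hP.inv (t - 1) ht' (by have := hs.lt; omega)) (by omega) hal hE
    (hs.idle t h₁ h₂ _ (hZ _) hf)

/-! ### Assertions about the pair of nodes located by a search -/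

/-- The local variable `v` holds the address of a node that has been in the list and whose value is
below `x`. -/
def Below (s : Stream Proc) (D : Set ℤ) (h : ℕ) (x : ℤ) (v : Var Proc) (n : ℤ) : Prop :=
  ∃ a ka, (s n).mem (Sum.inl v) = .addr a ∧ Entered s D h n a ∧ cell s n a .val = .key ka ∧
    ka < (x : Key)

/-- The search has arrived at `v₁`, whose value is below `x`, and has read `v₂` as a successor. -/
def Trav (s : Stream Proc) (D : Set ℤ) (h : ℕ) (x : ℤ) (v₁ v₂ : Var Proc) (n : ℤ) : Prop :=
  Below s D h x v₁ n ∧ ∀ b, (s n).mem (Sum.inl v₂) = .addr b → Entered s D h n b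

/-- The local variables `v₁` and `v₂` hold the addresses `a` and `b` of nodes that have been in the
list, with values below `x` and not below `x`, respectively. -/
structure Pair (s : Stream Proc) (D : Set ℤ) (h : ℕ) (x : ℤ) (v₁ v₂ : Var Proc) (n : ℤ)
    (a b : ℕ) : Prop where
  fst : (s n).mem (Sum.inl v₁) = .addr a
  snd : (s n).mem (Sum.inl v₂) = .addr b
  ea : Entered s D h n a
  eb : Entered s D h n b
  keys : ∃ ka kb, cell s n a .val = .key ka ∧ cell s n b .val = .key kb ∧ ka < (x : Key) ∧
    (x : Key) ≤ kb

/-- A `Pair` of nodes whose locks are held by `p`. -/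
structure LockedPair (s : Stream Proc) (D : Set ℤ) (h : ℕ) (p : Proc) (x : ℤ) (v₁ v₂ : Var Proc)
    (n : ℤ) (a b : ℕ) : Prop extends Pair s D h x v₁ v₂ n a b where
  la : cell s n a .lck = .proc p
  lb : cell s n b .lck = .proc p

/-- A `LockedPair` of adjacent nodes, the first of which is unmarked, while `μ` tells whether the
second one is marked. -/
structure AdjacentPair (s : Stream Proc) (D : Set ℤ) (h : ℕ) (p : Proc) (x : ℤ)
    (v₁ v₂ : Var Proc) (μ : Bool) (n : ℤ) (a b : ℕ) : Prop
    extends LockedPair s D h p x v₁ v₂ n a b where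
  ma : cell s n a .mrk = .bool false
  mb : cell s n b .mrk = .bool μ
  nx : cell s n a .nxt = .addr b

variable {x : ℤ} {v₁ v₂ : Var Proc} {a b : ℕ} {μ : Bool}

theorem Pair.ne (k : Pair s D h x v₁ v₂ n a b) : a ≠ b := by
  rintro rfl
  obtain ⟨ka, kb, h₁, h₂, h₃, h₄⟩ := k.keys
  rw [h₁] at h₂
  cases h₂
  exact absurd h₃ (not_lt.2 h₄)

theorem Pair.cell_ne (k : Pair s D h x v₁ v₂ n a b) (hP : Past s D P h tl t₀ T) (hn : n ∈ D)
    (hT : n < T) (f f' : Field) : a + f.offset ≠ b + f'.offset := fun e =>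
  k.ne (hP.sys.known_unique ((hP.inv n hn hT).known a k.ea) ((hP.inv n hn hT).known b k.eb) e).1

theorem Pair.stable (k : Pair s D h x v₁ v₂ n a b) (hP : Past s D P h tl t₀ T)
    (hs : Seg s D T p Z W n m) (o₁ : Own p Z v₁) (o₂ : Own p Z v₂) (w₁ : Sum.inl v₁ ∉ W)
    (w₂ : Sum.inl v₂ ∉ W) : Pair s D h x v₁ v₂ m a b := by
  have hh := hP.sys.healthy
  refine ⟨(hs.var hh o₁ w₁).trans k.fst, (hs.var hh o₂ w₂).trans k.snd, k.ea.mono hs.le,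
    k.eb.mono hs.le, ?_⟩
  rw [hP.val_eq hs.start hs.end_mem hs.le hs.lt k.ea,
    hP.val_eq hs.start hs.end_mem hs.le hs.lt k.eb]
  exact k.keys

theorem LockedPair.stable (k : LockedPair s D h p x v₁ v₂ n a b) (hP : Past s D P h tl t₀ T)
    (hs : Seg s D T p Z W n m) (hZ : ∀ b, Sum.inr b ∈ Z) (o₁ : Own p Z v₁) (o₂ : Own p Z v₂)
    (w₁ : Sum.inl v₁ ∉ W) (w₂ : Sum.inl v₂ ∉ W) (wa : Sum.inr (a + Field.lck.offset) ∉ W)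
    (wb : Sum.inr (b + Field.lck.offset) ∉ W) : LockedPair s D h p x v₁ v₂ m a b :=
  ⟨k.toPair.stable hP hs o₁ o₂ w₁ w₂, (hs.locked hP hZ k.ea k.la wa _ wa).trans k.la,
    (hs.locked hP hZ k.eb k.lb wb _ wb).trans k.lb⟩

theorem AdjacentPair.stable (k : AdjacentPair s D h p x v₁ v₂ μ n a b)
    (hP : Past s D P h tl t₀ T) (hs : Seg s D T p Z W n m) (hZ : ∀ b, Sum.inr b ∈ Z)
    (o₁ : Own p Z v₁) (o₂ : Own p Z v₂) (w₁ : Sum.inl v₁ ∉ W) (w₂ : Sum.inl v₂ ∉ W)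
    (wa : ∀ f, Sum.inr (a + Field.offset f) ∉ W) (wb : ∀ f, Sum.inr (b + Field.offset f) ∉ W) :
    AdjacentPair s D h p x v₁ v₂ μ m a b :=
  ⟨k.toLockedPair.stable hP hs hZ o₁ o₂ w₁ w₂ (wa _) (wb _),
    (hs.locked hP hZ k.ea k.la (wa _) _ (wa _)).trans k.ma,
    (hs.locked hP hZ k.eb k.lb (wb _) _ (wb _)).trans k.mb,
    (hs.locked hP hZ k.ea k.la (wa _) _ (wa _)).trans k.nx⟩

theorem Below.stable {v : Var Proc} (k : Below s D h x v n) (hP : Past s D P h tl t₀ T)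
    (hs : Seg s D T p Z W n m) (o : Own p Z v) (w : Sum.inl v ∉ W) : Below s D h x v m := by
  obtain ⟨a, ka, h₁, h₂, h₃, h₄⟩ := k
  refine ⟨a, ka, (hs.var hP.sys.healthy o w).trans h₁, h₂.mono hs.le, ?_, h₄⟩
  rw [hP.val_eq hs.start hs.end_mem hs.le hs.lt h₂, h₃]

end Past

/-! ### Rules for commands -/

section Commands

variable {s : Stream Proc} {D : Set ℤ} {T : ℤ} {p : Proc} {Z : Set (Loc Proc)} {Goal : Prop}
  {A B C : Pos → Prop}

theorem solo_singleton {g : Proc → IntvPred Proc} {Δ : Intv} (h : solo {p} g Δ s) : g p Δ s := by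
  obtain ⟨q, hq, hg⟩ := h
  rwa [Set.singleton_eq_singleton_iff.1 hq]

theorem Walk.solo {g : Proc → IntvPred Proc} (h : Walk s D T Goal (g p) A B) :
    Walk s D T Goal (LazySet.solo {p} g) A B :=
  h.mono (fun _ => solo_singleton) (fun _ => id) (fun _ => id)

theorem Walk.seq {C₁ C₂ : Cmd Proc} (h₁ : Walk s D T Goal (beh C₁ {p} Z) A B)
    (h₂ : Walk s D T Goal (beh C₂ {p} Z) B C) : Walk s D T Goal (beh (C₁ ;; C₂) {p} Z) A C :=
  h₁.chop h₂

theorem Walk.choice {C₁ C₂ : Cmd Proc} (h₁ : Walk s D T Goal (beh C₁ {p} Z) A B)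
    (h₂ : Walk s D T Goal (beh C₂ {p} Z) A B) : Walk s D T Goal (beh (C₁ ⊓⊓ C₂) {p} Z) A B :=
  h₁.or h₂

theorem Walk.label {C₁ : Cmd Proc} (l : Label) (h : Walk s D T Goal (beh C₁ {p} Z) A B) :
    Walk s D T Goal (beh (.label l C₁) {p} Z) A B :=
  h.mono (fun _ k => k.2) (fun _ => id) (fun _ => id)

theorem nonEmp_seq_left {C₁ C₂ : Cmd Proc} {Q : Set Proc} (h : NonEmp (beh C₁ Q Z)) :
    NonEmp (beh (C₁ ;; C₂) Q Z) := h.chop_left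

theorem nonEmp_seq_right {C₁ C₂ : Cmd Proc} {Q : Set Proc} (h : NonEmp (beh C₂ Q Z)) :
    NonEmp (beh (C₁ ;; C₂) Q Z) := h.chop_right

theorem nonEmp_label {C₁ : Cmd Proc} {Q : Set Proc} {l : Label} (h : NonEmp (beh C₁ Q Z)) :
    NonEmp (beh (.label l C₁) Q Z) := fun Δ s k => h Δ s k.2

theorem nonEmp_assign (v : Var Proc) (e : Expr Proc) (Q : Set Proc) :
    NonEmp (beh (.assign v e) Q Z) := by
  rintro Δ s ⟨q, -, k, h⟩
  exact NonEmp.chop_right update_nonempty Δ s h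

theorem nonEmp_assignAt (ae e : Expr Proc) (Q : Set Proc) :
    NonEmp (beh (.assignAt ae e) Q Z) := by
  rintro Δ s ⟨q, -, k, a, h⟩
  exact NonEmp.chop_right update_nonempty Δ s h

theorem nonEmp_tryFind (x : ℤ) (v₁ v₂ : Var Proc) (Q : Set Proc) :
    NonEmp (beh (TryFind x v₁ v₂) Q Z) :=
  nonEmp_seq_right (nonEmp_seq_right (nonEmp_seq_left (nonEmp_assignAt _ _ _)))

theorem nonEmp_add (q : Proc) (x : ℤ) (Q : Set Proc) : NonEmp (beh (Add q x) Q Z) :=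
  nonEmp_seq_right (nonEmp_seq_right (nonEmp_seq_left (nonEmp_label (nonEmp_assignAt _ _ _))))

theorem nonEmp_remove (q : Proc) (x : ℤ) (Q : Set Proc) : NonEmp (beh (Remove q x) Q Z) :=
  nonEmp_seq_right (nonEmp_seq_right (nonEmp_seq_left (nonEmp_label (nonEmp_assignAt _ _ _))))

theorem nonEmp_CL (q : Proc) (x : ℤ) (Q : Set Proc) : NonEmp (beh (CL q x) Q Z) :=
  nonEmp_seq_left (nonEmp_label (nonEmp_assign _ _ _))

theorem nonEmp_contains (q : Proc) (x : ℤ) (Q : Set Proc) : NonEmp (beh (Contains q x) Q Z) :=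
  nonEmp_seq_left (nonEmp_CL _ _ _)

end Commands

/-! ### The search for a pair of nodes -/

section Locate

variable {s : Stream Proc} {D : Set ℤ} {P : Set Proc} {h tl : ℕ} {t₀ T : ℤ} {p : Proc}
  {Z : Set (Loc Proc)} {x : ℤ} {v₁ v₂ : Var Proc}

theorem walk_assign_own {v v' : Var Proc} (hP : Past s D P h tl t₀ T) (hZ : ∀ b, Sum.inr b ∈ Z)
    (o' : Own p Z v') :
    Walk s D T (GoodAt s D h tl p T) (beh (.assign v (.var v')) {p} Z)
      (At D (Below s D h x v')) (At D (Below s D h x v)) := by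
  refine Walk.solo (walk_assign (fun k n => ∃ a ka, k = .addr a ∧ Entered s D h n a ∧
    cell s n a .val = .key ka ∧ ka < (x : Key)) hZ GoodAt.of_idle ?_ ?_)
  · intro n m σ k hs hJ hσ he
    obtain ⟨a, ka, h₁, h₂, h₃, h₄⟩ := hJ.stable hP hs o' (by simp)
    refine ⟨a, ka, ?_, h₂, h₃, h₄⟩
    rw [← h₁, hs.var hP.sys.healthy o' (by simp)]
    exact (hs.seen_var hP.sys.healthy o' (by simp) hσ he).symm
  · rintro n m k hs - ⟨a, ka, rfl, h₂, h₃, h₄⟩ hm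
    refine ⟨a, ka, hm, h₂.mono hs.le, ?_, h₄⟩
    rw [hP.val_eq hs.start hs.end_mem hs.le hs.lt h₂, h₃]

theorem walk_assign_next (hP : Past s D P h tl t₀ T) (hZ : ∀ b, Sum.inr b ∈ Z)
    (o₁ : Own p Z v₁) (hne : v₁ ≠ v₂) :
    Walk s D T (GoodAt s D h tl p T) (beh (.assign v₂ ((Expr.var v₁).at .nxt)) {p} Z)
      (At D (Below s D h x v₁)) (At D (Trav s D h x v₁ v₂)) := by
  refine Walk.solo (walk_assign (fun k n => Below s D h x v₁ n ∧ ∀ b, k = .addr b →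
    Entered s D h n b) hZ GoodAt.of_idle ?_ ?_)
  · intro n m σ k hs hJ hσ he
    refine ⟨hJ.stable hP hs o₁ (by simp), fun b hb => ?_⟩
    obtain ⟨a, t, h₁, h₂, h₃, h₄⟩ := hs.seen_at hP.sys.healthy o₁ (by simp) hσ he
    obtain ⟨a', ka, h₁', hE, -⟩ := hJ
    rw [h₁] at h₁'
    cases h₁'
    exact ((hP.inv t (hs.mem t h₂ h₃) (h₃.trans_lt hs.lt)).edge a b (hE.mono h₂.le)
      (h₄.trans hb)).mono h₃
  · rintro n m k hs - ⟨hJ, hb⟩ hm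
    refine ⟨hJ.stable hP hs o₁ (by simpa using hne), fun b e => (hb b ?_).mono hs.le⟩
    rw [← hm, e]

theorem walk_assign_head_below (hP : Past s D P h tl t₀ T) (hZ : ∀ b, Sum.inr b ∈ Z) :
    Walk s D T (GoodAt s D h tl p T) (beh (.assign v₁ (.var .Head)) {p} Z)
      (fun _ => True) (At D (Below s D h x v₁)) := by
  intro u w huw hu hD hg hA
  obtain ⟨h₁, h₂⟩ := walk_assign_head (h := h) (Goal := GoodAt s D h tl p T) hZ GoodAt.of_idle
    hP.sys.head u w huw hu hD (solo_singleton hg) hA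
  refine ⟨h₁, fun hw => ?_⟩
  obtain ⟨n, rfl, hn, e⟩ := h₂ hw
  exact ⟨n, rfl, hn, h, ⊥, e, Past.entered_head hn, hP.head_val hn (by exact_mod_cast hw),
    WithBot.bot_lt_coe _⟩

/-- A search ends with the locks of two nodes around `x`, whether or not they are adjacent. -/
theorem walk_search (hP : Past s D P h tl t₀ T) (hZ : ∀ b, Sum.inr b ∈ Z)
    (o₁ : Own p Z v₁) (o₂ : Own p Z v₂) (hne : v₁ ≠ v₂) :
    Walk s D T (GoodAt s D h tl p T) (beh (Search x v₁ v₂) {p} Z) (fun _ => True)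
      (At D fun n => ∃ a b, LockedPair s D h p x v₁ v₂ n a b) := by
  have hh := hP.sys.healthy
  have loop : Walk s D T (GoodAt s D h tl p T)
      (beh (.guard (.lt ((Expr.var v₂).at .val) (Expr.key (x : ℤ))) ;;
        .assign v₁ (.var v₂) ;; .assign v₂ ((Expr.var v₁).at .nxt)) {p} Z)
      (At D (Trav s D h x v₁ v₂)) (At D (Trav s D h x v₁ v₂)) := by
    refine Walk.seq (B := At D (Below s D h x v₂)) (Walk.solo (walk_eval hZ GoodAt.of_idle ?_))
      (Walk.seq (walk_assign_own hP hZ o₂) (walk_assign_next hP hZ o₁ hne))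
    intro n m σ hs hJ hσ he
    obtain ⟨k, l, h₁, h₂, hlt⟩ := eval_lt.1 he
    cases h₂
    obtain ⟨b, t, h₃, h₄, h₅, h₆⟩ := hs.seen_at hh o₂ (by simp) hσ h₁
    have hb := hJ.2 b h₃
    have ht := hs.mem t h₄ h₅
    refine ⟨b, k, (hs.var hh o₂ (by simp)).trans h₃, hb.mono hs.le, ?_, hlt⟩
    rw [hP.val_eq ht hs.end_mem h₅ hs.lt (hb.mono h₄.le), h₆]
  refine Walk.seq (walk_assign_head_below hP hZ) (Walk.seq (walk_assign_next hP hZ o₁ hne)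
    (Walk.seq (B := At D (Trav s D h x v₁ v₂)) (Walk.omega ?_ loop)
    (Walk.seq (B := At D fun n => ∃ a b, Pair s D h x v₁ v₂ n a b)
      (Walk.solo (walk_eval hZ GoodAt.of_idle ?_))
    (Walk.seq (B := At D fun n => ∃ a b, Pair s D h x v₁ v₂ n a b ∧ cell s n a .lck = .proc p)
      (Walk.solo (walk_lock hh o₁ hZ ?_ ?_ ?_))
    (Walk.solo (walk_lock hh o₂ hZ ?_ ?_ ?_))))))
  · exact nonEmp_seq_right (nonEmp_seq_left (nonEmp_assign _ _ _))
  · intro n m σ hs hJ hσ he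
    obtain ⟨k, l, h₁, h₂, hle⟩ := eval_le.1 he
    cases h₁
    obtain ⟨b, t, h₃, h₄, h₅, h₆⟩ := hs.seen_at hh o₂ (by simp) hσ h₂
    have hb := hJ.2 b h₃
    have ht := hs.mem t h₄ h₅
    obtain ⟨a, ka, g₁, g₂, g₃, g₄⟩ := hJ.1.stable hP hs o₁ (by simp)
    refine ⟨a, b, g₁, (hs.var hh o₂ (by simp)).trans h₃, g₂, hb.mono hs.le, ka, l, g₃, ?_, g₄,
      hle⟩
    rw [hP.val_eq ht hs.end_mem h₅ hs.lt (hb.mono h₄.le), h₆]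
  · rintro n m hs ⟨a, b, k⟩
    exact ⟨a, b, k.stable hP hs o₁ o₂ (by simp) (by simp)⟩
  · rintro n a ⟨a', b, k⟩ e
    rw [k.fst] at e
    cases e
    exact k.ea
  · rintro n m a hs - ⟨a', b, k⟩ e hl
    rw [k.fst] at e
    cases e
    exact ⟨_, b, k.stable hP hs o₁ o₂ (by simp) (by simp), hl⟩
  · rintro n m hs ⟨a, b, k, hl⟩
    exact ⟨a, b, k.stable hP hs o₁ o₂ (by simp) (by simp),
      (hs.locked hP hZ k.ea hl (by simp) _ (by simp)).trans hl⟩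
  · rintro n b ⟨a, b', k, -⟩ e
    rw [k.snd] at e
    cases e
    exact k.eb
  · rintro n m b hs hnm ⟨a, b', k, hl⟩ e hl'
    rw [k.snd] at e
    cases e
    have hne := k.cell_ne hP hs.start (hnm.trans hs.lt)
    exact ⟨a, _, k.stable hP hs o₁ o₂ (by simp) (by simp),
      (hs.locked hP hZ k.ea hl (by simpa using k.ne) _ (by simpa using k.ne)).trans hl, hl'⟩

/-- The release of the lock of a node that is locked by `p`. -/
theorem walk_unlock {v : Var Proc} {J K : ℤ → Prop} (hh : Healthy s) (hZ : ∀ b, Sum.inr b ∈ Z)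
    (o : Own p Z v)
    (hJ : ∀ n m, Seg s D T p Z ∅ n m → J n → J m)
    (hl : ∀ n, J n → ∃ a, (s n).mem (Sum.inl v) = .addr a ∧ Entered s D h n a ∧
      cell s n a .lck = .proc p)
    (H : ∀ n m a, Seg s D T p Z {Sum.inr (a + Field.lck.offset)} n m → n < m → J n →
      (s n).mem (Sum.inl v) = .addr a → K m) :
    Walk s D T (GoodAt s D h tl p T) (beh (Unlock v) {p} Z) (At D J) (At D K) := by
  refine Walk.solo (walk_assign_cell hh o hZ (Or.inl ⟨_, rfl⟩) hJ ?_ ?_)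
  · intro a k _ _ hJT ha hk hT _
    cases hk
    obtain ⟨a', h₁, h₂, h₃⟩ := hl _ hJT
    rw [ha] at h₁
    cases h₁
    exact Or.inl ⟨a, .lck, rfl, h₂, .release h₃ hT⟩
  · intro n m a k hs hlt hJn ha _ _
    exact H n m a hs hlt hJn ha

theorem walk_unlock_pair (hP : Past s D P h tl t₀ T) (hZ : ∀ b, Sum.inr b ∈ Z)
    (o₁ : Own p Z v₁) (o₂ : Own p Z v₂) :
    Walk s D T (GoodAt s D h tl p T) (beh (Unlock v₁) {p} Z)
      (At D fun n => ∃ a b, LockedPair s D h p x v₁ v₂ n a b)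
      (At D fun n => ∃ b, (s n).mem (Sum.inl v₂) = .addr b ∧ Entered s D h n b ∧
        cell s n b .lck = .proc p) := by
  refine walk_unlock hP.sys.healthy hZ o₁ ?_ ?_ ?_
  · rintro n m hs ⟨a, b, k⟩
    exact ⟨a, b, k.stable hP hs hZ o₁ o₂ (by simp) (by simp) (by simp) (by simp)⟩
  · rintro n ⟨a, b, k⟩
    exact ⟨a, k.fst, k.ea, k.la⟩
  · rintro n m a hs - ⟨a', b, k⟩ e
    rw [k.fst] at e
    cases e
    refine ⟨b, (hs.var hP.sys.healthy o₂ (by simp)).trans k.snd, k.eb.mono hs.le, ?_⟩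
    exact (hs.locked hP hZ k.eb k.lb (by simpa using k.ne.symm) _
      (by simpa using k.ne.symm)).trans k.lb

theorem walk_unlock_last {v : Var Proc} (hP : Past s D P h tl t₀ T) (hZ : ∀ b, Sum.inr b ∈ Z)
    (o : Own p Z v) :
    Walk s D T (GoodAt s D h tl p T) (beh (Unlock v) {p} Z)
      (At D fun n => ∃ b, (s n).mem (Sum.inl v) = .addr b ∧ Entered s D h n b ∧
        cell s n b .lck = .proc p) (fun _ => True) := by
  refine Walk.mono (walk_unlock (K := fun _ => True) hP.sys.healthy hZ o ?_ (fun _ h => h)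
    fun _ _ _ _ _ _ _ => trivial) (fun _ => id) (fun _ => id) fun _ _ => trivial
  rintro n m hs ⟨b, h₁, h₂, h₃⟩
  exact ⟨b, (hs.var hP.sys.healthy o (by simp)).trans h₁, h₂.mono hs.le,
    (hs.locked hP hZ h₂ h₃ (by simp) _ (by simp)).trans h₃⟩

/-- A guard that reads the fields of the locked nodes leaves the locks alone. -/
theorem walk_guard_locked {c : Expr Proc} (hP : Past s D P h tl t₀ T) (hZ : ∀ b, Sum.inr b ∈ Z)
    (o₁ : Own p Z v₁) (o₂ : Own p Z v₂) :
    Walk s D T (GoodAt s D h tl p T) (beh (.guard c) {p} Z)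
      (At D fun n => ∃ a b, LockedPair s D h p x v₁ v₂ n a b)
      (At D fun n => ∃ a b, LockedPair s D h p x v₁ v₂ n a b) := by
  refine Walk.solo (walk_eval hZ GoodAt.of_idle ?_)
  rintro n m σ hs ⟨a, b, k⟩ - -
  exact ⟨a, b, k.stable hP hs hZ o₁ o₂ (by simp) (by simp) (by simp) (by simp)⟩

/-- The validation reads the fields at different times. As the nodes are locked, what has been read
is still true at the end. -/
theorem walk_locate (hP : Past s D P h tl t₀ T) (hZ : ∀ b, Sum.inr b ∈ Z)
    (o₁ : Own p Z v₁) (o₂ : Own p Z v₂) (hne : v₁ ≠ v₂) :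
    Walk s D T (GoodAt s D h tl p T) (beh (Locate x v₁ v₂) {p} Z) (fun _ => True)
      (At D fun n => ∃ a b, AdjacentPair s D h p x v₁ v₂ false n a b) := by
  have hh := hP.sys.healthy
  refine Walk.seq (Walk.omega (nonEmp_tryFind x v₁ v₂ {p}) ?_) ?_
  · exact Walk.seq (walk_search hP hZ o₁ o₂ hne) (Walk.seq (walk_guard_locked hP hZ o₁ o₂)
      (Walk.seq (walk_unlock_pair hP hZ o₁ o₂) (walk_unlock_last hP hZ o₂)))
  · refine Walk.seq (walk_search hP hZ o₁ o₂ hne) (Walk.solo (walk_eval hZ GoodAt.of_idle ?_))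
    rintro n m σ hs ⟨a, b, k⟩ hσ he
    have k' := k.stable hP hs hZ o₁ o₂ (by simp) (by simp) (by simp) (by simp)
    obtain ⟨b₁, b₂, e₁, e₂, e₃⟩ := eval_and.1 he
    obtain ⟨b₃, b₄, e₄, e₅, e₆⟩ := eval_and.1 e₂
    have hb : b₁ = true ∧ b₃ = true ∧ b₄ = true := by
      cases e₆
      cases b₁ <;> cases b₃ <;> cases b₄ <;> simp_all
    obtain ⟨rfl, rfl, rfl⟩ := hb
    obtain ⟨k₁, k₂, g₁, g₂, g₃⟩ := eval_eq.1 e₅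
    obtain rfl := g₃.1 rfl
    -- What was read is still the case: the fields do not change while the locks are held.
    have hA : ∀ t, n < t → t ≤ m → ∀ f, cell s m a f = cell s t a f := fun t h₁ h₂ f => by
      rw [hs.locked hP hZ k.ea k.la (by simp) f (by simp),
        (hs.take h₁.le h₂).locked hP hZ k.ea k.la (by simp) f (by simp)]
    have hB : ∀ t, n < t → t ≤ m → ∀ f, cell s m b f = cell s t b f := fun t h₁ h₂ f => by
      rw [hs.locked hP hZ k.eb k.lb (by simp) f (by simp),
        (hs.take h₁.le h₂).locked hP hZ k.eb k.lb (by simp) f (by simp)]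
    obtain ⟨a₁, t₁, i₁, i₂, i₃, i₄⟩ := hs.seen_at hh o₁ (by simp) hσ (eval_not.1 e₁)
    obtain ⟨a₂, t₂, i₅, i₆, i₇, i₈⟩ := hs.seen_at hh o₂ (by simp) hσ (eval_not.1 e₄)
    obtain ⟨a₃, t₃, i₉, i₁₀, i₁₁, i₁₂⟩ := hs.seen_at hh o₁ (by simp) hσ g₁
    have i₁₃ := hs.seen_var hh o₂ (by simp) hσ g₂
    rw [k.fst] at i₁ i₉
    rw [k.snd] at i₅ i₁₃
    cases i₁; cases i₅; cases i₉; subst i₁₃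
    exact ⟨a, b, k', (hA _ i₂ i₃ _).trans i₄, (hB _ i₆ i₇ _).trans i₈, (hA _ i₁₀ i₁₁ _).trans i₁₂⟩

end Locate

section AddRemove

variable {s : Stream Proc} {D : Set ℤ} {P : Set Proc} {h tl : ℕ} {t₀ T : ℤ} {p : Proc}
  {Z W : Set (Loc Proc)} {x : ℤ} {v₁ v₂ v₃ : Var Proc} {a b c : ℕ} {n m : ℤ} {μ : Bool}

/-! ### Insertion -/

/-- `p` owns a node at `c` with value `x` that has never been in the list. -/
structure NewNode (s : Stream Proc) (D : Set ℤ) (h tl : ℕ) (p : Proc) (x : ℤ) (n : ℤ) (c : ℕ) :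
    Prop where
  alloc : ∃ t ≤ n, Alloc s h tl p c t
  notEntered : ¬ Entered s D h n c
  val : cell s n c .val = .key (x : ℤ)

theorem NewNode.cell_ne (k : NewNode s D h tl p x n c) (hP : Past s D P h tl t₀ T) (hn : n ∈ D)
    (hT : n < T) (ha : Entered s D h n a) (f f' : Field) : a + f.offset ≠ c + f'.offset := by
  obtain ⟨t, -, hal⟩ := k.alloc
  intro e
  have := hP.sys.known_unique ((hP.inv n hn hT).known a ha) (Or.inr (Or.inr ⟨p, t, le_rfl, hal⟩)) e
  exact k.notEntered (this.1 ▸ ha)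

theorem NewNode.stable (k : NewNode s D h tl p x n c) (hP : Past s D P h tl t₀ T)
    (hs : Seg s D T p Z W n m) (hZ : ∀ b, Sum.inr b ∈ Z) (h₀ : t₀ ≤ n)
    (hW : ∀ b, Sum.inr b ∈ W → b ∈ block c) (hv : Sum.inr (c + Field.val.offset) ∉ W) :
    NewNode s D h tl p x m c := by
  obtain ⟨t, ht, hal⟩ := k.alloc
  exact ⟨⟨t, ht.trans hs.le, hal⟩, hs.not_entered hP hZ hal k.notEntered h₀ hW,
    (hs.private_cell hP hZ hal k.notEntered h₀ hW hv).trans k.val⟩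

/-- An `AdjacentPair` of unmarked nodes, where the value of the second one is above `x`. -/
structure InsertPair (s : Stream Proc) (D : Set ℤ) (h : ℕ) (p : Proc) (x : ℤ)
    (v₁ v₂ : Var Proc) (n : ℤ) (a b : ℕ) : Prop
    extends AdjacentPair s D h p x v₁ v₂ false n a b where
  lt : ∀ kb, cell s n b .val = .key kb → (x : Key) < kb

theorem InsertPair.stable (k : InsertPair s D h p x v₁ v₂ n a b) (hP : Past s D P h tl t₀ T)
    (hs : Seg s D T p Z W n m) (hZ : ∀ b, Sum.inr b ∈ Z)
    (o₁ : Own p Z v₁) (o₂ : Own p Z v₂) (w₁ : Sum.inl v₁ ∉ W) (w₂ : Sum.inl v₂ ∉ W)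
    (wa : ∀ f, Sum.inr (a + Field.offset f) ∉ W) (wb : ∀ f, Sum.inr (b + Field.offset f) ∉ W) :
    InsertPair s D h p x v₁ v₂ m a b := by
  refine ⟨k.toAdjacentPair.stable hP hs hZ o₁ o₂ w₁ w₂ wa wb, ?_⟩
  rw [hP.val_eq hs.start hs.end_mem hs.le hs.lt k.eb]
  exact k.lt

theorem InsertPair.after (k : InsertPair s D h p x v₁ v₂ n a b) (hP : Past s D P h tl t₀ T)
    (hn : n ∈ D) : t₀ ≤ n := (hP.sys.lock_after hn k.ea k.la).le

/-- The block of the new node is private to `p` from the first state of its initialisation on. -/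
theorem walk_newNode {v : Var Proc} (hP : Past s D P h tl t₀ T) (hZ : ∀ b, Sum.inr b ∈ Z)
    (o₁ : Own p Z v₁) (o₂ : Own p Z v₂) (n₁ : v₁ ≠ v) (n₂ : v₂ ≠ v) :
    Walk s D T (GoodAt s D h tl p T) (beh (.newNode x v) {p} Z)
      (At D fun n => ∃ a b, InsertPair s D h p x v₁ v₂ n a b)
      (At D fun n => ∃ a b c, InsertPair s D h p x v₁ v₂ n a b ∧ NewNode s D h tl p x n c ∧
        (s n).mem (Sum.inl v) = .addr c) := by
  refine Walk.solo (walk_exists fun c => Walk.chop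
    (B := At D fun n => ∃ a b, InsertPair s D h p x v₁ v₂ n a b) (walk_idle hZ GoodAt.of_idle ?_)
    (Walk.chop (B := At D fun n => ∃ a b, InsertPair s D h p x v₁ v₂ n a b ∧
      NewNode s D h tl p x n c) ?_ (walk_assign (fun k n => k = .addr c ∧ ∃ a b,
        InsertPair s D h p x v₁ v₂ n a b ∧ NewNode s D h tl p x n c) hZ GoodAt.of_idle ?_ ?_)))
  · rintro n m hs ⟨a, b, k⟩
    exact ⟨a, b, k.stable hP hs hZ o₁ o₂ (by simp) (by simp) (by simp) (by simp)⟩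
  · rintro u w huw hu hD ⟨⟨hf₁, hf₂⟩, hne, hi, hk⟩ ⟨n, rfl, hn, a, b, k⟩
    obtain ⟨t, ht⟩ := Set.nonempty_iff_ne_empty.2 hne
    have ht' : n < t := by exact_mod_cast ht.1
    have hn1 : n + 1 ∈ (ioc (n : Pos) w).1 := by
      refine ⟨by norm_cast; omega, le_trans ?_ ht.2⟩
      norm_cast
    have hal : Alloc s h tl p c (n + 1) := by
      refine ⟨fun f => (hk _ hn1).2.2.2.2 _ (mem_block c f), fun b' hb' =>
        hi p rfl _ ⟨hZ b', by simpa using hb'⟩ _ hn1, fun t' ht' r f =>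
        hf₁ _ (mem_block c f) t' (fun u hu => ?_) r, fun f => ?_, fun f => ?_⟩
      · have : n < u := by exact_mod_cast hu.1
        omega
      · exact Set.disjoint_left.1 (hf₂ _ hn1 h (Or.inl (hP.sys.head _ (hD hn1)))) (mem_block c f)
      · exact Set.disjoint_left.1 (hf₂ _ hn1 tl (Or.inr (hP.sys.tail _ (hD hn1)))) (mem_block c f)
    have hT : n < T := by exact_mod_cast hu
    have hc : ¬ Entered s D h n c := by
      intro hE
      rcases (hP.inv n hn hT).known c hE with rfl | rfl | ⟨q, t₁, ht₁, h'⟩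
      · exact hal.head .val (mem_block _ .val)
      · exact hal.tail .val (mem_block _ .val)
      · have := (hal.unique hP.sys.healthy h' (f := .val) (f' := .val) rfl).2.2
        omega
    have h₀ := k.after hP hn
    have hseg : ∀ m : ℤ, (m : Pos) ≤ w → n ≤ m → m < T →
        Seg s D T p Z (Sum.inr '' block c) n m := fun m hm hnm hmT =>
      ⟨hn, hnm, hmT, fun t h₁ h₂ => hD ⟨by exact_mod_cast h₁, le_trans (by exact_mod_cast h₂) hm⟩,
        fun t h₁ h₂ va hva hW => hi p rfl va ⟨hva, hW⟩ t
          ⟨by exact_mod_cast h₁, le_trans (by exact_mod_cast h₂) hm⟩⟩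
    constructor
    · intro hTw b' _ hb'
      refine Or.inr ⟨c, n + 1, ?_, by omega, hal, ?_⟩
      · by_contra hn'
        exact hi p rfl (Sum.inr b') ⟨hZ b', by simpa using hn'⟩ T ⟨hu, hTw⟩ hb'
      · refine (hseg (T - 1) (le_trans ?_ hTw) (by omega) (by omega)).not_entered hP hZ hal hc h₀
          (by simp)
        norm_cast; omega
    · intro hw
      obtain ⟨m, rfl⟩ := Pos.eq_coe huw hw
      have hnm : n < m := by
        have := mem_ioc_coe.1 hn1; omega
      have hs := hseg m le_rfl hnm.le (by exact_mod_cast hw)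
      have hac : ∀ d, Entered s D h n d → ∀ f, Sum.inr (d + Field.offset f) ∉
          (Sum.inr '' block c : Set (Loc Proc)) := by
        intro d hd f
        simp only [Set.mem_image, Sum.inr.injEq, exists_eq_right]
        rintro ⟨f', hf'⟩
        have := hP.sys.known_unique ((hP.inv n hn hT).known d hd)
          (Or.inr (Or.inr ⟨p, n + 1, le_rfl, hal⟩)) hf'
        exact hc (this.1 ▸ hd)
      exact at_end hs ⟨a, b, k.stable hP hs hZ o₁ o₂ (by simp) (by simp) (hac a k.ea) (hac b k.eb),
        ⟨n + 1, by omega, hal⟩, hs.not_entered hP hZ hal hc h₀ (by simp),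
        (hk m ⟨by exact_mod_cast hnm, le_rfl⟩).1⟩
  · rintro n m σ k hs ⟨a, b, kI, kN⟩ - he
    cases he
    exact ⟨rfl, a, b, kI.stable hP hs hZ o₁ o₂ (by simp) (by simp) (by simp) (by simp),
      kN.stable hP hs hZ (kI.after hP hs.start) (by simp) (by simp)⟩
  · rintro n m k hs - ⟨rfl, a, b, kI, kN⟩ hm
    exact ⟨a, b, c, kI.stable hP hs hZ o₁ o₂ (by simpa using n₁) (by simpa using n₂) (by simp)
      (by simp), kN.stable hP hs hZ (kI.after hP hs.start) (by simp) (by simp), hm⟩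

theorem walk_assign_const {v : Var Proc} {k : Val Proc} (hP : Past s D P h tl t₀ T)
    (hZ : ∀ b, Sum.inr b ∈ Z) (o₁ : Own p Z v₁) (o₂ : Own p Z v₂) (n₁ : v₁ ≠ v) (n₂ : v₂ ≠ v) :
    Walk s D T (GoodAt s D h tl p T) (beh (.assign v (.const k)) {p} Z)
      (At D fun n => ∃ a b, LockedPair s D h p x v₁ v₂ n a b)
      (At D fun n => ∃ a b, LockedPair s D h p x v₁ v₂ n a b) := by
  refine Walk.solo (walk_assign (fun _ n => ∃ a b, LockedPair s D h p x v₁ v₂ n a b) hZ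
    GoodAt.of_idle ?_ ?_)
  · rintro n m σ k hs ⟨a, b, k⟩ - -
    exact ⟨a, b, k.stable hP hs hZ o₁ o₂ (by simp) (by simp) (by simp) (by simp)⟩
  · rintro n m k hs - ⟨a, b, k⟩ -
    exact ⟨a, b, k.stable hP hs hZ o₁ o₂ (by simpa using n₁) (by simpa using n₂) (by simp)
      (by simp)⟩

/-- The value of a node of a located pair, as read in a guard. -/
theorem LockedPair.seen_val (k : LockedPair s D h p x v₁ v₂ n a b) (hP : Past s D P h tl t₀ T)
    (hs : Seg s D T p Z ∅ n m) (o₂ : Own p Z v₂) {σ : Loc Proc → Option (Val Proc)}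
    {w : Val Proc} (hσ : Seen s n m σ) (e : ((Expr.var v₂).at .val).eval σ = some w) :
    cell s m b .val = w := by
  obtain ⟨a', t, h₁, h₂, h₃, h₄⟩ := hs.seen_at hP.sys.healthy o₂ (by simp) hσ e
  rw [k.snd] at h₁
  cases h₁
  rw [hP.val_eq (hs.mem t h₂ h₃) hs.end_mem h₃ hs.lt (k.eb.mono h₂.le), h₄]

theorem walk_add (hP : Past s D P h tl t₀ T) (hZ : ∀ b, Sum.inr b ∈ Z)
    (o₁ : Own p Z (.n1 p)) (o₂ : Own p Z (.n2 p)) (o₃ : Own p Z (.n3 p)) :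
    Walk s D T (GoodAt s D h tl p T) (beh (Add p x) {p} Z) (fun _ => True) (fun _ => True) := by
  have hh := hP.sys.healthy
  refine Walk.seq (Walk.label _ (walk_locate hP hZ o₁ o₃ (by simp)))
    (Walk.seq (B := At D fun n => ∃ a b, LockedPair s D h p x (.n1 p) (.n3 p) n a b)
      (Walk.choice ?_ ?_) (Walk.seq (Walk.label _ (walk_unlock_pair hP hZ o₁ o₃))
        (Walk.label _ (walk_unlock_last hP hZ o₃))))
  · refine Walk.seq (B := At D fun n => ∃ a b, InsertPair s D h p x (.n1 p) (.n3 p) n a b)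
      (Walk.label _ (Walk.solo (walk_eval hZ GoodAt.of_idle ?_)))
      (Walk.seq (Walk.label _ (walk_newNode (v := .n2 p) hP hZ o₁ o₃ (by simp) (by simp)))
      (Walk.seq (B := At D fun n => ∃ a b c, InsertPair s D h p x (.n1 p) (.n3 p) n a b ∧
          NewNode s D h tl p x n c ∧ (s n).mem (Sum.inl (.n2 p)) = .addr c ∧
          cell s n c .nxt = .addr b)
        (Walk.label _ (Walk.solo (walk_assign_cell hh o₂ hZ (Or.inr ⟨_, o₃, rfl⟩) ?_ ?_ ?_)))
      (Walk.seq (Walk.label _ (Walk.solo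
        (walk_assign_cell hh o₁ hZ (Or.inr ⟨_, o₂, rfl⟩) ?_ ?_ ?_)))
      (Walk.label _ (walk_assign_const hP hZ o₁ o₃ (by simp) (by simp))))))
    · rintro n m σ hs ⟨a, b, k⟩ hσ he
      have k' := k.stable hP hs hZ o₁ o₃ (by simp) (by simp) (by simp) (by simp)
      refine ⟨a, b, k', fun kb hkb => ?_⟩
      obtain ⟨w₁, w₂, e₁, e₂, e₃⟩ := eval_eq.1 (eval_not.1 he)
      cases e₂
      have e₄ := k.toLockedPair.seen_val hP hs o₃ hσ e₁
      rw [hkb] at e₄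
      subst e₄
      obtain ⟨ka, kb', -, g₂, -, g₄⟩ := k'.keys
      rw [hkb] at g₂
      cases g₂
      refine lt_of_le_of_ne g₄ fun e => ?_
      rw [← e] at e₃
      simp at e₃
    · rintro n m hs ⟨a, b, c, kI, kN, e⟩
      exact ⟨a, b, c, kI.stable hP hs hZ o₁ o₃ (by simp) (by simp) (by simp) (by simp),
        kN.stable hP hs hZ (kI.after hP hs.start) (by simp) (by simp),
        (hs.var hh o₂ (by simp)).trans e⟩
    · rintro c' k hT₁ hT ⟨a, b, c, kI, kN, e⟩ e' - - -
      rw [e] at e'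
      cases e'
      obtain ⟨t, ht, hal⟩ := kN.alloc
      exact Or.inr ⟨_, t, mem_block _ _, by omega, hal, kN.notEntered⟩
    · rintro n m c' k hs hlt ⟨a, b, c, kI, kN, e⟩ e' ek hk
      rw [e] at e'
      cases e'
      have hnT := hlt.trans hs.lt
      refine ⟨a, b, _, kI.stable hP hs hZ o₁ o₃ (by simp) (by simp) (fun f => ?_) (fun f => ?_),
        kN.stable hP hs hZ (kI.after hP hs.start) ?_ ?_, (hs.var hh o₂ (by simp)).trans e, ?_⟩
      · simpa using kN.cell_ne hP hs.start hnT kI.ea f .nxt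
      · simpa using kN.cell_ne hP hs.start hnT kI.eb f .nxt
      · rintro b' hb'
        simp only [Set.mem_singleton_iff, Sum.inr.injEq] at hb'
        exact hb' ▸ mem_block _ _
      · simp [Field.offset]
      · have : some ((s n).mem (Sum.inl (.n3 p))) = some k := ek
        rw [kI.snd] at this
        cases this
        exact hk
    · rintro n m hs ⟨a, b, c, kI, kN, e, e'⟩
      obtain ⟨t, ht, hal⟩ := kN.alloc
      have h₀ := kI.after hP hs.start
      exact ⟨a, b, c, kI.stable hP hs hZ o₁ o₃ (by simp) (by simp) (by simp) (by simp),
        kN.stable hP hs hZ h₀ (by simp) (by simp),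
        (hs.var hh o₂ (by simp)).trans e,
        (hs.private_cell hP hZ hal kN.notEntered h₀ (by simp) (by simp)).trans e'⟩
    · rintro a' k hT₁ hT ⟨a, b, c, kI, kN, e₁, e₂⟩ e' ek hk honly
      rw [kI.fst] at e'
      cases e'
      have : some ((s (T - 1)).mem (Sum.inl (.n2 p))) = some k := ek
      rw [e₁] at this
      cases this
      obtain ⟨t, ht, hal⟩ := kN.alloc
      obtain ⟨ka, kb, g₁, g₂, g₃, g₄⟩ := kI.keys
      refine Or.inl ⟨_, .nxt, rfl, kI.ea, .link b c kI.la ?_ ⟨kI.nx, hk, e₂, ⟨t, by omega, hal⟩,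
        kN.notEntered, ⟨ka, _, kb, g₁, kN.val, g₂, g₃, kI.lt kb g₂⟩, honly⟩⟩
      rw [kI.ma]
      simp
    · rintro n m a' k hs hlt ⟨a, b, c, kI, kN, e₁, e₂⟩ e' ek hk
      rw [kI.fst] at e'
      cases e'
      refine ⟨_, b, kI.toLockedPair.stable hP hs hZ o₁ o₃ (by simp) (by simp) ?_ ?_⟩
      · simp [Field.offset]
      · simpa using (kI.toPair.cell_ne hP hs.start (hlt.trans hs.lt) .nxt .lck).symm
  · refine Walk.seq (Walk.label _ (Walk.mono (walk_guard_locked hP hZ o₁ o₃) (fun _ => id) ?_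
      (fun _ => id))) (Walk.label _ (walk_assign_const hP hZ o₁ o₃ (by simp) (by simp)))
    rintro u ⟨n, rfl, hn, a, b, k⟩
    exact ⟨n, rfl, hn, a, b, k.toLockedPair⟩

/-! ### Removal -/

theorem walk_remove (hP : Past s D P h tl t₀ T) (hZ : ∀ b, Sum.inr b ∈ Z)
    (o₁ : Own p Z (.n1 p)) (o₂ : Own p Z (.n2 p)) (o₃ : Own p Z (.n3 p)) :
    Walk s D T (GoodAt s D h tl p T) (beh (Remove p x) {p} Z) (fun _ => True) (fun _ => True) := by
  have hh := hP.sys.healthy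
  refine Walk.seq (Walk.label _ (walk_locate hP hZ o₁ o₂ (by simp)))
    (Walk.seq (B := At D fun n => ∃ a b, LockedPair s D h p x (.n1 p) (.n2 p) n a b)
      (Walk.choice ?_ ?_) (Walk.seq (Walk.label _ (walk_unlock_pair hP hZ o₁ o₂))
        (Walk.label _ (walk_unlock_last hP hZ o₂))))
  · refine Walk.seq (B := At D fun n => ∃ a b,
        AdjacentPair s D h p x (.n1 p) (.n2 p) false n a b)
      (Walk.label _ (Walk.solo (walk_eval hZ GoodAt.of_idle ?_)))
      (Walk.seq (B := At D fun n => ∃ a b, AdjacentPair s D h p x (.n1 p) (.n2 p) true n a b)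
        (Walk.label _ (Walk.solo (walk_assign_cell hh o₂ hZ (Or.inl ⟨_, rfl⟩) ?_ ?_ ?_)))
      (Walk.seq (B := At D fun n => ∃ a b, AdjacentPair s D h p x (.n1 p) (.n2 p) true n a b ∧
          (s n).mem (Sum.inl (.n3 p)) = cell s n b .nxt)
        (Walk.label _ (Walk.solo (walk_assign (fun k n => ∃ a b,
          AdjacentPair s D h p x (.n1 p) (.n2 p) true n a b ∧ k = cell s n b .nxt)
          hZ GoodAt.of_idle ?_ ?_)))
      (Walk.seq (Walk.label _ (Walk.solo
        (walk_assign_cell hh o₁ hZ (Or.inr ⟨_, o₃, rfl⟩) ?_ ?_ ?_)))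
      (Walk.label _ (walk_assign_const hP hZ o₁ o₂ (by simp) (by simp))))))
    · rintro n m σ hs ⟨a, b, k⟩ - -
      exact ⟨a, b, k.stable hP hs hZ o₁ o₂ (by simp) (by simp) (by simp) (by simp)⟩
    · rintro n m hs ⟨a, b, k⟩
      exact ⟨a, b, k.stable hP hs hZ o₁ o₂ (by simp) (by simp) (by simp) (by simp)⟩
    · rintro b' k hT₁ hT ⟨a, b, kA⟩ e ek hk -
      rw [kA.snd] at e
      cases e
      cases ek
      exact Or.inl ⟨_, .mrk, rfl, kA.eb, .mark kA.lb hk⟩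
    · rintro n m b' k hs hlt ⟨a, b, kA⟩ e ek hk
      rw [kA.snd] at e
      cases e
      cases ek
      have hne := kA.toPair.cell_ne hP hs.start (hlt.trans hs.lt)
      have hwa : ∀ f, Sum.inr (a + Field.offset f) ∉
          ({Sum.inr (b' + Field.mrk.offset)} : Set (Loc Proc)) := fun f => by
        simpa using hne f .mrk
      refine ⟨a, _, kA.toLockedPair.stable hP hs hZ o₁ o₂ (by simp) (by simp) (hwa _) ?_,
        (hs.locked hP hZ kA.ea kA.la (hwa _) _ (hwa _)).trans kA.ma, hk,
        (hs.locked hP hZ kA.ea kA.la (hwa _) _ (hwa _)).trans kA.nx⟩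
      simp [Field.offset]
    · rintro n m σ k hs ⟨a, b, kA⟩ hσ he
      refine ⟨a, b, kA.stable hP hs hZ o₁ o₂ (by simp) (by simp) (by simp) (by simp), ?_⟩
      obtain ⟨b', t, h₁, h₂, h₃, h₄⟩ := hs.seen_at hh o₂ (by simp) hσ he
      rw [kA.snd] at h₁
      cases h₁
      rw [hs.locked hP hZ kA.eb kA.lb (by simp) _ (by simp), ← h₄,
        (hs.take h₂.le h₃).locked hP hZ kA.eb kA.lb (by simp) _ (by simp)]
    · rintro n m k hs - ⟨a, b, kA, rfl⟩ hm
      refine ⟨a, b, kA.stable hP hs hZ o₁ o₂ (by simp) (by simp) (by simp) (by simp), ?_⟩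
      rw [hm, hs.locked hP hZ kA.eb kA.lb (by simp) _ (by simp)]
    · rintro n m hs ⟨a, b, kA, e⟩
      refine ⟨a, b, kA.stable hP hs hZ o₁ o₂ (by simp) (by simp) (by simp) (by simp), ?_⟩
      rw [hs.var hh o₃ (by simp), e, hs.locked hP hZ kA.eb kA.lb (by simp) _ (by simp)]
    · rintro a' k hT₁ hT ⟨a, b, kA, e₁⟩ e' ek hk -
      rw [kA.fst] at e'
      cases e'
      have : some ((s (T - 1)).mem (Sum.inl (.n3 p))) = some k := ek
      rw [e₁] at this
      refine Or.inl ⟨_, .nxt, rfl, kA.ea, .unlink b kA.la ?_ kA.nx kA.mb ?_⟩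
      · rw [kA.ma]
        simp
      · rw [hk]
        exact (Option.some.inj this).symm
    · rintro n m a' k hs hlt ⟨a, b, kA, -⟩ e' - -
      rw [kA.fst] at e'
      cases e'
      refine ⟨_, b, kA.toLockedPair.stable hP hs hZ o₁ o₂ (by simp) (by simp) ?_ ?_⟩
      · simp [Field.offset]
      · simpa using (kA.toPair.cell_ne hP hs.start (hlt.trans hs.lt) .nxt .lck).symm
  · refine Walk.seq (Walk.label _ (Walk.mono (walk_guard_locked hP hZ o₁ o₂) (fun _ => id) ?_
      (fun _ => id))) (Walk.label _ (walk_assign_const hP hZ o₁ o₂ (by simp) (by simp)))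
    rintro u ⟨n, rfl, hn, a, b, k⟩
    exact ⟨n, rfl, hn, a, b, k.toLockedPair⟩

end AddRemove

/-! ### The abstract set -/

section AbsSet

variable {s : Stream Proc} {D : Set ℤ} {P : Set Proc} {h tl : ℕ} {t₀ T t : ℤ} {x : ℤ} {a b d : ℕ}

theorem evalIn_at {σ : State Proc} {f : Field} {k : Val Proc} :
    ((Expr.const (.addr a)).at f).evalIn σ = some k ↔ σ.mem (Sum.inr (a + f.offset)) = k := by
  rw [Expr.evalIn, eval_at]
  simp [Expr.eval]

theorem RE_iff_reach : RE (.addr h) (.addr a) (s t) ↔ Reach s h t a := by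
  constructor
  · rintro ⟨k, hk⟩
    induction k generalizing a with
    | zero =>
      cases hk
      exact Relation.ReflTransGen.refl
    | succ k ih =>
      obtain ⟨v, hv, hv'⟩ := Option.bind_eq_some_iff.1 hk
      rw [Expr.evalIn, eval_at] at hv'
      obtain ⟨c, hc, hc'⟩ := hv'
      cases hc
      exact (ih hv).tail (Option.some.inj hc')
  · intro hr
    induction hr with
    | refl => exact ⟨0, rfl⟩
    | tail _ hst ih =>
      obtain ⟨k, hk⟩ := ih
      refine ⟨k + 1, ?_⟩
      rw [follow, hk]
      exact evalIn_at.2 hst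

theorem inAbs_iff (hh : (s t).mem (Sum.inl .Head) = .addr h) :
    inAbs x (s t) ↔ ∃ a, Reach s h t a ∧ cell s t a .mrk = .bool false ∧
      cell s t a .val = .key (x : Key) := by
  simp only [inAbs, absSet, setAddr, Set.mem_ofPred_eq, hh, RE_iff_reach, and_assoc, evalIn_at]
  simp only [Expr.holds, Expr.evalIn, eval_not, eval_at, eval_const, cell, Bool.not_true]
  simp

theorem ListInv.path (hI : ListInv s D h tl t) (ha : Entered s D h t a)
    (hr : Relation.ReflTransGen (fun a b => cell s t a .nxt = .addr b) a b) :
    Entered s D h t b ∧ ∀ ka kb, cell s t a .val = .key ka → cell s t b .val = .key kb →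
      ka ≤ kb := by
  induction hr with
  | refl =>
    refine ⟨ha, fun ka kb h₁ h₂ => ?_⟩
    rw [h₁] at h₂
    cases h₂
    exact le_rfl
  | @tail c d _ hst ih =>
    refine ⟨hI.edge _ _ ih.1 hst, fun ka kb h₁ h₂ => ?_⟩
    obtain ⟨kc, hc⟩ := hI.key _ ih.1
    exact (ih.2 ka kc h₁ hc).trans (hI.sorted _ _ kc kb ih.1 hst hc h₂).le

theorem Reach.total (ha : Reach s h t a) (hb : Reach s h t b) :
    Relation.ReflTransGen (fun a b => cell s t a .nxt = .addr b) a b ∨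
      Relation.ReflTransGen (fun a b => cell s t a .nxt = .addr b) b a := by
  refine Relation.ReflTransGen.total_of_right_unique ?_ ha hb
  intro c d e h₁ h₂
  rw [h₁] at h₂
  cases h₂
  rfl

/-- A gap between adjacent reachable nodes witnesses the absence of `x`. -/
theorem notInAbs_of_gap (hh : (s t).mem (Sum.inl .Head) = .addr h) (ht : t ∈ D)
    (hI : ListInv s D h tl t) {ka kb : Key} (ha : Reach s h t a)
    (hab : cell s t a .nxt = .addr b) (hka : cell s t a .val = .key ka)
    (hkb : cell s t b .val = .key kb) (h₁ : ka < (x : Key)) (h₂ : (x : Key) < kb) :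
    notInAbs x (s t) := by
  intro hin
  obtain ⟨d, hd, -, hkd⟩ := (inAbs_iff hh).1 hin
  rcases ha.total hd with hr | hr
  · rcases hr.cases_head with rfl | ⟨b', hb', hr'⟩
    · rw [hka] at hkd
      cases hkd
      exact lt_irrefl _ h₁
    · rw [hab] at hb'
      cases hb'
      have := (hI.path (hI.edge _ _ (ha.entered ht) hab) hr').2 _ _ hkb hkd
      exact absurd h₂ (not_lt.2 this)
  · have := (hI.path (hd.entered ht) hr).2 _ _ hkd hka
    exact absurd h₁ (not_lt.2 this)

/-- A reachable marked node with value `x` witnesses the absence of `x`. -/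
theorem notInAbs_of_marked (hh : (s t).mem (Sum.inl .Head) = .addr h) (ht : t ∈ D)
    (hI : ListInv s D h tl t) (ha : Reach s h t a) (hm : cell s t a .mrk = .bool true)
    (hk : cell s t a .val = .key (x : Key)) : notInAbs x (s t) := by
  have aux : ∀ c e, Entered s D h t c → cell s t c .val = .key (x : Key) →
      cell s t e .val = .key (x : Key) →
      Relation.ReflTransGen (fun a b => cell s t a .nxt = .addr b) c e → c = e := by
    intro c e hc hkc hke hr
    rcases hr.cases_head with rfl | ⟨b', hb', hr'⟩
    · rfl
    · have hE := hI.edge _ _ hc hb'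
      obtain ⟨kb, hkb⟩ := hI.key _ hE
      have h₁ := hI.sorted _ _ _ _ hc hb' hkc hkb
      have h₂ := (hI.path hE hr').2 _ _ hkb hke
      exact absurd h₁ (not_lt.2 h₂)
  intro hin
  obtain ⟨d, hd, hmd, hkd⟩ := (inAbs_iff hh).1 hin
  have : a = d := by
    rcases ha.total hd with hr | hr
    · exact aux a d (ha.entered ht) hk hkd hr
    · exact (aux d a (hd.entered ht) hkd hk hr).symm
  subst this
  rw [hm] at hmd
  cases hmd

/-! ### Hindsight -/

theorem Past.reach_step (hP : Past s D P h tl t₀ T) (ht : t ∈ D) (ht' : t - 1 ∈ D) (hT : t < T)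
    (ha : Reach s h (t - 1) a) : Reach s h t a ∨ cell s (t - 1) a .mrk = .bool true := by
  rcases le_or_gt t t₀ with h₀ | h₀
  · left
    rcases hP.sys.reach_init ht' (by omega) ha with rfl | rfl
    · exact Relation.ReflTransGen.refl
    · exact hP.sys.reach_tail_init ht h₀
  · exact (hP.good t ht ht' hT).reach hP.sys ht' (hP.inv _ ht' (by omega)) h₀ ha

theorem Past.marked_of_gone (hP : Past s D P h tl t₀ T) (ht : t ∈ D) (ht' : t - 1 ∈ D)
    (hT : t < T) (ha : Entered s D h (t - 1) a) (hn : ¬ Reach s h t a) :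
    cell s (t - 1) a .mrk = .bool true := by
  by_contra hm
  have hr := (hP.inv _ ht' (by omega)).unmarked a ha hm
  exact (hP.reach_step ht ht' hT hr).elim hn hm

/-- If a node that was reachable at time `t` has a certain successor at the later time `u`, then at
some time in between it was reachable and had the same successor. -/
theorem Past.hindsight_nxt (hP : Past s D P h tl t₀ T) (ht : t ∈ D) (ha : Reach s h t a) {u : ℤ}
    (hu : u ∈ D) (htu : t ≤ u) (hT : u < T) :
    ∃ w, t ≤ w ∧ w ≤ u ∧ Reach s h w a ∧ cell s w a .nxt = cell s u a .nxt := by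
  refine int_stable (J := fun u => ∃ w, t ≤ w ∧ w ≤ u ∧ Reach s h w a ∧
    cell s w a .nxt = cell s u a .nxt) htu ⟨t, le_rfl, le_rfl, ha, rfl⟩ ?_
  rintro r h₁ h₂ ⟨w, hw₁, hw₂, hw, e⟩
  by_cases hr : Reach s h r a
  · exact ⟨r, h₁.le, le_rfl, hr, rfl⟩
  · obtain ⟨hm, hm'⟩ := hP.step_mem ht hu h₁ h₂
    have hE : Entered s D h (r - 1) a := (ha.entered ht).mono (by omega)
    have hmk := hP.marked_of_gone hm hm' (by omega) hE hr
    exact ⟨w, hw₁, by omega, hw,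
      e.trans ((hP.good r hm hm' (by omega)).nxt_frozen hE hmk).symm⟩

/-- If a node that was reachable at time `t` is marked at the later time `u`, then at some time in
between it was both reachable and marked. -/
theorem Past.hindsight_marked (hP : Past s D P h tl t₀ T) (ht : t ∈ D) (ha : Reach s h t a) {u : ℤ}
    (hu : u ∈ D) (htu : t ≤ u) (hT : u < T) (hm : cell s u a .mrk = .bool true) :
    ∃ w, t ≤ w ∧ w ≤ u ∧ Reach s h w a ∧ cell s w a .mrk = .bool true := by
  revert hm
  refine int_stable (J := fun u => cell s u a .mrk = .bool true → ∃ w, t ≤ w ∧ w ≤ u ∧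
    Reach s h w a ∧ cell s w a .mrk = .bool true) htu (fun h => ⟨t, le_rfl, le_rfl, ha, h⟩) ?_
  intro r h₁ h₂ ih hmr
  by_cases hr : Reach s h r a
  · exact ⟨r, h₁.le, le_rfl, hr, hmr⟩
  · obtain ⟨hm, hm'⟩ := hP.step_mem ht hu h₁ h₂
    have hE : Entered s D h (r - 1) a := (ha.entered ht).mono (by omega)
    obtain ⟨w, hw₁, hw₂, hw, e⟩ := ih (hP.marked_of_gone hm hm' (by omega) hE hr)
    exact ⟨w, hw₁, by omega, hw, e⟩

end AbsSet

/-! ### The traversal of `Contains` -/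

section Contains

variable {s : Stream Proc} {D D' : Set ℤ} {P : Set Proc} {h tl : ℕ} {t₀ T : ℤ} {p : Proc}
  {Z : Set (Loc Proc)} {x : ℤ}

/-- The node in `n1` was reachable at some time of `D'`, and if its value is above `x`, then `x` has
been absent at some time of `D'`. -/
def Visit (s : Stream Proc) (D' : Set ℤ) (h : ℕ) (x : ℤ) (n : ℤ) (k : Val Proc) : Prop :=
  ∀ a, k = .addr a → ∃ t ∈ D', t ≤ n ∧ Reach s h t a ∧
    ∀ ka, cell s n a .val = .key ka → (x : Key) < ka → ∃ u ∈ D', notInAbs x (s u)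

theorem Visit.stable {n m : ℤ} {k : Val Proc} (hV : Visit s D' h x n k)
    (hP : Past s D P h tl t₀ T) (hD : D' ⊆ D) (hn : n ∈ D') (hm : m ∈ D') (hnm : n ≤ m)
    (hT : m < T) : Visit s D' h x m k := by
  intro a ha
  obtain ⟨t, ht, htn, hr, hk⟩ := hV a ha
  refine ⟨t, ht, htn.trans hnm, hr, ?_⟩
  rw [hP.val_eq (hD hn) (hD hm) hnm hT ((hr.entered (hD ht)).mono htn)]
  exact hk

theorem walk_CL (hP : Past s D P h tl t₀ T) (hD : D' ⊆ D) (hc : D'.OrdConnected)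
    (hZ : ∀ b, Sum.inr b ∈ Z) (o : Own p Z (.n1 p)) :
    Walk s D' T True (beh (CL p x) {p} Z) (fun _ => True)
      (At D' fun n => ∃ a ka, (s n).mem (Sum.inl (.n1 p)) = .addr a ∧
        Visit s D' h x n (.addr a) ∧ cell s n a .val = .key ka ∧ (x : Key) ≤ ka) := by
  have hh := hP.sys.healthy
  have triv : T ∈ D' → (∀ b, ¬ CanWrite (Sum.inr b) p (s T)) → True := fun _ _ => trivial
  -- A guard on the value of the current node reads its true value.
  have guard : ∀ n m σ k, Seg s D' T p Z ∅ n m → Visit s D' h x n ((s n).mem (Sum.inl (.n1 p))) →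
      Seen s n m σ → ((Expr.var (.n1 p)).at .val).eval σ = some (.key k) →
      ∃ a, (s m).mem (Sum.inl (.n1 p)) = .addr a ∧ Visit s D' h x m (.addr a) ∧
        cell s m a .val = .key k := by
    intro n m σ k hs hV hσ he
    obtain ⟨a, t, h₁, h₂, h₃, h₄⟩ := hs.seen_at hh o (by simp) hσ he
    rw [h₁] at hV
    refine ⟨a, (hs.var hh o (by simp)).trans h₁,
      hV.stable hP hD hs.start hs.end_mem hs.le hs.lt, ?_⟩
    obtain ⟨t', ht', htn, hr, -⟩ := hV a rfl
    rw [hP.val_eq (hD (hs.mem t h₂ h₃)) (hD hs.end_mem) h₃ hs.lt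
      ((hr.entered (hD ht')).mono (htn.trans h₂.le)), h₄]
  refine Walk.seq (B := At D' fun n => Visit s D' h x n ((s n).mem (Sum.inl (.n1 p))))
    (Walk.label _ ?_) (Walk.label _ (Walk.seq (Walk.omega ?_ (Walk.seq
      (B := At D' fun n => ∃ a ka, (s n).mem (Sum.inl (.n1 p)) = .addr a ∧
        Visit s D' h x n (.addr a) ∧ cell s n a .val = .key ka ∧ ka < (x : Key))
      (Walk.solo (walk_eval hZ triv ?_))
      (Walk.solo (walk_assign (fun k n => Visit s D' h x n k) hZ triv ?_ ?_))))
      (Walk.solo (walk_eval hZ triv ?_))))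
  · intro u w huw hu hDu hg hA
    refine ⟨fun _ => trivial, fun hw => ?_⟩
    obtain ⟨n, rfl, hn, e⟩ := (walk_assign_head (h := h) (Goal := True) hZ triv
      (fun t ht => hP.sys.head t (hD ht)) u w huw hu hDu (solo_singleton hg) hA).2 hw
    refine ⟨n, rfl, hn, fun a ha => ?_⟩
    rw [e] at ha
    cases ha
    refine ⟨n, hn, le_rfl, Relation.ReflTransGen.refl, fun ka hka hlt => ?_⟩
    rw [hP.head_val (hD hn) (by exact_mod_cast hw)] at hka
    cases hka
    exact absurd hlt not_lt_bot
  · exact nonEmp_seq_right (nonEmp_assign _ _ _)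
  · intro n m σ hs hV hσ he
    obtain ⟨k, l, h₁, h₂, hlt⟩ := eval_lt.1 he
    cases h₂
    obtain ⟨a, e₁, e₂, e₃⟩ := guard n m σ k hs hV hσ h₁
    exact ⟨a, k, e₁, e₂, e₃, hlt⟩
  · rintro n m σ k hs ⟨a, ka, e₁, e₂, e₃, hlt⟩ hσ he b rfl
    obtain ⟨a', t, h₁, h₂, h₃, h₄⟩ := hs.seen_at hh o (by simp) hσ he
    rw [e₁] at h₁
    cases h₁
    obtain ⟨t', ht', htn, hr, -⟩ := e₂ a rfl
    have ht := hs.mem t h₂ h₃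
    have htT := h₃.trans_lt hs.lt
    obtain ⟨w, hw₁, hw₂, hw, e⟩ := hP.hindsight_nxt (hD ht') hr (hD ht) (by omega) htT
    rw [h₄] at e
    have hwD : w ∈ D' := hc.out ht' ht ⟨hw₁, hw₂⟩
    have hwb : Reach s h w b := hw.tail e
    refine ⟨w, hwD, hw₂.trans h₃, hwb, fun kb hkb hx => ?_⟩
    refine ⟨w, hwD, notInAbs_of_gap (hP.sys.head w (hD hwD)) (hD hwD)
      (hP.inv w (hD hwD) (by omega)) hw e (ka := ka) (kb := kb) ?_ ?_ hlt hx⟩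
    · have h₅ := hP.val_eq (hD hwD) (hD hs.end_mem) (hw₂.trans h₃) hs.lt (hw.entered (hD hwD))
      have h₆ := hP.val_eq (hD hs.start) (hD hs.end_mem) hs.le hs.lt
        ((hr.entered (hD ht')).mono htn)
      rw [← h₅, h₆, e₃]
    · rw [← hP.val_eq (hD hwD) (hD hs.end_mem) (hw₂.trans h₃) hs.lt (hwb.entered (hD hwD)), hkb]
  · intro n m k hs hlt hV hm
    rw [hm]
    exact hV.stable hP hD hs.start hs.end_mem hs.le hs.lt
  · intro n m σ hs hV hσ he
    obtain ⟨k, l, h₁, h₂, hle⟩ := eval_le.1 he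
    cases h₁
    obtain ⟨a, e₁, e₂, e₃⟩ := guard n m σ l hs hV hσ h₂
    exact ⟨a, l, e₁, e₂, e₃, hle⟩

/-- The outcome `r` of a traversal is justified by an actual state of `D'`. -/
def Justified (s : Stream Proc) (D' : Set ℤ) (x : ℤ) (r : Bool) : Prop :=
  ∃ t ∈ D', if r then inAbs x (s t) else notInAbs x (s t)

theorem walk_CL_eval (hP : Past s D P h tl t₀ T) (hD : D' ⊆ D) (hc : D'.OrdConnected)
    (hZ : ∀ b, Sum.inr b ∈ Z) (o : Own p Z (.n1 p)) {c : Expr Proc} {r : Bool}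
    (hr : ∀ σ, c.eval σ = some (.bool true) → (IN p x).eval σ = some (.bool r)) :
    Walk s D' T True (chop (beh (CL p x) {p} Z) (evalBeh p Z c)) (fun _ => True)
      (At D' fun _ => Justified s D' x r) := by
  have hh := hP.sys.healthy
  refine Walk.chop (walk_CL hP hD hc hZ o) (walk_eval hZ (fun _ _ => trivial) ?_)
  rintro n m σ hs ⟨a, ka, h₁, hV, hk, hle⟩ hσ he
  obtain ⟨t', ht', htn, hR, hW⟩ := hV a rfl
  obtain ⟨b₁, b₂, e₁, e₂, e₃⟩ := eval_and.1 (hr σ he)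
  obtain ⟨k₁, k₂, e₄, e₅, e₆⟩ := eval_eq.1 e₂
  cases e₅
  obtain ⟨a₁, t, i₁, i₂, i₃, i₄⟩ := hs.seen_at hh o (by simp) hσ (eval_not.1 e₁)
  obtain ⟨a₂, u, j₁, j₂, j₃, j₄⟩ := hs.seen_at hh o (by simp) hσ e₄
  rw [h₁] at i₁ j₁
  cases i₁; cases j₁
  have ht := hs.mem t i₂ i₃
  have htT := i₃.trans_lt hs.lt
  have hE : Entered s D h n a := (hR.entered (hD ht')).mono htn
  have hval : ∀ w, n ≤ w → w ≤ m → cell s w a .val = .key ka := fun w h₁ h₂ => by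
    rw [hP.val_eq (hD hs.start) (hD (hs.mem' h₁ h₂)) h₁ (h₂.trans_lt hs.lt) hE, hk]
  rw [hval u j₂.le j₃] at j₄
  subst j₄
  cases e₃
  by_cases hx : ka = (x : Key)
  · subst hx
    have : b₂ = true := e₆.2 rfl
    subst this
    cases b₁ with
    | true =>
      refine ⟨t, ht, (inAbs_iff (hP.sys.head t (hD ht))).2 ⟨a, ?_, i₄, hval t i₂.le i₃⟩⟩
      refine (hP.inv t (hD ht) htT).unmarked a (hE.mono i₂.le) ?_
      rw [i₄]
      simp
    | false =>
      obtain ⟨w, hw₁, hw₂, hw, e⟩ := hP.hindsight_marked (hD ht') hR (hD ht) (by omega) htT i₄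
      have hwD : w ∈ D' := hc.out ht' ht ⟨hw₁, hw₂⟩
      refine ⟨w, hwD, notInAbs_of_marked (hP.sys.head w (hD hwD)) (hD hwD)
        (hP.inv w (hD hwD) (by omega)) hw e ?_⟩
      rw [← hP.val_eq (hD hwD) (hD ht) hw₂ htT (hw.entered (hD hwD)), hval t i₂.le i₃]
  · have hb : b₂ = false := by
      cases b₂
      · rfl
      · have := e₆.1 rfl
        cases this
        exact absurd rfl hx
    subst hb
    obtain ⟨w, hw, hw'⟩ := hW ka hk (lt_of_le_of_ne hle (Ne.symm hx))
    rw [Bool.and_false]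
    exact ⟨w, hw, hw'⟩

end Contains

/-! ### Commands that do not write to given locations -/

theorem chop_ioc_intro {g₁ g₂ : IntvPred Proc} {u v w : Pos} {s : Stream Proc} (huw : u ≤ w)
    (hwv : w ≤ v) (h₁ : g₁ (ioc u w) s) (h₂ : g₂ (ioc w v) s) : chop g₁ g₂ (ioc u v) s := by
  have e : (ioc u v).1 = (ioc u w).1 ∪ (ioc w v).1 := by
    ext t
    constructor
    · rintro ⟨h, h'⟩
      rcases le_or_gt (t : Pos) w with k | k
      · exact Or.inl ⟨h, k⟩
      · exact Or.inr ⟨k, h'⟩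
    · rintro (⟨h, h'⟩ | ⟨h, h'⟩)
      · exact ⟨h, h'.trans hwv⟩
      · exact ⟨huw.trans_lt h, h'⟩
  refine Or.inl ⟨ioc u w, ioc w v, e, ⟨fun t ht t' ht' => ?_, ?_⟩, h₁, h₂⟩
  · exact_mod_cast ht.2.trans_lt ht'.1
  · rw [← e]
    exact (ioc u v).2

theorem idle_join {P : Set Proc} {W : Set (Loc Proc)} {s : Stream Proc} {u v w : Pos}
    (h₁ : idleBeh P W (ioc u w) s) (h₂ : idleBeh P W (ioc w v) s) :
    idleBeh P W (ioc u v) s := by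
  intro p hp va hva t ht
  rcases le_or_gt (t : Pos) w with k | k
  · exact h₁ p hp va hva t ⟨ht.1, k⟩
  · exact h₂ p hp va hva t ⟨k, ht.2⟩

/-- `g` holds only on intervals in which `p` does not write to `W`. -/
def NoWrite (p : Proc) (W : Set (Loc Proc)) (g : IntvPred Proc) : Prop :=
  ∀ Δ s, g Δ s → idleBeh {p} W Δ s

section NoWrite

variable {p : Proc} {W Z : Set (Loc Proc)} {g : IntvPred Proc} {s : Stream Proc}

theorem NoWrite.walk (h : NoWrite p W g) (D : Set ℤ) (T : ℤ) :
    Walk s D T (∀ va ∈ W, ¬ CanWrite va p (s T)) g (fun _ => True) (fun _ => True) :=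
  fun _ _ _ hu _ hg _ => ⟨fun hv va hva => h _ _ hg p rfl va hva T ⟨hu, hv⟩, fun _ => trivial⟩

/-- Since triples compose, so does the absence of writes. -/
theorem NoWrite.of_walk (h : ∀ s T, Walk s Set.univ T (∀ va ∈ W, ¬ CanWrite va p (s T)) g
    (fun _ => True) (fun _ => True)) : NoWrite p W g := by
  rintro Δ s hg q rfl va hva t ht
  obtain ⟨u, v, huv, rfl⟩ := exists_ioc Δ
  exact (h s t u v huv ht.1 (Set.subset_univ _) hg trivial).1 ht.2 va hva

theorem NoWrite.chop {g' : IntvPred Proc} (h : NoWrite p W g) (h' : NoWrite p W g') :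
    NoWrite p W (chop g g') :=
  .of_walk fun _ _ => (h.walk _ _).chop (h'.walk _ _)

theorem NoWrite.omega (hne : NonEmp g) (h : NoWrite p W g) : NoWrite p W (omega g) :=
  .of_walk fun _ _ => (h.walk _ _).omega hne

theorem NoWrite.seq {C₁ C₂ : Cmd Proc} (h₁ : NoWrite p W (beh C₁ {p} Z))
    (h₂ : NoWrite p W (beh C₂ {p} Z)) : NoWrite p W (beh (C₁ ;; C₂) {p} Z) := h₁.chop h₂

theorem NoWrite.choice {C₁ C₂ : Cmd Proc} (h₁ : NoWrite p W (beh C₁ {p} Z))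
    (h₂ : NoWrite p W (beh C₂ {p} Z)) : NoWrite p W (beh (C₁ ⊓⊓ C₂) {p} Z) :=
  fun Δ s h => h.elim (h₁ Δ s) (h₂ Δ s)

theorem NoWrite.label {C : Cmd Proc} {l : Label} (h : NoWrite p W (beh C {p} Z)) :
    NoWrite p W (beh (.label l C) {p} Z) := fun Δ s k => h Δ s k.2

theorem idle_mono {P : Set Proc} {Δ : Intv} (hWZ : W ⊆ Z) (h : idleBeh P Z Δ s) :
    idleBeh P W Δ s := fun q hq va hva => h q hq va (hWZ hva)

theorem NoWrite.eval (hWZ : W ⊆ Z) (c : Expr Proc) : NoWrite p W (evalBeh p Z c) :=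
  fun _ _ h => idle_mono hWZ h.2

theorem NoWrite.update (hWZ : W ⊆ Z) {va : Loc Proc} (hva : va ∉ W) (k : Val Proc) :
    NoWrite p W (update p Z va k) := by
  intro Δ s h
  refine idle_mono (Z := Z \ {va}) (fun w hw => ⟨hWZ hw, ?_⟩) h.1
  rintro rfl
  exact hva hw

theorem NoWrite.guard (hWZ : W ⊆ Z) (c : Expr Proc) : NoWrite p W (beh (.guard c) {p} Z) :=
  fun _ _ h => idle_mono hWZ (solo_singleton h).2

theorem NoWrite.assignBeh (hWZ : W ⊆ Z) {v : Var Proc} (hv : Sum.inl v ∉ W) (e : Expr Proc) :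
    NoWrite p W (assignBeh p Z v e) := by
  rintro Δ s ⟨k, h⟩
  exact NoWrite.chop (.eval hWZ _) (.update hWZ hv k) Δ s h

theorem NoWrite.assign (hWZ : W ⊆ Z) {v : Var Proc} (hv : Sum.inl v ∉ W) (e : Expr Proc) :
    NoWrite p W (beh (.assign v e) {p} Z) := fun Δ s h =>
  NoWrite.assignBeh hWZ hv e Δ s (solo_singleton h)

theorem NoWrite.assignAt (hWZ : W ⊆ Z) (hW : ∀ b, Sum.inr b ∉ W) (ae e : Expr Proc) :
    NoWrite p W (beh (.assignAt ae e) {p} Z) := by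
  intro Δ s h
  obtain ⟨k, a, h⟩ := solo_singleton h
  exact NoWrite.chop (.eval hWZ _) (.update hWZ (hW a) k) Δ s h

theorem NoWrite.lock (hWZ : W ⊆ Z) (hW : ∀ b, Sum.inr b ∉ W) (ae : Expr Proc) :
    NoWrite p W (beh (.lock ae) {p} Z) := by
  intro Δ s h
  obtain ⟨a, h⟩ := solo_singleton h
  exact NoWrite.chop (.eval hWZ _) (fun Δ s k => NoWrite.update hWZ (hW a) _ Δ s k.2) Δ s h

theorem NoWrite.newNode (hWZ : W ⊆ Z) (hW : ∀ b, Sum.inr b ∉ W) (x : ℤ) {v : Var Proc}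
    (hv : Sum.inl v ∉ W) : NoWrite p W (beh (.newNode x v) {p} Z) := by
  intro Δ s h
  obtain ⟨a, h⟩ := solo_singleton h
  refine NoWrite.chop (fun _ _ k => idle_mono hWZ k) (.chop (fun _ _ k => idle_mono ?_ k.2.2.1)
    (.assignBeh hWZ hv _)) Δ s h
  rintro w hw
  refine ⟨hWZ hw, ?_⟩
  rintro ⟨b, -, rfl⟩
  exact hW b hw

theorem NoWrite.CL (hWZ : W ⊆ Z) (h₁ : Sum.inl (.n1 p) ∉ W) (x : ℤ) :
    NoWrite p W (beh (CL p x) {p} Z) :=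
  .seq (.label (.assign hWZ h₁ _)) (.label (.seq
    (.omega (nonEmp_seq_right (nonEmp_assign _ _ _)) (.seq (.guard hWZ _) (.assign hWZ h₁ _)))
    (.guard hWZ _)))

theorem NoWrite.contains (hWZ : W ⊆ Z) (h₁ : Sum.inl (.n1 p) ∉ W) (hr : Sum.inl (.res p) ∉ W)
    (x : ℤ) : NoWrite p W (beh (Contains p x) {p} Z) :=
  .seq (.CL hWZ h₁ x) (.label (.assign hWZ hr _))

theorem NoWrite.search (hWZ : W ⊆ Z) (hW : ∀ b, Sum.inr b ∉ W) {v₁ v₂ : Var Proc}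
    (h₁ : Sum.inl v₁ ∉ W) (h₂ : Sum.inl v₂ ∉ W) (x : ℤ) :
    NoWrite p W (beh (Search x v₁ v₂) {p} Z) :=
  .seq (.assign hWZ h₁ _) (.seq (.assign hWZ h₂ _) (.seq
    (.omega (nonEmp_seq_right (nonEmp_seq_left (nonEmp_assign _ _ _)))
      (.seq (.guard hWZ _) (.seq (.assign hWZ h₁ _) (.assign hWZ h₂ _))))
    (.seq (.guard hWZ _) (.seq (.lock hWZ hW _) (.lock hWZ hW _)))))

theorem NoWrite.locate (hWZ : W ⊆ Z) (hW : ∀ b, Sum.inr b ∉ W) {v₁ v₂ : Var Proc}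
    (h₁ : Sum.inl v₁ ∉ W) (h₂ : Sum.inl v₂ ∉ W) (x : ℤ) :
    NoWrite p W (beh (Locate x v₁ v₂) {p} Z) :=
  .seq (.omega (nonEmp_tryFind _ _ _ _) (.seq (.search hWZ hW h₁ h₂ x) (.seq (.guard hWZ _)
      (.seq (.assignAt hWZ hW _ _) (.assignAt hWZ hW _ _)))))
    (.seq (.search hWZ hW h₁ h₂ x) (.guard hWZ _))

theorem NoWrite.add (hWZ : W ⊆ Z) (hW : ∀ b, Sum.inr b ∉ W) (h₁ : Sum.inl (.n1 p) ∉ W)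
    (h₂ : Sum.inl (.n2 p) ∉ W) (h₃ : Sum.inl (.n3 p) ∉ W) (hr : Sum.inl (.res p) ∉ W) (x : ℤ) :
    NoWrite p W (beh (Add p x) {p} Z) :=
  .seq (.label (.locate hWZ hW h₁ h₃ x)) (.seq
    (.choice
      (.seq (.label (.guard hWZ _)) (.seq (.label (.newNode hWZ hW x h₂)) (.seq
        (.label (.assignAt hWZ hW _ _)) (.seq (.label (.assignAt hWZ hW _ _))
          (.label (.assign hWZ hr _))))))
      (.seq (.label (.guard hWZ _)) (.label (.assign hWZ hr _))))
    (.seq (.label (.assignAt hWZ hW _ _)) (.label (.assignAt hWZ hW _ _))))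

theorem NoWrite.remove (hWZ : W ⊆ Z) (hW : ∀ b, Sum.inr b ∉ W) (h₁ : Sum.inl (.n1 p) ∉ W)
    (h₂ : Sum.inl (.n2 p) ∉ W) (h₃ : Sum.inl (.n3 p) ∉ W) (hr : Sum.inl (.res p) ∉ W) (x : ℤ) :
    NoWrite p W (beh (Remove p x) {p} Z) :=
  .seq (.label (.locate hWZ hW h₁ h₂ x)) (.seq
    (.choice
      (.seq (.label (.guard hWZ _)) (.seq (.label (.assignAt hWZ hW _ _)) (.seq
        (.label (.assign hWZ h₃ _)) (.seq (.label (.assignAt hWZ hW _ _))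
          (.label (.assign hWZ hr _))))))
      (.seq (.label (.guard hWZ _)) (.label (.assign hWZ hr _))))
    (.seq (.label (.assignAt hWZ hW _ _)) (.label (.assignAt hWZ hW _ _))))

end NoWrite

/-! ### Runs of the whole system -/

/-- The choice of an operation, which `S p` iterates. -/
def op (p : Proc) : Cmd Proc :=
  .choiceInt fun x => Add p x ⊓⊓ Remove p x ⊓⊓ Contains p x

/-- The shared locations and all program variables of `p`. -/
def fullCtx (p : Proc) : Set (Loc Proc) := HT ∪ resVar p ∪ nVars p

section System

variable {s : Stream Proc} {D : Set ℤ} {P : Set Proc} {h tl : ℕ} {t₀ T : ℤ} {p : Proc}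

theorem addr_mem_HT (b : ℕ) : (Sum.inr b : Loc Proc) ∈ HT := Or.inl ⟨b, rfl⟩

theorem addr_mem_fullCtx (b : ℕ) : (Sum.inr b : Loc Proc) ∈ fullCtx p :=
  Or.inl (Or.inl (addr_mem_HT b))

theorem own_n1 : Own p (fullCtx p) (.n1 p) := ⟨rfl, Or.inr (by simp [nVars])⟩

theorem own_n2 : Own p (fullCtx p) (.n2 p) := ⟨rfl, Or.inr (by simp [nVars])⟩

theorem own_n3 : Own p (fullCtx p) (.n3 p) := ⟨rfl, Or.inr (by simp [nVars])⟩

theorem nonEmp_op (Z : Set (Loc Proc)) : NonEmp (beh (op p) {p} Z) := by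
  rintro Δ s ⟨x, h | h | h⟩
  · exact nonEmp_add p x {p} Δ s h
  · exact nonEmp_remove p x {p} Δ s h
  · exact nonEmp_contains p x {p} Δ s h

theorem beh_S_iff {Δ : Intv} : beh (S p) {p} HT Δ s ↔ omega (beh (op p) {p} (fullCtx p)) Δ s := by
  have e : (HT ∪ (nVars p ∪ resVar p) : Set (Loc Proc)) = fullCtx p := by
    rw [fullCtx, Set.union_assoc, Set.union_comm (nVars p)]
  change (HT ∩ (nVars p ∪ resVar p) = ∅ ∧
    omega (beh (op p) {p} (HT ∪ (nVars p ∪ resVar p))) Δ s) ↔ _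
  rw [e]
  refine ⟨fun k => k.2, fun k => ⟨?_, k⟩⟩
  ext va
  simp only [HT, nVars, resVar, Set.mem_inter_iff, Set.mem_union, Set.mem_range,
    Set.mem_insert_iff, Set.mem_singleton_iff, Set.mem_empty_iff_false, iff_false, not_and]
  rintro (⟨b, rfl⟩ | rfl | rfl) <;> simp

theorem noWrite_op_sentinels : NoWrite p {Sum.inl .Head, Sum.inl .Tail}
    (beh (op p) {p} (fullCtx p)) := by
  have hW : ({Sum.inl .Head, Sum.inl .Tail} : Set (Loc Proc)) ⊆ fullCtx p := by
    rintro va (rfl | rfl)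
    · exact Or.inl (Or.inl (Or.inr (Or.inl rfl)))
    · exact Or.inl (Or.inl (Or.inr (Or.inr rfl)))
  rintro Δ s ⟨x, h | h | h⟩
  · exact NoWrite.add hW (by simp) (by simp) (by simp) (by simp) (by simp) x Δ s h
  · exact NoWrite.remove hW (by simp) (by simp) (by simp) (by simp) (by simp) x Δ s h
  · exact NoWrite.contains hW (by simp) (by simp) x Δ s h

theorem walk_op (hP : Past s D P h tl t₀ T) :
    Walk s D T (GoodAt s D h tl p T) (beh (op p) {p} (fullCtx p)) (fun _ => True)
      (fun _ => True) := by
  refine walk_exists fun x => Walk.choice (walk_add hP addr_mem_fullCtx own_n1 own_n2 own_n3)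
    (Walk.choice (walk_remove hP addr_mem_fullCtx own_n1 own_n2 own_n3) ?_)
  intro u v _ hu _ hg _
  refine ⟨fun hv b _ hb => absurd hb ?_, fun _ => trivial⟩
  exact NoWrite.contains (W := Set.range Sum.inr) (by rintro _ ⟨b, rfl⟩; exact addr_mem_fullCtx b)
    (by simp) (by simp) x _ s hg p rfl _ ⟨b, rfl⟩ T ⟨hu, hv⟩

/-- In a parallel composition, each process executes its component and then idles. -/
theorem component_of_par {b : Proc → IntvPred Proc} {Z : Set (Loc Proc)} {Q : Set Proc} {Δ : Intv}
    (hb : parBeh b Z Q Δ s) : ∀ p ∈ Q, chop (b p) (idleBeh {p} Z) Δ s := by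
  have key : parBeh b Z ≤ fun Q Δ s => ∀ p ∈ Q, chop (b p) (idleBeh {p} Z) Δ s := by
    refine OrderHom.lfp_le _ ?_
    have half : ∀ (Q : Set Proc) (i : Bool) (Δ : Intv) (s : Stream Proc),
        chop (fun Δ s => ∀ p ∈ Q, chop (b p) (idleBeh {p} Z) Δ s) (tailBeh i Q Z) Δ s →
        ∀ p ∈ Q, chop (b p) (idleBeh {p} Z) Δ s := by
      intro Q i Δ s hc p hp
      obtain ⟨u, v, huv, rfl⟩ := exists_ioc Δ
      rcases chop_ioc huv hc with ⟨w, huw, hwv, k₁, -, k₂⟩ | ⟨-, k₁⟩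
      · have hi : idleBeh {p} Z (ioc w v) s := by
          rintro q rfl
          exact k₂ q hp
        rcases chop_ioc huw (k₁ p hp) with ⟨w', h₁, h₂, l₁, l₂⟩ | ⟨-, l₁⟩
        · exact chop_ioc_intro h₁ (h₂.trans hwv) l₁ (idle_join l₂ hi)
        · exact chop_ioc_intro huw hwv l₁ hi
      · exact k₁ p hp
    rintro Q Δ s (rfl | ⟨p, rfl, hp⟩ | ⟨P₁, P₂, i₁, i₂, rfl, -, -, -, -, c₁, c₂⟩ | ⟨-, h, -⟩)
    · exact fun p hp => absurd hp (Set.notMem_empty p)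
    · rintro q rfl
      obtain ⟨u, v, huv, rfl⟩ := exists_ioc Δ
      refine chop_ioc_intro huv le_rfl hp ?_
      intro r _ va _ t ht
      exact absurd ht.1 (not_lt.2 ht.2)
    · rintro p (hp | hp)
      · exact half P₁ i₁ Δ s c₁ p hp
      · exact half P₂ i₂ Δ s c₂ p hp
    · exact h
  exact key Q Δ s hb

/-- The initial condition in terms of the addresses `h` and `tl` of the sentinel nodes. -/
theorem HTInit.fields {σ : State Proc} (hI : HTInit σ) : ∃ h tl : ℕ,
    σ.mem (Sum.inl .Head) = .addr h ∧ σ.mem (Sum.inl .Tail) = .addr tl ∧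
    (σ.mem (Sum.inr (h + Field.val.offset)) = .key ⊥ ∧
      σ.mem (Sum.inr (h + Field.nxt.offset)) = .addr tl ∧
      σ.mem (Sum.inr (h + Field.mrk.offset)) = .bool false ∧
      σ.mem (Sum.inr (h + Field.lck.offset)) = .null) ∧
    (σ.mem (Sum.inr (tl + Field.val.offset)) = .key ⊤ ∧
      σ.mem (Sum.inr (tl + Field.nxt.offset)) = .null ∧
      σ.mem (Sum.inr (tl + Field.mrk.offset)) = .bool false ∧
      σ.mem (Sum.inr (tl + Field.lck.offset)) = .null) := by
  obtain ⟨⟨h₁, h₂, h₃, h₄⟩, k₁, k₂, k₃, k₄⟩ := hI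
  have fld : ∀ {v : Var Proc} {f : Field} {k : Val Proc},
      (Expr.eq ((Expr.var v).at f) (.const k)).holds σ →
      ∃ a, σ.mem (Sum.inl v) = .addr a ∧ σ.mem (Sum.inr (a + f.offset)) = k := by
    intro v f k hh
    obtain ⟨a, e₁, e₂⟩ := eval_at.1 (eval_eq_const.1 hh)
    exact ⟨a, Option.some.inj e₁, Option.some.inj e₂⟩
  obtain ⟨h, e₁, e₂⟩ := fld h₁
  obtain ⟨_, e₃, e₄⟩ := fld h₃
  obtain ⟨_, e₅, e₆⟩ := fld h₄
  obtain ⟨tl, f₁, f₂⟩ := fld k₁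
  obtain ⟨_, f₃, f₄⟩ := fld k₂
  obtain ⟨_, f₅, f₆⟩ := fld k₃
  obtain ⟨_, f₇, f₈⟩ := fld k₄
  rw [e₁] at e₃ e₅
  cases e₃; cases e₅
  rw [f₁] at f₃ f₅ f₇
  cases f₃; cases f₅; cases f₇
  obtain ⟨w₁, w₂, g₁, g₂, g₃⟩ := eval_eq.1 h₂
  obtain rfl := g₃.1 rfl
  obtain ⟨a, g₄, g₅⟩ := eval_at.1 g₁
  have e₇ : σ.mem (Sum.inl .Head) = .addr a := Option.some.inj g₄
  rw [e₁] at e₇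
  cases e₇
  have g₆ : σ.mem (Sum.inl .Tail) = w₁ := Option.some.inj g₂
  have g₇ : σ.mem (Sum.inr (h + Field.nxt.offset)) = w₁ := Option.some.inj g₅
  refine ⟨h, tl, e₁, f₁, ⟨e₂, ?_, e₄, e₆⟩, f₂, f₄, f₆, f₈⟩
  rw [g₇, ← g₆, f₁]

theorem atStart.elim {c : StatePred Proc} {Δ : Intv} (hc : atStart c Δ s) :
    ∃ t₀ ∈ Δ.1, ∀ t ∈ Δ.1, t ≤ t₀ → c (s t) := by
  rcases hc with ⟨Δ₁, Δ₂, hu, ha, ⟨hall, hne⟩, -⟩ | ⟨-, hall, hne⟩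
  · obtain ⟨t₀, ht₀⟩ := Set.nonempty_iff_ne_empty.2 hne
    refine ⟨t₀, hu ▸ Or.inl ht₀, fun t ht hle => ?_⟩
    rw [hu] at ht
    rcases ht with ht | ht
    · exact hall t ht
    · have := ha.1 t₀ ht₀ t ht
      omega
  · obtain ⟨t₀, ht₀⟩ := Set.nonempty_iff_ne_empty.2 hne
    exact ⟨t₀, ht₀, fun t ht _ => hall t ht⟩

/-- A variable that is never written has the same value throughout an interval. -/
theorem mem_const {Δ : Intv} (hh : Healthy s) {va : Loc Proc}
    (hw : ∀ t ∈ Δ.1, ∀ q, ¬ CanWrite va q (s t)) {t u : ℤ} (ht : t ∈ Δ.1) (hu : u ∈ Δ.1) :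
    (s t).mem va = (s u).mem va := by
  have aux : ∀ t u, t ∈ Δ.1 → u ∈ Δ.1 → t ≤ u → (s u).mem va = (s t).mem va := by
    intro t u ht hu htu
    refine int_stable (J := fun u => (s u).mem va = (s t).mem va) htu rfl fun r h₁ h₂ e => ?_
    rw [← e]
    by_contra hne
    obtain ⟨q, hq⟩ := hh.frame r va hne
    exact hw r (Δ.2.out ht hu ⟨h₁.le, h₂⟩) q hq
  rcases le_total t u with h | h
  · exact (aux t u ht hu h).symm
  · exact aux u t hu ht h

/-- No command writes to the variables `Head` and `Tail`, so the sentinel nodes are fixed. -/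
theorem exists_sys {Δ : Intv} (hh : Healthy s) (hr : sysRely P Δ s)
    (hc : ∀ p ∈ P, chop (beh (S p) {p} HT) (idleBeh {p} HT) Δ s) :
    ∃ h tl t₀, Sys s Δ.1 P h tl t₀ := by
  obtain ⟨hst, hext⟩ := hr
  obtain ⟨t₀, ht₀, hinit⟩ := hst.elim
  obtain ⟨h, tl, eh, et, -⟩ := (hinit t₀ ht₀ le_rfl).fields
  have hwrite : ∀ va : Loc Proc, va ∈ ({Sum.inl .Head, Sum.inl .Tail} : Set (Loc Proc)) →
      ∀ t ∈ Δ.1, ∀ q, ¬ CanWrite va q (s t) := by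
    intro va hva t ht q hq
    have hHT : va ∈ HT := Or.inr hva
    by_cases hqP : q ∈ P
    · refine NoWrite.chop (p := q) (W := {Sum.inl .Head, Sum.inl .Tail}) (fun Δ s k => ?_)
        (fun Δ s k => idle_mono (fun w hw => Or.inr hw) k) Δ s (hc q hqP) q rfl va hva t ht hq
      exact NoWrite.omega (nonEmp_op _) noWrite_op_sentinels Δ s (beh_S_iff.1 k)
    · exact hext t ht ⟨va, hHT, q, hqP, hq⟩
  have hhead : ∀ t ∈ Δ.1, (s t).mem (Sum.inl .Head) = .addr h := fun t ht =>
    (mem_const hh (hwrite _ (by simp)) ht ht₀).trans eh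
  have htail : ∀ t ∈ Δ.1, (s t).mem (Sum.inl .Tail) = .addr tl := fun t ht =>
    (mem_const hh (hwrite _ (by simp)) ht ht₀).trans et
  have hfields := fun t ht h₀ => (hinit t ht h₀).fields
  refine ⟨h, tl, t₀, hh, Δ.2, ht₀, hhead, htail, fun t ht h₀ => ?_, fun t ht h₀ => ?_, ?_⟩
  · obtain ⟨h', tl', e₁, e₂, k, -⟩ := hfields t ht h₀
    rw [hhead t ht] at e₁
    rw [htail t ht] at e₂
    cases e₁; cases e₂
    exact k
  · obtain ⟨h', tl', e₁, e₂, -, k⟩ := hfields t ht h₀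
    rw [hhead t ht] at e₁
    rw [htail t ht] at e₂
    cases e₁; cases e₂
    exact k
  · intro t ht q b hq
    by_contra hqP
    exact hext t ht ⟨_, addr_mem_HT b, q, hqP, hq⟩

/-- A process of the system makes permitted changes only, provided that all earlier changes are
permitted. -/
theorem goodAt_of_component {Δ : Intv} (hP : Past s Δ.1 P h tl t₀ T) (hT : T ∈ Δ.1)
    (hc : chop (beh (S p) {p} HT) (idleBeh {p} HT) Δ s) : GoodAt s Δ.1 h tl p T := by
  obtain ⟨u, v, huv, rfl⟩ := exists_ioc Δ
  have hop := (Walk.omega (nonEmp_op (p := p) _) (walk_op hP)).mono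
    (g' := beh (S p) {p} HT) (fun _ => beh_S_iff.1) (fun _ => id) (fun _ => id)
  refine (Walk.chop (C := fun _ => True) hop ?_ u v huv hT.1 subset_rfl hc trivial).1 hT.2
  intro u' v' _ hu' hD hg _
  exact ⟨fun hv' => GoodAt.of_idle (hD ⟨hu', hv'⟩) fun b =>
    idle_of_mem hg hu' hv' (addr_mem_HT b), fun _ => trivial⟩

theorem goodStep_of_goodAt (hP : Past s D P h tl t₀ T) (hT : T ∈ D) (hT' : T - 1 ∈ D)
    (hg : ∀ p ∈ P, GoodAt s D h tl p T) : GoodStep s D h tl t₀ T := by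
  have step : ∀ b, (s T).mem (Sum.inr b) ≠ (s (T - 1)).mem (Sum.inr b) →
      ∃ p, CanWrite (Sum.inr b) p (s T) ∧ Permitted s D h tl p T b := by
    intro b hne
    obtain ⟨q, hq⟩ := hP.sys.healthy.frame T _ hne
    exact ⟨q, hq, hg q (hP.sys.ext T hT q b hq) b hne hq⟩
  refine ⟨fun a f ha hne => ?_, fun _ => step⟩
  obtain ⟨q, hq, hp⟩ := step _ hne
  have hk := (hP.inv (T - 1) hT' (by omega)).known a ha
  refine ⟨q, hq, ?_⟩
  rcases hp with ⟨a', f', e, ha', hch⟩ | ⟨c, t₁, ⟨f', e⟩, -, hal, hc⟩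
  · obtain ⟨rfl, rfl⟩ := hP.sys.known_unique hk
      ((hP.inv (T - 1) hT' (by omega)).known a' ha') e
    exact hch
  · obtain ⟨rfl, -⟩ := hP.sys.known_unique hk (Or.inr (Or.inr ⟨q, t₁, le_rfl, hal⟩)) e
    exact absurd ha hc

/-- All steps of a run of the system are permitted. -/
theorem past_of_run {Δ : Intv} (hS : Sys s Δ.1 P h tl t₀)
    (hc : ∀ p ∈ P, chop (beh (S p) {p} HT) (idleBeh {p} HT) Δ s) (T : ℤ) :
    Past s Δ.1 P h tl t₀ T := by
  have key : ∀ (k : ℕ) (t : ℤ), t ∈ Δ.1 → t₀ < t → (t - t₀).toNat ≤ k →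
      GoodStep s Δ.1 h tl t₀ t := by
    intro k
    induction k with
    | zero => intro t _ h₁ h₂; omega
    | succ k ih =>
      intro t ht h₁ h₂
      have hP : Past s Δ.1 P h tl t₀ t := Past.of_good hS fun u hu _ h₀ hut =>
        ih u hu h₀ (by omega)
      have ht' : t - 1 ∈ Δ.1 := hS.conn.out hS.mem₀ ht ⟨by omega, by omega⟩
      exact goodStep_of_goodAt hP ht ht' fun p hp => goodAt_of_component hP ht (hc p hp)
  exact Past.of_good hS fun t ht _ h₀ _ => key _ t ht h₀ le_rfl

/-! ### The refinement -/

theorem isInf_mono {Δ Δ' : Intv} (h : Δ.1 ⊆ Δ'.1) (hi : Δ.IsInf) : Δ'.IsInf :=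
  fun hb => hi (hb.mono h)

theorem n1_notMem_small : (Sum.inl (.n1 p) : Loc Proc) ∉ HT ∪ resVar p := by
  simp [HT, resVar]

theorem small_subset_fullCtx : HT ∪ resVar p ⊆ fullCtx p := Set.subset_union_left

/-- The constant expression `k` evaluates to `k` in the empty interval. -/
theorem eval_const_empty {k : Val Proc} {Z : Set (Loc Proc)} (w : Pos) :
    evalBeh p Z (.eq (.const k) (.const k)) (ioc w w) s := by
  have he : ∀ t, t ∉ (ioc w w).1 := fun t ht => absurd ht.1 (not_lt.2 ht.2)
  refine ⟨⟨fun _ => none, ⟨fun va hva => ?_, fun _ _ => rfl⟩, eval_eq_const.2 rfl⟩,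
    fun q _ va _ t ht => absurd ht (he t)⟩
  obtain ⟨t, ht, -⟩ := hva
  exact absurd ht (he t)

/-- A run of `Contains` is a run of its abstraction. -/
theorem contains_refines {Δ Δ' : Intv} {x : ℤ} (hP : ∀ T, Past s Δ.1 P h tl t₀ T)
    (hsub : Δ'.1 ⊆ Δ.1) (hg : beh (Contains p x) {p} (fullCtx p) Δ' s) :
    beh (CGCon p x) {p} (HT ∪ resVar p) Δ' s := by
  obtain ⟨u, v, huv, rfl⟩ := exists_ioc Δ'
  have hidleCL : NoWrite p (HT ∪ resVar p) (beh (CL p x) {p} (fullCtx p)) :=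
    .CL small_subset_fullCtx n1_notMem_small x
  -- A run that never assigns the result is abstracted by an infinite test.
  have inf : (ioc u v).IsInf → idleBeh {p} (HT ∪ resVar p) (ioc u v) s →
      beh (CGCon p x) {p} (HT ∪ resVar p) (ioc u v) s := by
    intro hi hid
    obtain ⟨t, ht⟩ := IsInf.nonempty hi
    by_cases hx : inAbs x (s t)
    · exact Or.inl (Or.inr ⟨hi, p, rfl, ⟨t, ht, hx⟩, hid⟩)
    · exact Or.inr (Or.inr ⟨hi, p, rfl, ⟨t, ht, hx⟩, hid⟩)
  rcases chop_ioc huv hg with ⟨w, huw, hwv, k₁, -, k₂⟩ | ⟨hi, k₁⟩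
  swap
  · exact inf hi (hidleCL _ _ k₁)
  obtain ⟨k, k₂⟩ := solo_singleton k₂
  rcases chop_ioc hwv k₂ with ⟨w', hw₁, hw₂, l₁, l₂⟩ | ⟨hi, l₁⟩
  swap
  · exact inf (isInf_mono (Δ := ioc w v) (fun t ht => ⟨huw.trans_lt ht.1, ht.2⟩) hi)
      (idle_join (hidleCL _ _ k₁) (idle_mono small_subset_fullCtx l₁.2))
  have hid : idleBeh {p} (HT ∪ resVar p) (ioc u w') s :=
    idle_join (hidleCL _ _ k₁) (idle_mono small_subset_fullCtx l₁.2)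
  obtain ⟨T, hT⟩ := update_nonempty _ _ l₂
  obtain ⟨σ, -, hσ⟩ := l₁.1.elim
  obtain ⟨b₁, b₂, -, -, rfl⟩ := eval_and.1 (eval_eq_const.1 hσ)
  have hsub' : (ioc u w').1 ⊆ Δ.1 := fun t ht => hsub ⟨ht.1, ht.2.trans hw₂⟩
  have hJ := (walk_CL_eval (hP T) hsub' (ioc u w').2 addr_mem_fullCtx own_n1
    (r := b₁ && b₂) (fun σ hσ => eval_eq_const.1 hσ) u w' (huw.trans hw₁)
    ((huw.trans hw₁).trans_lt hT.1) subset_rfl (chop_ioc_intro huw hw₁ k₁ l₁) trivial).2 hT.1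
  obtain ⟨n, -, -, t, ht, hr⟩ := hJ
  have hres : ∀ b, update p (fullCtx p) (Sum.inl (.res p)) (.bool b) (ioc w' v) s →
      beh (.assign (.res p) (.const (.bool b))) {p} (HT ∪ resVar p) (ioc w' v) s := by
    intro b hu
    refine ⟨p, rfl, .bool b, chop_ioc_intro le_rfl hw₂ (eval_const_empty _) ?_⟩
    exact ⟨idle_mono (Set.sdiff_subset_sdiff_left small_subset_fullCtx) hu.1, hu.2⟩
  cases hb : (b₁ && b₂) with
  | true =>
    rw [hb] at l₂ hr
    exact Or.inl (chop_ioc_intro (huw.trans hw₁) hw₂ ⟨p, rfl, ⟨t, ht, hr⟩, hid⟩ (hres _ l₂))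
  | false =>
    rw [hb] at l₂ hr
    exact Or.inr (chop_ioc_intro (huw.trans hw₁) hw₂ ⟨p, rfl, ⟨t, ht, by simpa using hr⟩, hid⟩
      (hres _ l₂))

/-- A traversal followed by the evaluation of a guard that determines the outcome `r` is a test of
the abstract set. -/
theorem test_refines {Δ Δ' : Intv} {x : ℤ} {c : Expr Proc} {r : Bool}
    (hP : ∀ T, Past s Δ.1 P h tl t₀ T) (hsub : Δ'.1 ⊆ Δ.1) (hfin : Δ'.IsFin)
    (hr : ∀ σ, c.eval σ = some (.bool true) → (IN p x).eval σ = some (.bool r))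
    (hg : beh (CL p x ;; .label .cl3 (.guard c)) {p} (fullCtx p) Δ' s) :
    beh (.aguard fun σ => if r then inAbs x σ else notInAbs x σ) {p} (HT ∪ resVar p) Δ' s := by
  have hid : NoWrite p (HT ∪ resVar p)
      (beh (CL p x ;; .label .cl3 (.guard c)) {p} (fullCtx p)) :=
    .seq (.CL small_subset_fullCtx n1_notMem_small x)
      (.label (.guard small_subset_fullCtx _))
  refine ⟨p, rfl, ?_, hid _ _ hg⟩
  have hne := nonEmp_seq_left (nonEmp_CL p x {p}) Δ' s hg
  obtain ⟨u, v, huv, rfl⟩ := exists_ioc Δ'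
  obtain ⟨m, hm⟩ := not_not.1 hfin
  obtain ⟨t, ht⟩ := hne
  have hv : v < ((m + 1 : ℤ) : Pos) := by
    by_contra hle
    have h₁ : m + 1 ∈ (ioc u v).1 := by
      refine ⟨ht.1.trans ?_, not_lt.1 hle⟩
      have := hm ht
      norm_cast; omega
    have := hm h₁
    omega
  have hg' : chop (beh (CL p x) {p} (fullCtx p)) (evalBeh p (fullCtx p) c) (ioc u v) s :=
    chop_mono le_rfl (fun Δ s k => solo_singleton k.2) _ _ hg
  obtain ⟨n, -, -, hJ⟩ := (walk_CL_eval (hP (m + 1)) hsub (ioc u v).2 addr_mem_fullCtx own_n1 hr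
    u v huv (huv.trans_lt hv) subset_rfl hg' trivial).2 hv
  exact hJ

theorem omega_coinduct {g z : IntvPred Proc} (hz : z ≤ chop g z ⊔ fun Δ _ => Δ.IsEmpty) :
    z ≤ omega g := OrderHom.le_gfp _ hz

/-- By coinduction on the iteration, since only `Contains` differs from its abstraction. -/
theorem S_refines {Δ Δ' : Intv} (hP : ∀ T, Past s Δ.1 P h tl t₀ T)
    (hsub : Δ'.1 ⊆ Δ.1) (hg : beh (S p) {p} HT Δ' s) : beh (CGS p) {p} HT Δ' s := by
  have hd₁ : (HT ∩ resVar p : Set (Loc Proc)) = ∅ := by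
    ext va
    simp only [HT, resVar, Set.mem_inter_iff, Set.mem_union, Set.mem_range, Set.mem_insert_iff,
      Set.mem_singleton_iff, Set.mem_empty_iff_false, iff_false, not_and]
    rintro (⟨b, rfl⟩ | rfl | rfl) <;> simp
  have hd₂ : ((HT ∪ resVar p) ∩ nVars p : Set (Loc Proc)) = ∅ := by
    ext va
    simp only [HT, resVar, nVars, Set.mem_inter_iff, Set.mem_union, Set.mem_range,
      Set.mem_insert_iff, Set.mem_singleton_iff, Set.mem_empty_iff_false, iff_false, not_and]
    rintro ((⟨b, rfl⟩ | rfl | rfl) | rfl) <;> simp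
  have hop : ∀ Δ₁ : Intv, Δ₁.1 ⊆ Δ.1 → beh (op p) {p} (fullCtx p) Δ₁ s →
      beh (.choiceInt fun x => .context (nVars p) (Add p x ⊓⊓ Remove p x) ⊓⊓ CGCon p x) {p}
        (HT ∪ resVar p) Δ₁ s := by
    rintro Δ₁ h₁ ⟨x, h | h | h⟩
    · exact ⟨x, Or.inl ⟨hd₂, Or.inl h⟩⟩
    · exact ⟨x, Or.inl ⟨hd₂, Or.inr h⟩⟩
    · exact ⟨x, Or.inr (contains_refines hP h₁ h)⟩
  refine ⟨hd₁, omega_coinduct (z := fun Δ₁ s₁ => s₁ = s ∧ Δ₁.1 ⊆ Δ.1 ∧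
    omega (beh (op p) {p} (fullCtx p)) Δ₁ s₁) ?_ _ _ ⟨rfl, hsub, beh_S_iff.1 hg⟩⟩
  rintro Δ₁ _ ⟨rfl, h₁, ho⟩
  rcases omega_unfold ho with (⟨A, B, hu, ha, hA, hB⟩ | ⟨hi, hA⟩) | he
  · have hAs : A.1 ⊆ Δ.1 := fun t ht => h₁ (hu ▸ Or.inl ht)
    have hBs : B.1 ⊆ Δ.1 := fun t ht => h₁ (hu ▸ Or.inr ht)
    exact Or.inl (Or.inl ⟨A, B, hu, ha, hop A hAs hA, rfl, hBs, hB⟩)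
  · exact Or.inl (Or.inr ⟨hi, hop _ h₁ hA⟩)
  · exact Or.inr he

/-- Parallel composition is monotone, where the components are compared on the subintervals of a
given interval only. -/
theorem parBeh_mono_on {b b' : Proc → IntvPred Proc} {Z : Set (Loc Proc)} {Δ : Intv}
    (hb : ∀ p ∈ P, ∀ Δ' : Intv, Δ'.1 ⊆ Δ.1 → b p Δ' s → b' p Δ' s) (h : parBeh b Z P Δ s) :
    parBeh b' Z P Δ s := by
  have key : parBeh b Z ≤ fun Q Δ' s' => s' = s → Q ⊆ P → Δ'.1 ⊆ Δ.1 → parBeh b' Z Q Δ' s' := by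
    refine OrderHom.lfp_le _ ?_
    rintro Q Δ' s' hst hs hQ hsub
    obtain rfl : s = s' := hs.symm
    have hfix : parBeh b' Z = parStep b' Z (parBeh b' Z) := (OrderHom.map_lfp ⟨_, _⟩).symm
    rw [hfix]
    have half : ∀ Q' ⊆ P, ∀ g : IntvPred Proc, chop (fun Δ' s' => s' = s → Q' ⊆ P → Δ'.1 ⊆ Δ.1 →
        parBeh b' Z Q' Δ' s') g Δ' s → chop (parBeh b' Z Q') g Δ' s := by
      rintro Q' hQ' g (⟨A, B, hu, ha, hA, hB⟩ | ⟨hi, hA⟩)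
      · exact Or.inl ⟨A, B, hu, ha, hA rfl hQ' fun t ht => hsub (hu ▸ Or.inl ht), hB⟩
      · exact Or.inr ⟨hi, hA rfl hQ' hsub⟩
    rcases hst with rfl | ⟨p, rfl, hp⟩ | ⟨P₁, P₂, i₁, i₂, rfl, hd, n₁, n₂, hi, c₁, c₂⟩ |
      ⟨hinf, hall, hex⟩
    · exact Or.inl rfl
    · exact Or.inr (Or.inl ⟨p, rfl, hb p (hQ rfl) Δ' hsub hp⟩)
    · exact Or.inr (Or.inr (Or.inl ⟨P₁, P₂, i₁, i₂, rfl, hd, n₁, n₂, hi,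
        half P₁ (fun q hq => hQ (Or.inl hq)) _ c₁, half P₂ (fun q hq => hQ (Or.inr hq)) _ c₂⟩))
    · refine Or.inr (Or.inr (Or.inr ⟨hinf, fun p hp => ?_, fun hi => ?_⟩))
      · rcases hall p hp with ⟨A, B, hu, ha, hA, hB⟩ | ⟨hi, hA⟩
        · exact Or.inl ⟨A, B, hu, ha, hb p (hQ hp) A (fun t ht => hsub (hu ▸ Or.inl ht)) hA, hB⟩
        · exact Or.inr ⟨hi, hb p (hQ hp) Δ' hsub hA⟩
      · obtain ⟨p, hp, k⟩ := hex hi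
        exact ⟨p, hp, hb p (hQ hp) Δ' hsub k⟩
  exact key P Δ s h rfl subset_rfl subset_rfl

theorem exists_past {Δ : Intv} (hh : Healthy s) (hr : sysRely P Δ s)
    (hb : beh (.par P S) P HT Δ s) : ∃ h tl t₀, ∀ T, Past s Δ.1 P h tl t₀ T := by
  have hc := component_of_par hb.2
  obtain ⟨h, tl, t₀, hS⟩ := exists_sys hh hr hc
  exact ⟨h, tl, t₀, past_of_run hS hc⟩

end System

end LazySet

theorem mainTheorem1 {Proc : Type*} (P : Set Proc) :
    LazySet.Refines P ∅ ∅ (LazySet.CGSet P) (LazySet.LSet P) ∧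
    ∀ (Δ : LazySet.Intv) (s : LazySet.Stream Proc), LazySet.Healthy s →
      LazySet.sysRely P Δ s → LazySet.beh (.par P LazySet.S) P LazySet.HT Δ s →
      ∀ p ∈ P, ∀ Δ' : LazySet.Intv, Δ'.1 ⊆ Δ.1 →
        (LazySet.beh (LazySet.S p) {p} LazySet.HT Δ' s →
          LazySet.beh (LazySet.CGS p) {p} LazySet.HT Δ' s) ∧
        ∀ x : ℤ, Δ'.IsFin →
          (LazySet.beh (.seq (LazySet.CL p x) (.label .cl3 (.guard (LazySet.IN p x)))) {p}
              (LazySet.HT ∪ LazySet.resVar p ∪ LazySet.nVars p) Δ' s →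
            LazySet.beh (.aguard (LazySet.inAbs x)) {p}
              (LazySet.HT ∪ LazySet.resVar p) Δ' s) ∧
          (LazySet.beh (.seq (LazySet.CL p x) (.label .cl3 (.guard (.not (LazySet.IN p x))))) {p}
              (LazySet.HT ∪ LazySet.resVar p ∪ LazySet.nVars p) Δ' s →
            LazySet.beh (.aguard (LazySet.notInAbs x)) {p}
              (LazySet.HT ∪ LazySet.resVar p) Δ' s) := by
  constructor
  · rintro Δ s hh ⟨-, hb⟩
    rw [Set.empty_union] at hb
    refine ⟨Set.empty_inter _, ?_⟩
    rw [Set.empty_union]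
    intro hr
    obtain ⟨h, tl, t₀, hP⟩ := LazySet.exists_past hh hr (hb hr)
    exact ⟨rfl, LazySet.parBeh_mono_on (fun p _ Δ' hsub hg => LazySet.S_refines hP hsub hg)
      (hb hr).2⟩
  · intro Δ s hh hr hb p _ Δ' hsub
    obtain ⟨h, tl, t₀, hP⟩ := LazySet.exists_past hh hr hb
    refine ⟨LazySet.S_refines hP hsub, fun x hfin => ⟨fun hg => ?_, fun hg => ?_⟩⟩
    · have := LazySet.test_refines (r := true) hP hsub hfin (fun σ k => k) hg
      simpa only [if_true] using this
    · have := LazySet.test_refines (r := false) hP hsub hfin (fun σ k => LazySet.eval_not.1 k) hg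
      simpa only [Bool.false_eq_true, if_false] using this
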